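/- Let $\triangle=\{(x,y): x\ge 0,\ y\ge 0,\ x+y\le 1\}$. All functions are real valued and all derivatives are weak derivatives in the interior of $\triangle$; write $\partial_1=\partial_x$, $\partial_2=\partial_y$, $\partial_3=\partial_2-\partial_1$. For real $\alpha,\beta,\gamma$ let $\varpi_{\alpha,\beta,\gamma}(x,y)=x^\alpha y^\beta(1-x-y)^\gamma$, and for $\alpha,\beta,\gamma>-1$ let $\langle f,g\rangle_{\alpha,\beta,\gamma}=\int_\triangle fg\,\varpi_{\alpha,\beta,\gamma}\,dx\,dy$, let $\|\cdot\|_{\alpha,\beta,\gamma}$ be the norm of $L^2(\varpi_{\alpha,\beta,\gamma})$, and let $$E_n(f)_{\alpha,\beta,\gamma}=\inf\{\|f-p\|_{\alpha,\beta,\gamma}: p \text{ a polynomial of total degree at most } n\},$$ which is $+\infty$ if $f\notin L^2(\varpi_{\alpha,\beta,\gamma})$. Let $\mathcal W_2^1(\varpi_{\alpha,\beta,\gamma})$ be the space of all $f\in L^2(\varpi_{\alpha,\beta,\gamma})$ with $\partial_1f\in L^2(\varpi_{\alpha+1,\beta,\gamma+1})$, $\partial_2f\in L^2(\varpi_{\alpha,\beta+1,\gamma+1})$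 and $\partial_3f\in L^2(\varpi_{\alpha+1,\beta+1,\gamma})$. For $a,b\in\mathbb R$ and an integer $n\ge 0$ let $$J_n^{a,b}(t)=\sum_{k=\iota_0}^n\frac{(k+a+1)_{n-k}}{(n-k)!\,k!\,(n+a+b+k+1)_{n-k}}\Big(\frac{t-1}{2}\Big)^k,$$ where $(c)_m=c(c+1)\cdots(c+m-1)$, and $\iota_0=-n-a-b$ if this number lies in $\{1,\dots,n\}$, $\iota_0=0$ otherwise. For $0\le k\le n$ put $$J_{k,n}^{\alpha,\beta,\gamma}(x,y)=(x+y)^kJ_k^{\alpha,\beta}\big(\tfrac{y-x}{x+y}\big)J_{n-k}^{2k+\alpha+\beta+1,\gamma}(1-2x-2y),$$ $$K_{k,n}^{\alpha,\beta,\gamma}(x,y)=(1-y)^kJ_k^{\gamma,\alpha}\big(\tfrac{2x}{1-y}-1\big)J_{n-k}^{2k+\alpha+\gamma+1,\beta}(2y-1),$$ $$L_{k,n}^{\alpha,\beta,\gamma}(x,y)=(1-x)^kJ_k^{\beta,\gamma}\big(1-\tfrac{2y}{1-x}\big)J_{n-k}^{2k+\beta+\gamma+1,\alpha}(2x-1).$$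 Fix $\lambda>0$. With boundary values taken in the sense of traces, let $$\langle f,g\rangle_{\alpha,\beta,-1}=\langle\partial_1f,\partial_1g\rangle_{\alpha+1,\beta,0}+\langle\partial_2f,\partial_2g\rangle_{\alpha,\beta+1,0}+\lambda\int_0^1f(t,1-t)\,g(t,1-t)\,t^\alpha(1-t)^\beta\,dt,$$ $$\langle f,g\rangle_{\alpha,-1,\gamma}=\langle\partial_2f,\partial_2g\rangle_{\alpha,0,\gamma+1}+\langle\partial_3f,\partial_3g\rangle_{\alpha+1,0,\gamma}+\lambda\int_0^1f(t,0)\,g(t,0)\,t^\alpha(1-t)^\gamma\,dt,$$ $$\langle f,g\rangle_{-1,\beta,\gamma}=\langle\partial_3f,\partial_3g\rangle_{0,\beta+1,\gamma}+\langle\partial_1f,\partial_1g\rangle_{0,\beta,\gamma+1}+\lambda\int_0^1f(0,t)\,g(0,t)\,t^\beta(1-t)^\gamma\,dt.$$ Let $S_n^{\alpha,\beta,-1}f$, $S_n^{\alpha,-1,\gamma}f$ and $S_n^{-1,\beta,\gamma}f$ be the partial sums $\sum_{m=0}^n\sum_{k=0}^m\frac{\langle f,P_{k,m}\rangle}{\langle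 P_{k,m},P_{k,m}\rangle}P_{k,m}$ for the first inner product with $P_{k,m}=J_{k,m}^{\alpha,\beta,-1}$, the second with $P_{k,m}=K_{k,m}^{\alpha,-1,\gamma}$, and the third with $P_{k,m}=L_{k,m}^{-1,\beta,\gamma}$, respectively. **Theorem.** (1) Let $\alpha,\beta>-1$. There is a constant $c>0$ depending only on $\alpha,\beta$ such that for all $f\in\mathcal W_2^1(\varpi_{\alpha,\beta,0})$ and $n=1,2,3,\dots$ $$\|f-S_n^{\alpha,\beta,-1}f\|_{\alpha,\beta,0}\le\frac cn\Big[E_{n-1}(\partial_1f)_{\alpha+1,\beta,0}+E_{n-1}(\partial_2f)_{\alpha,\beta+1,0}\Big].$$ (2) Let $\alpha,\gamma>-1$. There is a constant $c>0$ depending only on $\alpha,\gamma$ such that for all $f\in\mathcal W_2^1(\varpi_{\alpha,0,\gamma})$ and $n=1,2,3,\dots$ $$\|f-S_n^{\alpha,-1,\gamma}f\|_{\alpha,0,\gamma}\le\frac cn\Big[E_{n-1}(\partial_2f)_{\alpha,0,\gamma+1}+E_{n-1}(\partial_3f)_{\alpha+1,0,\gamma}\Big].$$ (3) Let $\beta,\gamma>-1$.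 There is a constant $c>0$ depending only on $\beta,\gamma$ such that for all $f\in\mathcal W_2^1(\varpi_{0,\beta,\gamma})$ and $n=1,2,3,\dots$ $$\|f-S_n^{-1,\beta,\gamma}f\|_{0,\beta,\gamma}\le\frac cn\Big[E_{n-1}(\partial_3f)_{0,\beta+1,\gamma}+E_{n-1}(\partial_1f)_{0,\beta,\gamma+1}\Big].$$ The inequalities are understood in $[0,\infty]$: if the right-hand side is $+\infty$ (in which case $S_nf$ need not be defined) nothing is claimed. -/

import Mathlib

open MeasureTheory

namespace Tri

noncomputable section

/-! ### The triangle, weights, norms, best approximation -/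

/-- The closed triangle. -/
def closedTri : Set (ℝ × ℝ) := {p | 0 ≤ p.1 ∧ 0 ≤ p.2 ∧ p.1 + p.2 ≤ 1}

/-- The open triangle (it differs from the closed one by a null set). -/
def tri : Set (ℝ × ℝ) := {p | 0 < p.1 ∧ 0 < p.2 ∧ p.1 + p.2 < 1}

/-- The weight `x ^ α * y ^ β * (1 - x - y) ^ γ`. -/
def weight (α β γ : ℝ) (p : ℝ × ℝ) : ℝ := p.1 ^ α * p.2 ^ β * (1 - p.1 - p.2) ^ γ

/-- The measure `weight α β γ dx dy` on the triangle. -/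
def wMeasure (α β γ : ℝ) : Measure (ℝ × ℝ) :=
  (volume.restrict tri).withDensity fun p => ENNReal.ofReal (weight α β γ p)

/-- The norm of `L²(weight α β γ)`, equal to `∞` for measurable functions outside this space. -/
def wNorm (α β γ : ℝ) (f : ℝ × ℝ → ℝ) : ENNReal := eLpNorm f 2 (wMeasure α β γ)

/-- Error of best approximation of `f` in `L²(weight α β γ)` by polynomials of total degree at
most `n`; it is finite exactly for `f` in that space when `α, β, γ > -1`. -/
def bestApprox (n : ℕ) (f : ℝ × ℝ → ℝ) (α β γ : ℝ) : ENNReal :=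
  ⨅ q : {q : MvPolynomial (Fin 2) ℝ // q.totalDegree ≤ n},
    wNorm α β γ fun p => f p - MvPolynomial.eval ![p.1, p.2] q.1

/-- The inner product of `L²(weight α β γ)`. -/
def wInner (α β γ : ℝ) (f g : ℝ × ℝ → ℝ) : ℝ :=
  ∫ p in tri, f p * g p * weight α β γ p

/-! ### Weak derivatives and the weighted Sobolev space -/

/-- `g` is the weak derivative of `f` in direction `v` on the open triangle. -/
def HasWeakDeriv (v : ℝ × ℝ) (f g : ℝ × ℝ → ℝ) : Prop :=
  LocallyIntegrableOn f tri ∧ LocallyIntegrableOn g tri ∧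
    ∀ φ : ℝ × ℝ → ℝ, ContDiff ℝ (⊤ : ℕ∞) φ → HasCompactSupport φ → tsupport φ ⊆ tri →
      ∫ p in tri, f p * fderiv ℝ φ p v = - ∫ p in tri, g p * φ p

open Classical in
/-- The weak derivative of `f` in direction `v` (a representative; unique almost everywhere). -/
def weakDeriv (v : ℝ × ℝ) (f : ℝ × ℝ → ℝ) : ℝ × ℝ → ℝ :=
  if h : ∃ g, HasWeakDeriv v f g then h.choose else 0

/-- Direction of `∂₁ = ∂/∂x`. -/
def d1 : ℝ × ℝ := (1, 0)

/-- Direction of `∂₂ = ∂/∂y`. -/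
def d2 : ℝ × ℝ := (0, 1)

/-- Direction of `∂₃ = ∂₂ - ∂₁`. -/
def d3 : ℝ × ℝ := (-1, 1)

/-- The weighted Sobolev space of first order with parameters `α, β, γ`: `f`, `∂₁ f`, `∂₂ f`,
`∂₃ f` are square integrable with respect to the weights with parameters `(α, β, γ)`,
`(α + 1, β, γ + 1)`, `(α, β + 1, γ + 1)`, `(α + 1, β + 1, γ)`, respectively. -/
def MemSobolev (α β γ : ℝ) (f : ℝ × ℝ → ℝ) : Prop :=
  MemLp f 2 (wMeasure α β γ) ∧
  (∃ u, HasWeakDeriv d1 f u ∧ MemLp u 2 (wMeasure (α + 1) β (γ + 1))) ∧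
  (∃ u, HasWeakDeriv d2 f u ∧ MemLp u 2 (wMeasure α (β + 1) (γ + 1))) ∧
  (∃ u, HasWeakDeriv d3 f u ∧ MemLp u 2 (wMeasure (α + 1) (β + 1) γ))

/-! ### Traces on the edges -/

/-- Let `e` parametrize an edge of the triangle over `(0, 1)`, and let `N` be the outward normal
of this edge, scaled so that `N dt` is the vector surface element. The function `g` is the trace
of `f` on this edge if the divergence theorem
`∫ (f ∂_v φ + φ ∂_v f) = ∫ g φ ⟨v, N⟩ dt`
holds for all directions `v` and all test functions `φ` whose support does not meet the two other
closed edges. This determines `g` almost everywhere. -/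
def IsTrace (e : ℝ → ℝ × ℝ) (N : ℝ × ℝ) (f : ℝ × ℝ → ℝ) (g : ℝ → ℝ) : Prop :=
  LocallyIntegrableOn g (Set.Ioo 0 1) ∧
  LocallyIntegrableOn f (tri ∪ e '' Set.Ioo 0 1) ∧
  ∀ v : ℝ × ℝ, ∃ u, HasWeakDeriv v f u ∧ LocallyIntegrableOn u (tri ∪ e '' Set.Ioo 0 1) ∧
    ∀ φ : ℝ × ℝ → ℝ, ContDiff ℝ (⊤ : ℕ∞) φ → HasCompactSupport φ →
      tsupport φ ∩ closedTri ⊆ tri ∪ e '' Set.Ioo 0 1 →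
      ∫ p in tri, (f p * fderiv ℝ φ p v + u p * φ p) =
        (v.1 * N.1 + v.2 * N.2) * ∫ t in Set.Ioo (0 : ℝ) 1, g t * φ (e t)

open Classical in
/-- The trace of `f` on the edge given by `e` and `N` (a representative). -/
def trace (e : ℝ → ℝ × ℝ) (N : ℝ × ℝ) (f : ℝ × ℝ → ℝ) : ℝ → ℝ :=
  if h : ∃ g, IsTrace e N f g then h.choose else 0

/-- The trace `t ↦ f (t, 1 - t)` on the edge `x + y = 1`. -/
def traceZ (f : ℝ × ℝ → ℝ) : ℝ → ℝ := trace (fun t => (t, 1 - t)) (1, 1) f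

/-- The trace `t ↦ f (t, 0)` on the edge `y = 0`. -/
def traceY (f : ℝ × ℝ → ℝ) : ℝ → ℝ := trace (fun t => (t, 0)) (0, -1) f

/-- The trace `t ↦ f (0, t)` on the edge `x = 0`. -/
def traceX (f : ℝ × ℝ → ℝ) : ℝ → ℝ := trace (fun t => (0, t)) (-1, 0) f

/-- The inner product of `L²((0, 1), t ^ a * (1 - t) ^ b)`. -/
def edgeInner (a b : ℝ) (f g : ℝ → ℝ) : ℝ :=
  ∫ t in Set.Ioo (0 : ℝ) 1, f t * g t * (t ^ a * (1 - t) ^ b)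

/-! ### Extended Jacobi polynomials -/

/-- The Pochhammer symbol `(a)_n = a (a + 1) ⋯ (a + n - 1)`. -/
def poch (a : ℝ) (n : ℕ) : ℝ := (ascPochhammer ℝ n).eval a

open Classical in
/-- The lower summation index of the extended Jacobi polynomial: it is `-n - a - b` if this is one
of the integers `1, …, n`, and `0` otherwise. -/
def iota0 (a b : ℝ) (n : ℕ) : ℕ :=
  if ∃ j : ℕ, 1 ≤ j ∧ j ≤ n ∧ (j : ℝ) = -n - a - b then ⌊-(n : ℝ) - a - b⌋₊ else 0

/-- The extended (renormalized) Jacobi polynomial `J_n^{a,b}`, defined for all real `a, b`. -/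
def jacobi (a b : ℝ) (n : ℕ) (t : ℝ) : ℝ :=
  ∑ k ∈ Finset.Icc (iota0 a b n) n,
    poch (k + a + 1) (n - k) /
      ((n - k).factorial * k.factorial * poch (n + a + b + k + 1) (n - k)) * ((t - 1) / 2) ^ k

/-- The polynomial `J_{k,n}^{α,β,γ}` on the triangle, `0 ≤ k ≤ n`. -/
def basisJ (α β γ : ℝ) (k n : ℕ) (p : ℝ × ℝ) : ℝ :=
  (p.1 + p.2) ^ k * jacobi α β k ((p.2 - p.1) / (p.1 + p.2)) *
    jacobi (2 * k + α + β + 1) γ (n - k) (1 - 2 * p.1 - 2 * p.2)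

/-- The polynomial `K_{k,n}^{α,β,γ}` on the triangle, `0 ≤ k ≤ n`. -/
def basisK (α β γ : ℝ) (k n : ℕ) (p : ℝ × ℝ) : ℝ :=
  (1 - p.2) ^ k * jacobi γ α k (2 * p.1 / (1 - p.2) - 1) *
    jacobi (2 * k + α + γ + 1) β (n - k) (2 * p.2 - 1)

/-- The polynomial `L_{k,n}^{α,β,γ}` on the triangle, `0 ≤ k ≤ n`. -/
def basisL (α β γ : ℝ) (k n : ℕ) (p : ℝ × ℝ) : ℝ :=
  (1 - p.1) ^ k * jacobi β γ k (1 - 2 * p.2 / (1 - p.1)) *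
    jacobi (2 * k + β + γ + 1) α (n - k) (2 * p.1 - 1)

/-! ### Sobolev inner products and partial sums of the Sobolev expansions -/

/-- The Sobolev inner product for the parameters `(α, β, -1)`. -/
def sobZ (lam α β : ℝ) (f g : ℝ × ℝ → ℝ) : ℝ :=
  wInner (α + 1) β 0 (weakDeriv d1 f) (weakDeriv d1 g) +
  wInner α (β + 1) 0 (weakDeriv d2 f) (weakDeriv d2 g) +
  lam * edgeInner α β (traceZ f) (traceZ g)

/-- The Sobolev inner product for the parameters `(α, -1, γ)`. -/
def sobY (lam α γ : ℝ) (f g : ℝ × ℝ → ℝ) : ℝ :=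
  wInner α 0 (γ + 1) (weakDeriv d2 f) (weakDeriv d2 g) +
  wInner (α + 1) 0 γ (weakDeriv d3 f) (weakDeriv d3 g) +
  lam * edgeInner α γ (traceY f) (traceY g)

/-- The Sobolev inner product for the parameters `(-1, β, γ)`. -/
def sobX (lam β γ : ℝ) (f g : ℝ × ℝ → ℝ) : ℝ :=
  wInner 0 (β + 1) γ (weakDeriv d3 f) (weakDeriv d3 g) +
  wInner 0 β (γ + 1) (weakDeriv d1 f) (weakDeriv d1 g) +
  lam * edgeInner β γ (traceX f) (traceX g)

/-- The `n`-th partial sum of the Fourier expansion of `f` with respect to the bilinear form `B`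
and the family `P k m`, `0 ≤ k ≤ m`, orthogonal for `B`. -/
def fourierSum (B : (ℝ × ℝ → ℝ) → (ℝ × ℝ → ℝ) → ℝ) (P : ℕ → ℕ → ℝ × ℝ → ℝ) (n : ℕ)
    (f : ℝ × ℝ → ℝ) (p : ℝ × ℝ) : ℝ :=
  ∑ m ∈ Finset.range (n + 1), ∑ k ∈ Finset.range (m + 1),
    B f (P k m) / B (P k m) (P k m) * P k m p

/-- The partial sum operator `S_n^{α,β,-1}`. -/
def sumZ (lam α β : ℝ) (n : ℕ) (f : ℝ × ℝ → ℝ) : ℝ × ℝ → ℝ :=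
  fourierSum (sobZ lam α β) (basisJ α β (-1)) n f

/-- The partial sum operator `S_n^{α,-1,γ}`. -/
def sumY (lam α γ : ℝ) (n : ℕ) (f : ℝ × ℝ → ℝ) : ℝ × ℝ → ℝ :=
  fourierSum (sobY lam α γ) (basisK α (-1) γ) n f

/-- The partial sum operator `S_n^{-1,β,γ}`. -/
def sumX (lam β γ : ℝ) (n : ℕ) (f : ℝ × ℝ → ℝ) : ℝ × ℝ → ℝ :=
  fourierSum (sobX lam β γ) (basisL (-1) β γ) n f

end

end Tri

namespace Tri
noncomputable section

/-! Only the first part needs analysis. The affine map `rot` of order three permutes the edges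
cyclically and carries the other two parts to it (`sumY_estimate`, `sumX_estimate`).

Put `s = x + y` and `w = x ^ α * y ^ β`. The form `∫ (x ∂₁p ∂₁q + y ∂₂p ∂₂q) w` belongs to the
operator `lap`, which separates into a radial part in `s` and a part `ang` that differentiates along
the segments `s = const`. The polynomial `harm α β k` is homogeneous of degree `k`, is killed by
`lap`, and is an eigenfunction of `ang` for `-k (k + α + β + 1)`. On `harm α β k * rad r` the
operator `lap` acts only on `r`, as `radLap`. The basis polynomials are `harm` times `radJ`, and for
radial index at least `1` they vanish on the edge `s = 1`.

Let `e = f - S_n f`; it is Sobolev orthogonal to degree `n`. Testing with `harm α β k` gives `k +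
lam` times a moment of the trace, so the trace of `e` is orthogonal to degree `n` and `lam` drops
out. As `lap` maps degree `n` onto degree `n - 1`, also `e` is orthogonal to degree `n - 1`; by
Green's identities so are `∂₁ e` and `∂₂ e`, each separately (`orthogonality`). Hence the
derivatives of `S_n f` are the best approximations of those of `f`, and it remains to bound the norm
of `e` by `3 / n` times the root of its energy.

This is a duality argument (`functional_bound`): for a polynomial `p = ∑ harm k * rad (r k)`, the
number `∫ e p w` is rewritten as a pairing of `∂₁ e`, `∂₂ e` with polynomials of small energy. For
`k > n` (`high_modes`) one inverts `ang`, whose eigenvalues are there at least `n ^ 2` in absolute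
value. For `k ≤ n` (`low_modes`) one solves the radial equation and subtracts a Sobolev projection,
which `e` does not see; the energy of the rest is controlled by Hardy's inequality if `n ≤ 2 k` and
by a spectral gap otherwise (`exists_small_solution`). These steps use only Green's identities, so
they are carried out for abstract functionals on polynomials. Density of polynomials then gives the
bound for `e` (`integral_sq_le_of_forall_poly`).

The analytic input is the existence of the trace, recovered by integration along rays from the
origin (`edgeFunctional_eq`), and Green's identities for the possibly singular weight
(`TracedSobolev.green`). -/

/-! ### Polynomials in two variables and the operators acting on them -/

/-- Polynomials in the two coordinates of the plane. -/
abbrev Poly2 := MvPolynomial (Fin 2) ℝ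

/-- The first coordinate. -/
abbrev xP : Poly2 := MvPolynomial.X 0

/-- The second coordinate. -/
abbrev yP : Poly2 := MvPolynomial.X 1

/-- The polynomial `x + y`. -/
def sP : Poly2 := xP + yP

/-- The derivative `∂ / ∂x`. -/
abbrev dX : Derivation ℝ Poly2 Poly2 := MvPolynomial.pderiv 0

/-- The derivative `∂ / ∂y`. -/
abbrev dY : Derivation ℝ Poly2 Poly2 := MvPolynomial.pderiv 1

/-- The derivative `∂ / ∂y - ∂ / ∂x`. -/
def dT : Derivation ℝ Poly2 Poly2 := dY - dX

/-- The Euler derivation `x ∂ / ∂x + y ∂ / ∂y`. -/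
def eul : Derivation ℝ Poly2 Poly2 := xP • dX + yP • dY

/-- The second order operator of the Dirichlet form with weights `x ^ α * y ^ β`. -/
def lap (α β : ℝ) (p : Poly2) : Poly2 :=
  xP * dX (dX p) + yP * dY (dY p) + (α + 1) • dX p + (β + 1) • dY p

/-- The angular part of `lap`. -/
def ang (α β : ℝ) (p : Poly2) : Poly2 :=
  xP * yP * dT (dT p) + ((β + 1) • xP - (α + 1) • yP) * dT p

/-- The polynomial `r (x + y)`. -/
def rad (r : Polynomial ℝ) : Poly2 := Polynomial.aeval sP r

/-- The radial part of `lap` with parameter `b`. -/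
def radLap (b : ℝ) (r : Polynomial ℝ) : Polynomial ℝ :=
  Polynomial.X * r.derivative.derivative + (b + 1) • r.derivative

@[simp] lemma dX_x : dX xP = 1 := by simp
@[simp] lemma dX_y : dX yP = 0 := by simp [MvPolynomial.pderiv_X]
@[simp] lemma dY_x : dY xP = 0 := by simp [MvPolynomial.pderiv_X]
@[simp] lemma dY_y : dY yP = 1 := by simp
@[simp] lemma dX_s : dX sP = 1 := by simp [sP, MvPolynomial.pderiv_X]
@[simp] lemma dY_s : dY sP = 1 := by simp [sP, MvPolynomial.pderiv_X]
lemma dT_apply (p : Poly2) : dT p = dY p - dX p := rfl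
lemma eul_apply (p : Poly2) : eul p = xP * dX p + yP * dY p := rfl
@[simp] lemma dT_x : dT xP = -1 := by simp [dT_apply]
@[simp] lemma dT_s : dT sP = 0 := by simp [dT_apply]
@[simp] lemma eul_x : eul xP = xP := by simp [eul_apply]
@[simp] lemma eul_s : eul sP = sP := by simp [eul_apply]; rfl

lemma derivation_rad (d : Derivation ℝ Poly2 Poly2) (r : Polynomial ℝ) :
    d (rad r) = rad r.derivative * d sP := by
  rw [rad, Derivation.map_aeval]; rfl

@[simp] lemma dX_rad (r : Polynomial ℝ) : dX (rad r) = rad r.derivative := by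
  rw [derivation_rad, dX_s, mul_one]
@[simp] lemma dY_rad (r : Polynomial ℝ) : dY (rad r) = rad r.derivative := by
  rw [derivation_rad, dY_s, mul_one]
@[simp] lemma dT_rad (r : Polynomial ℝ) : dT (rad r) = 0 := by
  rw [derivation_rad, dT_s, mul_zero]
@[simp] lemma eul_rad (r : Polynomial ℝ) : eul (rad r) = rad r.derivative * sP := by
  rw [derivation_rad, eul_s]

lemma rad_add (r t : Polynomial ℝ) : rad (r + t) = rad r + rad t := map_add _ _ _
lemma rad_sub (r t : Polynomial ℝ) : rad (r - t) = rad r - rad t := map_sub _ _ _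
lemma rad_neg (r : Polynomial ℝ) : rad (-r) = -rad r := map_neg _ _
lemma rad_mul (r t : Polynomial ℝ) : rad (r * t) = rad r * rad t := map_mul _ _ _
lemma rad_smul (c : ℝ) (r : Polynomial ℝ) : rad (c • r) = c • rad r := map_smul _ _ _
lemma rad_one : rad 1 = 1 := map_one _
lemma rad_X : rad Polynomial.X = sP := Polynomial.aeval_X _
lemma rad_sum {ι : Type*} (s : Finset ι) (r : ι → Polynomial ℝ) :
    rad (∑ i ∈ s, r i) = ∑ i ∈ s, rad (r i) := map_sum _ _ _

/-- Separation of variables: `eul` is `s ∂/∂s`, and `ang` involves only the derivative `dT` along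
the segments `x + y = s`. The factor `sP` keeps everything polynomial. -/
lemma s_mul_lap (α β : ℝ) (p : Poly2) :
    sP * lap α β p = eul (eul p) + (α + β + 1) • eul p + ang α β p := by
  simp only [lap, ang, eul_apply, dT_apply, sP, Derivation.leibniz, map_add, map_sub, smul_eq_mul,
    dX_x, dX_y, dY_x, dY_y, MvPolynomial.smul_eq_C_mul, MvPolynomial.C_1]
  -- The commutator of two derivations is a derivation, and this one kills both variables.
  have h : dX (dY p) = dY (dX p) := by
    have h0 : ⁅dX, dY⁆ = (0 : Derivation ℝ Poly2 Poly2) := by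
      refine MvPolynomial.derivation_ext fun i => ?_
      fin_cases i <;> simp [Derivation.commutator_apply, MvPolynomial.pderiv_X]
    have h1 := congrArg (fun d => d p) h0
    simpa [Derivation.commutator_apply, sub_eq_zero] using h1
  rw [h]
  ring

/-- The cross term of the product rule is `2 r' * eul p = 2 k r' p`. Together with the term `(α + β
+ 2) r'` from `lap` of a radial function it produces the parameter `2 k + α + β + 1`. -/
lemma lap_mul_rad (α β : ℝ) (k : ℕ) (p : Poly2) (hE : eul p = (k : ℝ) • p)
    (hL : lap α β p = 0) (r : Polynomial ℝ) :
    lap α β (p * rad r) = p * rad (radLap (2 * k + α + β + 1) r) := by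
  have e : xP * dX p + yP * dY p = (k : ℝ) • p := hE
  have l := hL
  unfold lap at l
  simp only [lap, radLap, Derivation.leibniz, map_add, smul_eq_mul, dX_rad, dY_rad, rad_add,
    rad_mul, rad_smul, rad_X]
  simp only [MvPolynomial.smul_eq_C_mul, MvPolynomial.C_add, MvPolynomial.C_1,
    MvPolynomial.C_mul] at l ⊢
  simp only [MvPolynomial.smul_eq_C_mul] at e
  rw [sP]
  have h2 : (MvPolynomial.C 2 : Poly2) = 2 := map_ofNat _ 2
  rw [h2]
  linear_combination rad r * l + 2 * rad r.derivative * e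

/-- Since `dT` kills functions of `x + y`, these are constants for `ang`. -/
lemma ang_mul_rad (α β : ℝ) (p : Poly2) (r : Polynomial ℝ) :
    ang α β (p * rad r) = ang α β p * rad r := by
  simp only [ang, Derivation.leibniz, smul_eq_mul, dT_rad, mul_zero, zero_add]
  ring

lemma eul_mul_rad (k : ℕ) (p : Poly2) (hE : eul p = (k : ℝ) • p) (r : Polynomial ℝ) :
    eul (p * rad r) = p * rad ((k : ℝ) • r + Polynomial.X * r.derivative) := by
  simp only [Derivation.leibniz, smul_eq_mul, hE, eul_rad, rad_add, rad_smul, rad_mul, rad_X,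
    MvPolynomial.smul_eq_C_mul]
  ring

lemma sP_ne_zero : sP ≠ 0 := by
  intro h
  have := dX_s
  rw [h, map_zero] at this
  exact zero_ne_one this

/-! ### Coefficients of the extended Jacobi polynomials -/

/-- The coefficient of `((t - 1) / 2) ^ k` in `J_n^{a,b}`. -/
def jcoef (a b : ℝ) (n k : ℕ) : ℝ :=
  poch (k + a + 1) (n - k) /
    ((n - k).factorial * k.factorial * poch (n + a + b + k + 1) (n - k))

lemma poch_succ (a : ℝ) (n : ℕ) : poch a (n + 1) = a * poch (a + 1) n := by
  simp [poch, ascPochhammer_succ_left]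

lemma poch_pos {a : ℝ} (h : 0 < a) (n : ℕ) : 0 < poch a n := ascPochhammer_pos n a h

/-- An exceptional index `j` would need `n + j = -a - b < 2` with `n, j ≥ 1`. So the parameter pairs
`(α, β)` and `(2 k + α + β + 1, -1)` used below are never exceptional. -/
lemma iota0_eq_zero {a b : ℝ} (h : -2 < a + b) (n : ℕ) : iota0 a b n = 0 := by
  rw [iota0, if_neg]
  rintro ⟨j, h1, h2, h3⟩
  have h1' : (1 : ℝ) ≤ j := by exact_mod_cast h1
  have h2' : (1 : ℝ) ≤ n := by exact_mod_cast h1.trans h2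
  linarith

lemma jacobi_eq {a b : ℝ} (h : -2 < a + b) (n : ℕ) (t : ℝ) :
    jacobi a b n t = ∑ k ∈ Finset.range (n + 1), jcoef a b n k * ((t - 1) / 2) ^ k := by
  rw [jacobi, iota0_eq_zero h, Finset.range_eq_Ico]
  rfl

lemma jcoef_self (a b : ℝ) (n : ℕ) : jcoef a b n n = 1 / n.factorial := by
  simp [jcoef, poch]

/-- This is the Jacobi differential equation read off on coefficients; both eigenvalue equations
below rest on it. The bound on `a + b` keeps the Pochhammer denominators positive. -/
lemma jcoef_succ {a b : ℝ} (h : -2 < a + b) {n i : ℕ} (hi : i < n) :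
    jcoef a b n (i + 1) * ((i + 1) * (i + 1 + a)) =
      jcoef a b n i * ((n - i) * (n + a + b + 1 + i)) := by
  obtain ⟨m, rfl⟩ : ∃ m, n = i + 1 + m := ⟨n - (i + 1), by omega⟩
  have e1 : i + 1 + m - (i + 1) = m := by omega
  have e2 : i + 1 + m - i = m + 1 := by omega
  have hp : 0 < ((i + 1 + m : ℕ) : ℝ) + a + b + i + 1 := by
    push_cast
    have : (0 : ℝ) ≤ i := by positivity
    have : (0 : ℝ) ≤ m := by positivity
    linarith
  have hq := poch_pos (add_pos hp one_pos) m
  simp only [jcoef, e1, e2, poch_succ, Nat.factorial_succ]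
  have f1 : (((i + 1 : ℕ) : ℝ) + a + 1) = i + a + 1 + 1 := by push_cast; ring
  have f2 : ((i + 1 + m : ℕ) : ℝ) + a + b + ((i + 1 : ℕ) : ℝ) + 1 =
    ((i + 1 + m : ℕ) : ℝ) + a + b + i + 1 + 1 := by push_cast; ring
  rw [f1, f2]
  generalize poch (((i + 1 + m : ℕ) : ℝ) + a + b + i + 1 + 1) m = Q at *
  generalize poch (i + a + 1 + 1) m = P
  have hf := (Nat.cast_pos (α := ℝ)).2 m.factorial_pos
  have hg := (Nat.cast_pos (α := ℝ)).2 i.factorial_pos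
  push_cast at *
  field_simp
  ring

/-! ### Separated solutions: angular and radial factors -/

/-- The homogeneous polynomial `(x + y) ^ k * J_k^{α,β} ((y - x) / (x + y))`. -/
def harm (α β : ℝ) (k : ℕ) : Poly2 :=
  ∑ i ∈ Finset.range (k + 1), ((-1) ^ i * jcoef α β k i) • (xP ^ i * sP ^ (k - i))

/-- The polynomial `J_j^{b,-1} (1 - 2 s)`. -/
def radJ (b : ℝ) (j : ℕ) : Polynomial ℝ :=
  ∑ i ∈ Finset.range (j + 1), ((-1) ^ i * jcoef b (-1) j i) • Polynomial.X ^ i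

lemma eul_monomial (i j : ℕ) : eul (xP ^ i * sP ^ j) = ((i + j : ℕ) : ℝ) • (xP ^ i * sP ^ j) := by
  have e : ∀ (p : Poly2) (i : ℕ), eul p = p → eul (p ^ i) = (i : ℝ) • p ^ i := by
    intro p i h
    rw [Derivation.leibniz_pow, h]
    cases i with
    | zero => simp
    | succ i =>
      rw [Nat.add_sub_cancel, ← Nat.cast_smul_eq_nsmul ℝ, smul_eq_mul, pow_succ]
  rw [Derivation.leibniz, e _ _ eul_x, e _ _ eul_s]
  push_cast
  simp only [smul_eq_mul, MvPolynomial.smul_eq_C_mul, MvPolynomial.C_add]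
  ring

lemma eul_harm (α β : ℝ) (k : ℕ) : eul (harm α β k) = (k : ℝ) • harm α β k := by
  rw [harm, map_sum, Finset.smul_sum]
  refine Finset.sum_congr rfl fun i hi => ?_
  have : i + (k - i) = k := by have := Finset.mem_range.1 hi; omega
  rw [Derivation.map_smul, eul_monomial, this, smul_comm]

/-- Without the factor `xP` the exponent `i - 1` would occur; multiplying by it avoids truncated
subtraction at `i = 0`. The computation replaces `yP` by `sP - xP` and uses that `dT` treats `sP` as
a constant. -/
lemma x_mul_ang_monomial (α β : ℝ) (i j : ℕ) :
    xP * ang α β (xP ^ i * sP ^ j) =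
      ((i : ℝ) * (i + α)) • (xP ^ i * sP ^ (j + 1)) -
        ((i : ℝ) * (i + α + β + 1)) • (xP ^ (i + 1) * sP ^ j) := by
  have hs : sP ^ j = rad (Polynomial.X ^ j) := by rw [rad, map_pow, Polynomial.aeval_X]
  have h1 : xP * dT (xP ^ i) = -(MvPolynomial.C (i : ℝ) * xP ^ i) := by
    rw [Derivation.leibniz_pow, dT_x]
    cases i with
    | zero => simp
    | succ i =>
      rw [Nat.add_sub_cancel, ← Nat.cast_smul_eq_nsmul ℝ, smul_eq_mul, MvPolynomial.smul_eq_C_mul]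
      ring
  have h2 : xP * dT (xP * dT (xP ^ i)) = MvPolynomial.C (i : ℝ) ^ 2 * xP ^ i := by
    rw [h1]
    simp only [map_neg, Derivation.leibniz, ← MvPolynomial.algebraMap_eq, Derivation.map_algebraMap]
    simp only [MvPolynomial.algebraMap_eq, smul_eq_mul]
    linear_combination (-MvPolynomial.C (i : ℝ)) * h1
  rw [Derivation.leibniz, dT_x, smul_eq_mul, smul_eq_mul] at h2
  rw [hs, ang_mul_rad, ← hs, ang]
  simp only [MvPolynomial.smul_eq_C_mul, MvPolynomial.C_add, MvPolynomial.C_mul, MvPolynomial.C_1]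
  have hy : yP = sP - xP := by simp [sP]
  rw [hy]
  linear_combination (sP - xP) * sP ^ j * h2 +
    ((sP - xP) * sP ^ j + ((MvPolynomial.C β + 1) * xP - (MvPolynomial.C α + 1) * (sP - xP)) * sP ^ j)
      * h1

lemma ang_add (α β : ℝ) (p q : Poly2) : ang α β (p + q) = ang α β p + ang α β q := by
  simp only [ang, map_add]; ring

lemma ang_smul (α β c : ℝ) (p : Poly2) : ang α β (c • p) = c • ang α β p := by
  simp only [ang, Derivation.map_smul]
  simp only [MvPolynomial.smul_eq_C_mul]; ring

lemma ang_sum {ι : Type*} (α β : ℝ) (s : Finset ι) (p : ι → Poly2) :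
    ang α β (∑ i ∈ s, p i) = ∑ i ∈ s, ang α β (p i) := by
  classical
  induction s using Finset.induction_on with
  | empty => simp [ang]
  | insert a s h ih => rw [Finset.sum_insert h, Finset.sum_insert h, ang_add, ih]

/-- By `x_mul_ang_monomial` the operator is bidiagonal on the monomials `x ^ i s ^ (k - i)`, so the
eigenvalue equation is a two-term recurrence for the coefficients, which is `jcoef_succ`. -/
lemma ang_harm {α β : ℝ} (h : -2 < α + β) (k : ℕ) :
    ang α β (harm α β k) = (-((k : ℝ) * (k + α + β + 1))) • harm α β k := by
  refine mul_left_cancel₀ (MvPolynomial.X_ne_zero (R := ℝ) (0 : Fin 2)) ?_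
  rw [harm, ang_sum, Finset.mul_sum, Finset.smul_sum, Finset.mul_sum]
  have e1 : ∀ i ∈ Finset.range (k + 1),
      xP * ang α β (((-1) ^ i * jcoef α β k i) • (xP ^ i * sP ^ (k - i))) =
      ((-1) ^ i * jcoef α β k i * (i * (i + α))) • (xP ^ i * sP ^ (k + 1 - i)) -
      ((-1) ^ i * jcoef α β k i * (i * (i + α + β + 1))) • (xP ^ (i + 1) * sP ^ (k - i)) := by
    intro i hi
    have : k + 1 - i = k - i + 1 := by have := Finset.mem_range.1 hi; omega
    rw [ang_smul, mul_smul_comm, x_mul_ang_monomial, smul_sub, smul_smul, smul_smul, this]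
  rw [Finset.sum_congr rfl e1, Finset.sum_sub_distrib, Finset.sum_range_succ']
  rw [Finset.sum_range_succ (fun i => ((-1) ^ i * jcoef α β k i * (i * (i + α + β + 1))) •
    (xP ^ (i + 1) * sP ^ (k - i))), Finset.sum_range_succ (fun i => xP * _)]
  -- The coefficients match because `k (k + c) - i (i + c) = (k - i) (k + i + c)` with `c = α + β +
  -- 1`.
  have e2 : ∀ i ∈ Finset.range k,
      ((-1) ^ (i + 1) * jcoef α β k (i + 1) * ((i + 1 : ℕ) * ((i + 1 : ℕ) + α))) •
        (xP ^ (i + 1) * sP ^ (k + 1 - (i + 1))) =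
      (((-1) ^ i * jcoef α β k i * (i * (i + α + β + 1))) • (xP ^ (i + 1) * sP ^ (k - i)) +
      xP * (-((k : ℝ) * (k + α + β + 1))) • ((-1) ^ i * jcoef α β k i) •
        (xP ^ i * sP ^ (k - i))) := by
    intro i hi
    have hr := jcoef_succ h (Finset.mem_range.1 hi)
    rw [Nat.add_sub_add_right, mul_smul_comm, mul_smul_comm, ← mul_assoc xP, ← pow_succ',
      smul_smul, ← add_smul]
    congr 1
    push_cast
    rw [pow_succ]
    linear_combination (-(-1) ^ i) * hr
  rw [Finset.sum_congr rfl e2, Finset.sum_add_distrib, mul_smul_comm, mul_smul_comm,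
    ← mul_assoc xP, ← pow_succ', smul_smul]
  simp only [Nat.cast_zero, zero_mul, mul_zero, zero_smul, add_zero]
  have e3 : (-((k : ℝ) * (k + α + β + 1)) * ((-1) ^ k * jcoef α β k k)) =
    -(((-1) ^ k * jcoef α β k k * (k * (k + α + β + 1)))) := by ring
  rw [e3, neg_smul]
  abel

/-- Homogeneity contributes `k ^ 2 + (α + β + 1) k` to `sP * lap`, and the eigenvalue of `ang` is
exactly its negative; `sP` can then be cancelled. -/
lemma lap_harm {α β : ℝ} (h : -2 < α + β) (k : ℕ) : lap α β (harm α β k) = 0 := by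
  refine (mul_eq_zero.1 ?_).resolve_left sP_ne_zero
  rw [s_mul_lap, ang_harm h, eul_harm, Derivation.map_smul, eul_harm, smul_smul, smul_smul, ← add_smul,
    ← add_smul]
  convert zero_smul ℝ _
  ring

lemma lap_harm_mul {α β : ℝ} (h : -2 < α + β) (k : ℕ) (r : Polynomial ℝ) :
    lap α β (harm α β k * rad r) = harm α β k * rad (radLap (2 * k + α + β + 1) r) :=
  lap_mul_rad α β k _ (eul_harm α β k) (lap_harm h k) r

lemma radLap_add (b : ℝ) (r t : Polynomial ℝ) : radLap b (r + t) = radLap b r + radLap b t := by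
  simp only [radLap, Polynomial.derivative_add, smul_add]; ring

lemma radLap_smul (b c : ℝ) (r : Polynomial ℝ) : radLap b (c • r) = c • radLap b r := by
  simp only [radLap, Polynomial.derivative_smul]
  simp only [Polynomial.smul_eq_C_mul]; ring

lemma radLap_sum {ι : Type*} (b : ℝ) (s : Finset ι) (p : ι → Polynomial ℝ) :
    radLap b (∑ i ∈ s, p i) = ∑ i ∈ s, radLap b (p i) := by
  classical
  induction s using Finset.induction_on with
  | empty => simp [radLap]
  | insert a s h ih => rw [Finset.sum_insert h, Finset.sum_insert h, radLap_add, ih]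

lemma X_mul_radLap_X_pow (b : ℝ) (i : ℕ) :
    Polynomial.X * radLap b (Polynomial.X ^ i) = ((i : ℝ) * (i + b)) • Polynomial.X ^ i := by
  rcases i with _ | _ | i
  · simp [radLap]
  · simp [radLap, Polynomial.smul_eq_C_mul]; ring
  · simp [radLap, Polynomial.smul_eq_C_mul]; ring

/-- The same coefficient recurrence as for `ang_harm`, now with second Jacobi parameter `-1`. This
parameter is what puts the factor `1 - X` in front of the whole operator. -/
lemma radLap_radJ {b : ℝ} (h : -1 < b) (j : ℕ) :
    (1 - Polynomial.X) * radLap b (radJ b j) = (-((j : ℝ) * (j + b))) • radJ b j := by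
  refine mul_left_cancel₀ Polynomial.X_ne_zero ?_
  have e1 : Polynomial.X * radLap b (radJ b j) = ∑ i ∈ Finset.range (j + 1),
      ((-1) ^ i * jcoef b (-1) j i * (i * (i + b))) • Polynomial.X ^ i := by
    rw [radJ, radLap_sum, Finset.mul_sum]
    refine Finset.sum_congr rfl fun i _ => ?_
    rw [radLap_smul, mul_smul_comm, X_mul_radLap_X_pow, smul_smul]
  have e0 : Polynomial.X * ((1 - Polynomial.X) * radLap b (radJ b j)) =
      Polynomial.X * radLap b (radJ b j) - Polynomial.X * (Polynomial.X * radLap b (radJ b j)) := by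
    ring
  rw [e0, e1, Finset.mul_sum, radJ, Finset.smul_sum, Finset.mul_sum, Finset.sum_range_succ']
  rw [Finset.sum_range_succ (fun i => Polynomial.X * (((-1) ^ i * jcoef b (-1) j i *
    (i * (i + b))) • Polynomial.X ^ i)), Finset.sum_range_succ (fun i => Polynomial.X * (-_) • _)]
  have e2 : ∀ i ∈ Finset.range j,
      ((-1) ^ (i + 1) * jcoef b (-1) j (i + 1) * ((i + 1 : ℕ) * ((i + 1 : ℕ) + b))) •
        (Polynomial.X : Polynomial ℝ) ^ (i + 1) =
      Polynomial.X * (((-1) ^ i * jcoef b (-1) j i * (i * (i + b))) • Polynomial.X ^ i) +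
      Polynomial.X * (-((j : ℝ) * (j + b))) • ((-1) ^ i * jcoef b (-1) j i) •
        Polynomial.X ^ i := by
    intro i hi
    have hr := jcoef_succ (a := b) (b := -1) (by linarith) (Finset.mem_range.1 hi)
    rw [mul_smul_comm, mul_smul_comm, mul_smul_comm, ← pow_succ', smul_smul, ← add_smul]
    congr 1
    push_cast
    rw [pow_succ]
    linear_combination (-(-1) ^ i) * hr
  rw [Finset.sum_congr rfl e2, Finset.sum_add_distrib]
  simp only [Nat.cast_zero, zero_mul, mul_zero, zero_smul, add_zero]
  have e3 : Polynomial.X * (-((j : ℝ) * (j + b))) • ((-1) ^ j * jcoef b (-1) j j) •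
      (Polynomial.X : Polynomial ℝ) ^ j =
      -(Polynomial.X * (((-1) ^ j * jcoef b (-1) j j * (j * (j + b))) • Polynomial.X ^ j)) := by
    rw [smul_smul, ← mul_neg (Polynomial.X : Polynomial ℝ), ← neg_smul]
    congr 2
    ring
  rw [e3]
  abel

/-- At `1` the left side of the eigenvalue equation `radLap_radJ` vanishes while the eigenvalue `-j
(j + b)` does not. -/
lemma eval_one_radJ {b : ℝ} (h : -1 < b) {j : ℕ} (hj : j ≠ 0) : (radJ b j).eval 1 = 0 := by
  have := congrArg (Polynomial.eval 1) (radLap_radJ h j)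
  simp only [Polynomial.eval_mul, Polynomial.eval_sub, Polynomial.eval_one, Polynomial.eval_X,
    sub_self, zero_mul, Polynomial.eval_smul, smul_eq_mul] at this
  have hj' : (1 : ℝ) ≤ j := by exact_mod_cast Nat.one_le_iff_ne_zero.2 hj
  have h2 : -((j : ℝ) * (j + b)) ≠ 0 := by
    have : 0 < (j : ℝ) * (j + b) := by apply mul_pos <;> linarith
    linarith
  exact (mul_eq_zero.1 this.symm).resolve_left h2

lemma radJ_zero (b : ℝ) : radJ b 0 = 1 := by simp [radJ, jcoef_self]

lemma coeff_radJ_self (b : ℝ) (j : ℕ) : (radJ b j).coeff j ≠ 0 := by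
  rw [radJ, Polynomial.finsetSum_coeff, Finset.sum_eq_single j]
  · rw [Polynomial.coeff_smul, Polynomial.coeff_X_pow_self, jcoef_self]
    have : (j.factorial : ℝ) ≠ 0 := by positivity
    simp [this]
  · intro i _ hij
    simp [Polynomial.coeff_X_pow, hij.symm]
  · simp

lemma natDegree_radJ (b : ℝ) (j : ℕ) : (radJ b j).natDegree = j := by
  refine le_antisymm ?_ (Polynomial.le_natDegree_of_ne_zero (coeff_radJ_self b j))
  refine Polynomial.natDegree_sum_le_of_forall_le _ _ fun i hi => ?_
  refine (Polynomial.natDegree_smul_le _ _).trans ?_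
  rw [Polynomial.natDegree_X_pow]
  exact Nat.lt_succ_iff.1 (Finset.mem_range.1 hi)

lemma radJ_ne_zero (b : ℝ) (j : ℕ) : radJ b j ≠ 0 := by
  intro h
  have := coeff_radJ_self b j
  simp [h] at this

end
end Tri

namespace Tri
noncomputable section

/-! ### Positive functionals on polynomials in one variable -/

/-- The Cauchy-Schwarz inequality for a positive functional on a commutative algebra. -/
lemma functional_cauchy_schwarz {R : Type*} [CommRing R] [Algebra ℝ R] (J : R →ₗ[ℝ] ℝ)
    (hJ : ∀ p, 0 ≤ J (p * p)) (a b : R) : J (a * b) ^ 2 ≤ J (a * a) * J (b * b) := by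
  have h : ∀ t : ℝ, 0 ≤ J (b * b) * (t * t) + (2 * J (a * b)) * t + J (a * a) := by
    intro t
    have e : (a + t • b) * (a + t • b) = a * a + (2 * t) • (a * b) + (t * t) • (b * b) := by
      simp only [Algebra.smul_def, map_mul, map_ofNat]
      ring
    have := hJ (a + t • b)
    rw [e, map_add, map_add, map_smul, map_smul, smul_eq_mul, smul_eq_mul] at this
    linarith
  have := discrim_le_zero h
  rw [discrim] at this
  linarith

/-- `M` behaves like `r ↦ τ * ∫_0^1 r s ^ b ds`. -/
structure IsRadMoment (b : ℝ) (M : Polynomial ℝ →ₗ[ℝ] ℝ) (τ : ℝ) : Prop where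
  euler : ∀ r, M (Polynomial.X * r.derivative + (b + 1) • r) = r.eval 1 * τ
  nonneg : ∀ r, 0 ≤ M (Polynomial.X * (r * r))
  pos : ∀ r, r ≠ 0 → 0 < M ((1 - Polynomial.X) * (r * r))

namespace IsRadMoment

variable {b : ℝ} {M : Polynomial ℝ →ₗ[ℝ] ℝ} {τ : ℝ}

lemma one_sub_nonneg (h : IsRadMoment b M τ) (r : Polynomial ℝ) :
    0 ≤ M ((1 - Polynomial.X) * (r * r)) := by
  rcases eq_or_ne r 0 with rfl | hr
  · simp
  · exact (h.pos r hr).le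

lemma sq_nonneg (h : IsRadMoment b M τ) (r : Polynomial ℝ) : 0 ≤ M (r * r) := by
  have e : r * r = Polynomial.X * (r * r) + (1 - Polynomial.X) * (r * r) := by ring
  rw [e, map_add]
  exact add_nonneg (h.nonneg r) (h.one_sub_nonneg r)

lemma X_sq_le (h : IsRadMoment b M τ) (r : Polynomial ℝ) :
    M (Polynomial.X * (r * r)) ≤ M (r * r) := by
  have e : r * r = Polynomial.X * (r * r) + (1 - Polynomial.X) * (r * r) := by ring
  conv_rhs => rw [e, map_add]
  linarith [h.one_sub_nonneg r]

/-- The difference has weight `s (1 - s)`. Positivity is known only for the weights `s` and `1 - s`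
times squares, whence the decomposition `s (1 - s) = s (1 - s) ^ 2 + (1 - s) s ^ 2`. -/
lemma one_sub_sq_le (h : IsRadMoment b M τ) (r : Polynomial ℝ) :
    M (((1 - Polynomial.X) * r) * ((1 - Polynomial.X) * r)) ≤
      M ((1 - Polynomial.X) * (r * r)) := by
  have e : (1 - Polynomial.X) * (r * r) =
      ((1 - Polynomial.X) * r) * ((1 - Polynomial.X) * r) +
      (Polynomial.X * (((1 - Polynomial.X) * r) * ((1 - Polynomial.X) * r)) +
      (1 - Polynomial.X) * ((Polynomial.X * r) * (Polynomial.X * r))) := by ring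
  rw [e, map_add, map_add]
  linarith [h.nonneg ((1 - Polynomial.X) * r), h.one_sub_nonneg (Polynomial.X * r)]

/-- Integration by parts: `euler` applied to the product `p q'`. -/
lemma mul_radLap (h : IsRadMoment b M τ) (p q : Polynomial ℝ) :
    M (p * radLap b q) = p.eval 1 * q.derivative.eval 1 * τ -
      M (Polynomial.X * (p.derivative * q.derivative)) := by
  have := h.euler (p * q.derivative)
  rw [Polynomial.eval_mul] at this
  rw [← this, eq_sub_iff_add_eq, ← map_add]
  congr 1
  simp only [radLap, Polynomial.derivative_mul, Polynomial.smul_eq_C_mul]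
  ring

/-- Hardy's inequality. The boundary term in `euler` for `p ^ 2` vanishes, so `(b + 1) M (p ^ 2) =
-2 M (s p p')`; then Cauchy-Schwarz with weight `s` and `s ≤ 1`. Its constant grows with `b`, which
makes it strong for large angular index. -/
lemma hardy (h : IsRadMoment b M τ) (p : Polynomial ℝ) (hp : p.eval 1 = 0) :
    (b + 1) ^ 2 * M (p * p) ≤ 4 * M (Polynomial.X * (p.derivative * p.derivative)) := by
  have e := h.euler (p * p)
  have e1 : Polynomial.X * (p * p).derivative + (b + 1) • (p * p) =
      (2 : ℝ) • (Polynomial.X * (p * p.derivative)) + (b + 1) • (p * p) := by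
    rw [Polynomial.derivative_mul, two_smul]; ring
  rw [e1, Polynomial.eval_mul, hp, map_add, map_smul, map_smul, smul_eq_mul, smul_eq_mul] at e
  have cs := functional_cauchy_schwarz (M ∘ₗ LinearMap.mulLeft ℝ Polynomial.X)
    (fun r => h.nonneg r) p p.derivative
  simp only [LinearMap.comp_apply, LinearMap.mulLeft_apply] at cs
  have hx := h.X_sq_le p
  have h0 := h.sq_nonneg p
  have h1 := h.nonneg p.derivative
  set u := M (p * p)
  set v := M (Polynomial.X * (p.derivative * p.derivative))
  set z := M (Polynomial.X * (p * p.derivative))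
  have hz : (b + 1) * u = -(2 * z) := by linarith
  have h2 : ((b + 1) * u) ^ 2 ≤ 4 * (u * v) := by
    rw [hz]
    nlinarith [mul_le_mul_of_nonneg_right hx h1]
  -- One factor `u` has to be cancelled from `((b + 1) u) ^ 2 ≤ 4 u v`.
  rcases h0.eq_or_lt with hu | hu
  · rw [← hu]; linarith
  · refine le_of_mul_le_mul_left ?_ hu
    nlinarith

/-- By the eigenvalue equation and integration by parts the left side is `i (i + b)` times an
expression symmetric in `i` and `j`. Subtracting the two versions leaves the nonzero factor `(i - j)
(i + j + b)`. For index `0` the polynomial is constant and `radLap` kills it. -/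
lemma orthogonal (hb : -1 < b) (h : IsRadMoment b M τ) {i j : ℕ} (hij : i ≠ j) :
    M ((1 - Polynomial.X) * (radLap b (radJ b i) * radLap b (radJ b j))) = 0 := by
  have key : ∀ i j : ℕ, i ≠ 0 → M ((1 - Polynomial.X) * (radLap b (radJ b i) * radLap b (radJ b j)))
      = (i : ℝ) * (i + b) * M (Polynomial.X * ((radJ b i).derivative * (radJ b j).derivative)) := by
    intro i j hi
    rw [← mul_assoc, radLap_radJ hb, smul_mul_assoc, map_smul, h.mul_radLap, eval_one_radJ hb hi,
      smul_eq_mul]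
    ring
  have z : radLap b (radJ b 0) = 0 := by simp [radJ_zero, radLap]
  rcases Nat.eq_zero_or_pos i with rfl | hi
  · simp [z]
  rcases Nat.eq_zero_or_pos j with rfl | hj
  · simp [z]
  have k1 := key i j hi.ne'
  have k2 := key j i hj.ne'
  rw [mul_comm (radLap b (radJ b j)), mul_comm (radJ b j).derivative, k1] at k2
  have h1 : (1 : ℝ) ≤ i := by exact_mod_cast hi
  have h2 : (1 : ℝ) ≤ j := by exact_mod_cast hj
  have hne : (i : ℝ) ≠ j := by exact_mod_cast hij
  have h3 : ((i : ℝ) - j) * (i + j + b) *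
      M (Polynomial.X * ((radJ b i).derivative * (radJ b j).derivative)) = 0 := by
    linear_combination k2
  have h4 : ((i : ℝ) - j) * (i + j + b) ≠ 0 :=
    mul_ne_zero (sub_ne_zero.2 hne) (by linarith)
  rw [k1, (mul_eq_zero.1 h3).resolve_left h4, mul_zero]

end IsRadMoment

lemma exists_radJ_expansion (b : ℝ) (N : ℕ) (p : Polynomial ℝ) (hp : p.natDegree ≤ N) :
    ∃ a : ℕ → ℝ, p = ∑ j ∈ Finset.range (N + 1), a j • radJ b j := by
  induction N generalizing p with
  | zero =>
    refine ⟨fun _ => p.coeff 0, ?_⟩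
    rw [zero_add, Finset.sum_range_one, radJ_zero, Polynomial.smul_eq_C_mul, mul_one]
    exact Polynomial.eq_C_of_natDegree_le_zero hp
  | succ N ih =>
    set c := p.coeff (N + 1) / (radJ b (N + 1)).coeff (N + 1)
    obtain ⟨a, ha⟩ := ih (p - c • radJ b (N + 1)) (by
      rw [Polynomial.natDegree_le_iff_coeff_eq_zero]
      intro m hm
      rw [Polynomial.coeff_sub, Polynomial.coeff_smul, smul_eq_mul]
      rcases (Nat.succ_le_of_lt hm).eq_or_lt with h | h
      · rw [← h, Nat.succ_eq_add_one, div_mul_cancel₀ _ (coeff_radJ_self b (N + 1)), sub_self]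
      · rw [Polynomial.coeff_eq_zero_of_natDegree_lt (hp.trans_lt h),
          Polynomial.coeff_eq_zero_of_natDegree_lt (by rwa [natDegree_radJ]), mul_zero, sub_zero])
    refine ⟨Function.update a (N + 1) c, ?_⟩
    rw [Finset.sum_range_succ, Function.update_self, ← sub_eq_iff_eq_add, ha]
    refine Finset.sum_congr rfl fun j hj => ?_
    rw [Function.update_of_ne (Finset.mem_range.1 hj).ne]

/-- `radLap b` maps `X ^ (i + 1)` to `(i + 1) (i + 1 + b) X ^ i`, and this factor is nonzero for `b
> -1`. -/
lemma exists_radLap_eq {b : ℝ} (hb : -1 < b) (r : Polynomial ℝ) :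
    ∃ p : Polynomial ℝ, radLap b p = r ∧ p.natDegree ≤ r.natDegree + 1 := by
  refine ⟨∑ i ∈ Finset.range (r.natDegree + 1),
    (r.coeff i / ((i + 1) * (i + 1 + b))) • Polynomial.X ^ (i + 1), ?_, ?_⟩
  · rw [radLap_sum]
    conv_rhs => rw [r.as_sum_range]
    refine Finset.sum_congr rfl fun i _ => ?_
    refine mul_left_cancel₀ Polynomial.X_ne_zero ?_
    rw [radLap_smul, mul_smul_comm, X_mul_radLap_X_pow, smul_smul,
      ← Polynomial.C_mul_X_pow_eq_monomial, Polynomial.smul_eq_C_mul, pow_succ]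
    have : ((i : ℝ) + 1) * (i + 1 + b) ≠ 0 := by
      have : (0 : ℝ) ≤ i := by positivity
      exact mul_ne_zero (by linarith) (by linarith)
    push_cast
    rw [div_mul_cancel₀ _ this]
    ring
  · refine Polynomial.natDegree_sum_le_of_forall_le _ _ fun i hi => ?_
    refine (Polynomial.natDegree_smul_le _ _).trans ?_
    rw [Polynomial.natDegree_X_pow]
    have := Finset.mem_range.1 hi
    omega

namespace IsRadMoment

variable {b : ℝ} {M : Polynomial ℝ →ₗ[ℝ] ℝ} {τ : ℝ}

/-- The solution of `radLap b p = -r`, corrected by its Sobolev projection of degree `m`. -/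
lemma exists_corrected_solution (hb : -1 < b) (h : IsRadMoment b M τ) (r : Polynomial ℝ) (m : ℕ) :
    ∃ p q : Polynomial ℝ, radLap b p = -r ∧ q.natDegree ≤ m ∧ (p - q).eval 1 = 0 ∧
      M (Polynomial.X * ((p - q).derivative * (p - q).derivative)) = M ((p - q) * r) ∧
      (m + 1) * (m + 1 + b) * M ((p - q) * (p - q)) ≤
        M (Polynomial.X * ((p - q).derivative * (p - q).derivative)) := by
  obtain ⟨p, hp, -⟩ := exists_radLap_eq hb (-r)
  -- The bound `m + p.natDegree` ensures that truncation at degree `m` stays inside the expansion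
  -- even if `p` has smaller degree.
  obtain ⟨a, ha⟩ := exists_radJ_expansion b (m + p.natDegree) p (by omega)
  set N := m + p.natDegree
  set S := Finset.Ico (m + 1) (N + 1)
  set L := fun j => radLap b (radJ b j)
  set μ : ℕ → ℝ := fun j => (j : ℝ) * (j + b)
  set q := ∑ j ∈ Finset.range (m + 1), a j • radJ b j with hq
  have hpq : p - q = ∑ j ∈ S, a j • radJ b j := by
    rw [sub_eq_iff_eq_add', hq, Finset.range_eq_Ico,
      Finset.sum_Ico_consecutive _ (Nat.zero_le _) (by omega), ← Finset.range_eq_Ico]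
    exact ha
  have hμ : ∀ j ∈ S, (m + 1) * (m + 1 + b) ≤ μ j ∧ 0 < μ j := by
    intro j hj
    have h1 : ((m + 1 : ℕ) : ℝ) ≤ j := by exact_mod_cast (Finset.mem_Ico.1 hj).1
    push_cast at h1
    have h2 : (0 : ℝ) ≤ m := by positivity
    constructor
    · exact mul_le_mul h1 (by linarith) (by linarith) (by linarith)
    · exact mul_pos (by linarith) (by linarith)
  have hj0 : ∀ j ∈ S, j ≠ 0 := fun j hj => by have := (Finset.mem_Ico.1 hj).1; omega
  have h1 : (p - q).eval 1 = 0 := by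
    rw [hpq, Polynomial.eval_finsetSum]
    refine Finset.sum_eq_zero fun j hj => ?_
    rw [Polynomial.eval_smul, eval_one_radJ hb (hj0 j hj), smul_zero]
  -- Each mode with `j ≥ 1` is a multiple of `(1 - X) * L j`, so `p - q = (1 - X) * η`. The `L j`
  -- are orthogonal for the weight `1 - X`, hence all pairings below become diagonal.
  set η := ∑ j ∈ S, (-(a j / μ j)) • L j with hη
  have hfac : p - q = (1 - Polynomial.X) * η := by
    rw [hpq, hη, Finset.mul_sum]
    refine Finset.sum_congr rfl fun j hj => ?_
    rw [mul_smul_comm, radLap_radJ hb, smul_smul]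
    congr 1
    have := (hμ j hj).2.ne'
    change a j = -(a j / μ j) * -μ j
    field_simp
  have hpair : ∀ i ∈ S, M ((p - q) * L i) = -(a i / μ i) * M ((1 - Polynomial.X) * (L i * L i)) := by
    intro i hi
    rw [hfac, hη, Finset.mul_sum, Finset.sum_mul, map_sum, Finset.sum_eq_single i]
    · rw [mul_smul_comm, smul_mul_assoc, map_smul, mul_assoc, smul_eq_mul]
    · intro j _ hji
      rw [mul_smul_comm, smul_mul_assoc, map_smul, mul_assoc, h.orthogonal hb hji, smul_zero]
    · exact fun hi' => absurd hi hi'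
  have hpairq : M ((p - q) * radLap b q) = 0 := by
    rw [hq, radLap_sum, Finset.mul_sum, map_sum]
    refine Finset.sum_eq_zero fun i hi => ?_
    rw [hfac, hη, Finset.mul_sum, Finset.sum_mul, map_sum]
    refine Finset.sum_eq_zero fun j hj => ?_
    have hji : j ≠ i := by
      have := (Finset.mem_Ico.1 hj).1
      have := Finset.mem_range.1 hi
      omega
    rw [radLap_smul, mul_smul_comm, mul_smul_comm, smul_mul_assoc, map_smul, map_smul, mul_assoc,
      h.orthogonal hb hji, smul_zero, smul_zero]
  have hE1 : M (Polynomial.X * ((p - q).derivative * (p - q).derivative)) =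
      -M ((p - q) * radLap b (p - q)) := by
    rw [h.mul_radLap, h1]; ring
  -- In `radLap b (p - q)` only the part `-r` pairs with `p - q`: the part from `q` consists of
  -- modes up to `m`, orthogonal to the remaining ones.
  have hE2 : M (Polynomial.X * ((p - q).derivative * (p - q).derivative)) = M ((p - q) * r) := by
    have e : p - q = p + (-1 : ℝ) • q := by rw [neg_one_smul, sub_eq_add_neg]
    have : radLap b (p - q) = -r + (-1 : ℝ) • radLap b q := by
      rw [e, radLap_add, radLap_smul, hp]
    rw [hE1, this, mul_add, mul_smul_comm, map_add, map_smul, hpairq, smul_zero, add_zero, mul_neg,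
      map_neg, neg_neg]
  refine ⟨p, q, hp, ?_, h1, hE2, ?_⟩
  · refine Polynomial.natDegree_sum_le_of_forall_le _ _ fun j hj => ?_
    refine (Polynomial.natDegree_smul_le _ _).trans ?_
    rw [natDegree_radJ]
    exact Nat.lt_succ_iff.1 (Finset.mem_range.1 hj)
  · have hE3 : M (Polynomial.X * ((p - q).derivative * (p - q).derivative)) =
        ∑ j ∈ S, a j ^ 2 / μ j * M ((1 - Polynomial.X) * (L j * L j)) := by
      have e : radLap b (p - q) = ∑ j ∈ S, a j • L j := by
        rw [hpq, radLap_sum]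
        exact Finset.sum_congr rfl fun j _ => radLap_smul _ _ _
      rw [hE1, e, Finset.mul_sum, map_sum, ← Finset.sum_neg_distrib]
      refine Finset.sum_congr rfl fun j hj => ?_
      rw [mul_smul_comm, map_smul, hpair j hj, smul_eq_mul]
      ring
    have hη2 : M ((1 - Polynomial.X) * (η * η)) =
        ∑ j ∈ S, a j ^ 2 / μ j ^ 2 * M ((1 - Polynomial.X) * (L j * L j)) := by
      rw [← mul_assoc, ← hfac]
      conv_lhs => rw [hη]
      rw [Finset.mul_sum, map_sum]
      refine Finset.sum_congr rfl fun j hj => ?_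
      rw [mul_smul_comm, map_smul, hpair j hj, smul_eq_mul]
      ring_nf
    -- In terms of the norms of the `L j`, the energy carries the factors `a j ^ 2 / μ j` and the
    -- squared norm is at most the sum with `a j ^ 2 / μ j ^ 2`. The spectral gap follows, as `μ j`
    -- is at least its value at `m + 1`.
    have hle : M ((p - q) * (p - q)) ≤ M ((1 - Polynomial.X) * (η * η)) := by
      rw [hfac]; exact h.one_sub_sq_le η
    have hm : (0 : ℝ) ≤ (m + 1) * (m + 1 + b) := by
      have : (0 : ℝ) ≤ m := by positivity
      exact mul_nonneg (by linarith) (by linarith)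
    refine (mul_le_mul_of_nonneg_left hle hm).trans ?_
    rw [hη2, hE3, Finset.mul_sum]
    refine Finset.sum_le_sum fun j hj => ?_
    have hn := h.one_sub_nonneg (L j)
    obtain ⟨g1, g2⟩ := hμ j hj
    rw [← mul_assoc]
    refine mul_le_mul_of_nonneg_right ?_ hn
    have : a j ^ 2 / μ j = μ j * (a j ^ 2 / μ j ^ 2) := by field_simp
    rw [this]
    exact mul_le_mul_of_nonneg_right g1 (by positivity)

/-- Let `E` be the energy and `u` the squared norm of `p - q`. The equation gives `E ^ 2 ≤ u * M (r
^ 2)` by Cauchy-Schwarz, so it suffices that `n ^ 2 u ≤ 4 E`, uniformly in `k ≤ n`. -/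
lemma exists_small_solution {A : ℝ} (hA : -1 < A) {k n : ℕ} (hk : k ≤ n)
    (h : IsRadMoment (2 * k + A) M τ) (r : Polynomial ℝ) :
    ∃ p q : Polynomial ℝ, radLap (2 * k + A) p = -r ∧ q.natDegree ≤ n - k ∧ (p - q).eval 1 = 0 ∧
      (n : ℝ) ^ 2 * M (Polynomial.X * ((p - q).derivative * (p - q).derivative)) ≤
        4 * M (r * r) := by
  have hk0 : (0 : ℝ) ≤ k := by positivity
  have hb : -1 < 2 * (k : ℝ) + A := by linarith
  obtain ⟨p, q, hp, hq, h1, hE, hs⟩ := h.exists_corrected_solution hb r (n - k)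
  refine ⟨p, q, hp, hq, h1, ?_⟩
  have hh := h.hardy (p - q) h1
  have cs := functional_cauchy_schwarz M h.sq_nonneg (p - q) r
  have hu := h.sq_nonneg (p - q)
  have hr := h.sq_nonneg r
  have hE0 := h.nonneg (p - q).derivative
  rw [← hE] at cs
  set E := M (Polynomial.X * ((p - q).derivative * (p - q).derivative))
  set u := M ((p - q) * (p - q))
  rw [Nat.cast_sub hk] at hs
  have hkn : (k : ℝ) ≤ n := by exact_mod_cast hk
  have hn0 : (0 : ℝ) ≤ n := by positivity
  have key : (n : ℝ) ^ 2 * u ≤ 4 * E := by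
    -- If `n ≤ 2 k`, Hardy's constant `(2 k + A + 1) ^ 2` exceeds `n ^ 2`. Otherwise the spectral
    -- gap is a product of a factor above `n / 2` and a factor above `n`.
    rcases le_total (n : ℝ) (2 * k) with hc | hc
    · refine le_trans (mul_le_mul_of_nonneg_right ?_ hu) hh
      nlinarith
    · refine le_trans (b := 4 * (((n : ℝ) - k + 1) * (n - k + 1 + (2 * k + A)) * u)) ?_ (by linarith)
      rw [← mul_assoc]
      refine mul_le_mul_of_nonneg_right ?_ hu
      nlinarith
  rcases hE0.eq_or_lt with h0 | h0
  · rw [← h0]; linarith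
  · refine le_of_mul_le_mul_left ?_ h0
    nlinarith [mul_le_mul_of_nonneg_right key hr, mul_le_mul_of_nonneg_left cs (_root_.sq_nonneg (n : ℝ))]

end IsRadMoment

end
end Tri

namespace Tri
noncomputable section

/-! ### Green's identities for functionals on polynomials in two variables -/

/-- Green's identities between a functional `F` on polynomials, its partial derivatives `G₁`, `G₂`
with weights `x ^ (α + 1) * y ^ β` and `x ^ α * y ^ (β + 1)`, and its trace `T`. -/
structure GreenId (α β : ℝ) (F G₁ G₂ T : Poly2 →ₗ[ℝ] ℝ) : Prop where
  gx : ∀ p, G₁ p + F (xP * dX p + (α + 1) • p) = T (xP * p)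
  gy : ∀ p, G₂ p + F (yP * dY p + (β + 1) • p) = T (yP * p)
  ts : ∀ p, T (sP * p) = T p

/-- `I` and `T` behave like the integrals of polynomials over the triangle and over its edge
`x + y = 1` with weight `x ^ α * y ^ β`. -/
structure IsMoment (α β : ℝ) (I T : Poly2 →ₗ[ℝ] ℝ) : Prop where
  green : GreenId α β I 0 0 T
  nx : ∀ p, 0 ≤ I (xP * (p * p))
  ny : ∀ p, 0 ≤ I (yP * (p * p))
  pos : ∀ p, p ≠ 0 → 0 < I ((1 - sP) * (p * p))
  nxyz : ∀ p, 0 ≤ I ((1 - sP) * (xP * yP * (p * p)))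

namespace GreenId

variable {α β : ℝ} {F G₁ G₂ T : Poly2 →ₗ[ℝ] ℝ}

/-- Taking `gx` at `y p` and `gy` at `x p`, both boundary terms are `T (x y p)` and cancel: the
field is tangent to the edge. -/
lemma tangential (h : GreenId α β F G₁ G₂ T) (p : Poly2) :
    G₂ (xP * p) - G₁ (yP * p) +
      F (xP * yP * dT p + ((β + 1) • xP - (α + 1) • yP) * p) = 0 := by
  have h1 := h.gx (yP * p)
  have h2 := h.gy (xP * p)
  have e : xP * yP * dT p + ((β + 1) • xP - (α + 1) • yP) * p =
      (yP * dY (xP * p) + (β + 1) • (xP * p)) - (xP * dX (yP * p) + (α + 1) • (yP * p)) := by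
    simp only [Derivation.leibniz, dX_y, dY_x, dT_apply, smul_eq_mul, sub_mul, smul_mul_assoc]
    ring
  have e2 : yP * (xP * p) = xP * (yP * p) := by ring
  rw [e, map_sub]
  rw [e2] at h2
  linarith

lemma angular (h : GreenId α β F G₁ G₂ T) (p : Poly2) :
    G₂ (xP * dT p) - G₁ (yP * dT p) = -F (ang α β p) := by
  have := h.tangential (dT p)
  rw [ang]
  linarith

/-- The divergence theorem for the radial field: the sum of `gx` and `gy`, with `x + y = 1` on the
edge. -/
lemma radial (h : GreenId α β F G₁ G₂ T) (p : Poly2) :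
    G₁ p + G₂ p + F (eul p + (α + β + 2) • p) = T p := by
  have h1 := h.gx p
  have h2 := h.gy p
  have h3 := h.ts p
  rw [sP, add_mul, map_add] at h3
  have e : eul p + (α + β + 2) • p =
      (xP * dX p + (α + 1) • p) + (yP * dY p + (β + 1) • p) := by
    rw [eul_apply, show α + β + 2 = (α + 1) + (β + 1) by ring, add_smul]
    abel
  rw [e, map_add]
  linarith

/-- The identities `gx` at `dX p` and `gy` at `dY p`, added; the conormal derivative on the edge is
`eul p`. -/
lemma laplace (h : GreenId α β F G₁ G₂ T) (p : Poly2) :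
    G₁ (dX p) + G₂ (dY p) + F (lap α β p) = T (eul p) := by
  have h1 := h.gx (dX p)
  have h2 := h.gy (dY p)
  have e : lap α β p =
      (xP * dX (dX p) + (α + 1) • dX p) + (yP * dY (dY p) + (β + 1) • dY p) := by
    rw [lap]; abel
  rw [e, map_add F, eul_apply, map_add T]
  linarith

lemma trace_mul_rad (h : GreenId α β F G₁ G₂ T) (p : Poly2) (r : Polynomial ℝ) :
    T (p * rad r) = r.eval 1 * T p := by
  induction r using Polynomial.induction_on' with
  | add r t hr ht => rw [rad_add, mul_add, map_add, hr, ht, Polynomial.eval_add, add_mul]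
  | monomial n a =>
    have e : Polynomial.monomial n a = a • Polynomial.monomial n (1 : ℝ) := by
      rw [Polynomial.smul_monomial, smul_eq_mul, mul_one]
    rw [Polynomial.eval_monomial, one_pow, mul_one, e, rad_smul, mul_smul_comm, map_smul,
      smul_eq_mul]
    congr 1
    clear e
    induction n with
    | zero => rw [Polynomial.monomial_zero_left, Polynomial.C_1, rad_one, mul_one]
    | succ n ih =>
      have : p * rad (Polynomial.monomial (n + 1) (1 : ℝ)) =
          sP * (p * rad (Polynomial.monomial n (1 : ℝ))) := by
        rw [← Polynomial.monomial_mul_X, rad_mul, rad_X]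
        ring
      rw [this, h.ts, ih]

end GreenId

/-- The Dirichlet form on polynomials. -/
def dirichlet (I : Poly2 →ₗ[ℝ] ℝ) (p q : Poly2) : ℝ :=
  I (xP * (dX p * dX q) + yP * (dY p * dY q))

lemma dirichlet_comm (I : Poly2 →ₗ[ℝ] ℝ) (p q : Poly2) : dirichlet I p q = dirichlet I q p := by
  rw [dirichlet, dirichlet, mul_comm (dX p), mul_comm (dY p)]

/-- The functional `r ↦ I (p ^ 2 * r (x + y))`. -/
def radial (I : Poly2 →ₗ[ℝ] ℝ) (p : Poly2) : Polynomial ℝ →ₗ[ℝ] ℝ :=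
  I ∘ₗ LinearMap.mulLeft ℝ (p * p) ∘ₗ (Polynomial.aeval sP).toLinearMap

lemma radial_apply (I : Poly2 →ₗ[ℝ] ℝ) (p : Poly2) (r : Polynomial ℝ) :
    radial I p r = I (p * p * rad r) := rfl

/-- The Sobolev form on polynomials. -/
def sobolev (lam : ℝ) (I T : Poly2 →ₗ[ℝ] ℝ) (p q : Poly2) : ℝ :=
  dirichlet I p q + lam * T (p * q)

lemma sobolev_comm (lam : ℝ) (I T : Poly2 →ₗ[ℝ] ℝ) (p q : Poly2) :
    sobolev lam I T p q = sobolev lam I T q p := by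
  rw [sobolev, sobolev, dirichlet_comm, mul_comm p]

/-- The Sobolev orthogonal polynomial of degree `k + j`. -/
def sobPoly (α β : ℝ) (k j : ℕ) : Poly2 := harm α β k * rad (radJ (2 * k + (α + β + 1)) j)

lemma sobPoly_zero (α β : ℝ) (k : ℕ) : sobPoly α β k 0 = harm α β k := by
  rw [sobPoly, radJ_zero, rad_one, mul_one]

/-- On the line `x + y = 1` it becomes a polynomial in `x` whose coefficient of degree `k` is `±1 /
k!`. -/
lemma harm_ne_zero (α β : ℝ) (k : ℕ) : harm α β k ≠ 0 := by
  intro h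
  have h1 : MvPolynomial.aeval ![(Polynomial.X : Polynomial ℝ), 1 - Polynomial.X] (harm α β k) = 0 := by
    rw [h, map_zero]
  have h2 := congrArg (fun p => Polynomial.coeff p k) h1
  simp only [harm, sP, map_sum, map_smul, map_mul, map_pow, map_add, MvPolynomial.aeval_X,
    Matrix.cons_val_zero, Matrix.cons_val_one, add_sub_cancel, one_pow, mul_one,
    Polynomial.finsetSum_coeff, Polynomial.coeff_smul, Polynomial.coeff_X_pow,
    Polynomial.coeff_zero] at h2
  rw [Finset.sum_eq_single k] at h2
  · rw [jcoef_self] at h2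
    have : (k.factorial : ℝ) ≠ 0 := by positivity
    simp [this] at h2
  · intro i _ hi
    simp [hi.symm]
  · simp

/-- Restriction to `y = 0`, where `x + y = x`, recovers `r`. -/
lemma rad_injective : Function.Injective rad := by
  intro r t h
  have e : ∀ r : Polynomial ℝ,
      MvPolynomial.aeval ![(Polynomial.X : Polynomial ℝ), 0] (rad r) = r := by
    intro r
    rw [rad, ← Polynomial.aeval_algHom_apply]
    simp [sP]
  rw [← e r, h, e]

lemma rad_ne_zero {r : Polynomial ℝ} (h : r ≠ 0) : rad r ≠ 0 := by
  intro h0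
  exact h (rad_injective (h0.trans (map_zero (Polynomial.aeval sP)).symm))

/-! ### Orthogonality and energy of the separated modes -/

namespace IsMoment

variable {α β : ℝ} {I T : Poly2 →ₗ[ℝ] ℝ}

lemma one_sub_nonneg (h : IsMoment α β I T) (p : Poly2) : 0 ≤ I ((1 - sP) * (p * p)) := by
  rcases eq_or_ne p 0 with rfl | hp
  · simp
  · exact (h.pos p hp).le

lemma sq_eq (_h : IsMoment α β I T) (p : Poly2) :
    I (p * p) = I (xP * (p * p)) + I (yP * (p * p)) + I ((1 - sP) * (p * p)) := by
  rw [← map_add, ← map_add]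
  congr 1
  rw [sP]; ring

lemma sq_nonneg (h : IsMoment α β I T) (p : Poly2) : 0 ≤ I (p * p) := by
  rw [h.sq_eq]
  linarith [h.nx p, h.ny p, h.one_sub_nonneg p]

lemma sq_pos (h : IsMoment α β I T) {p : Poly2} (hp : p ≠ 0) : 0 < I (p * p) := by
  rw [h.sq_eq]
  linarith [h.nx p, h.ny p, h.pos p hp]

/-- The tangential identity at `q * dT p`, in which `G₁` and `G₂` are zero. It shows that `ang` is
symmetric and negative for `I`. -/
lemma angular_symm (h : IsMoment α β I T) (p q : Poly2) :
    I (q * ang α β p) = -I (xP * yP * (dT q * dT p)) := by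
  have := h.green.tangential (q * dT p)
  rw [LinearMap.zero_apply, LinearMap.zero_apply, sub_zero, zero_add] at this
  have e : q * ang α β p + xP * yP * (dT q * dT p) =
      xP * yP * dT (q * dT p) + ((β + 1) • xP - (α + 1) • yP) * (q * dT p) := by
    rw [ang, Derivation.leibniz, smul_eq_mul, smul_eq_mul]
    ring
  rw [← sub_eq_zero, sub_neg_eq_add, ← map_add, e]
  exact this

lemma euler (h : IsMoment α β I T) (p : Poly2) : I (eul p + (α + β + 2) • p) = T p := by
  simpa using h.green.radial p

lemma dirichlet_eq (h : IsMoment α β I T) (p q : Poly2) :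
    dirichlet I p q = T (p * eul q) - I (p * lap α β q) := by
  have h1 := h.green.gx (p * dX q)
  have h2 := h.green.gy (p * dY q)
  rw [LinearMap.zero_apply, zero_add] at h1 h2
  have e : p * eul q = xP * (p * dX q) + yP * (p * dY q) := by rw [eul_apply]; ring
  rw [e, map_add, ← h1, ← h2, dirichlet, eq_sub_iff_add_eq, ← map_add, ← map_add]
  congr 1
  simp only [lap, Derivation.leibniz, smul_eq_mul, MvPolynomial.smul_eq_C_mul]
  ring

/-- Eigenfunctions of the symmetric operator `ang` for different eigenvalues. Radial factors are
harmless since `ang` treats them as constants, so the modes are orthogonal with arbitrary radial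
parts. -/
lemma harm_orthogonal (hα : -1 < α + β + 1) (h : IsMoment α β I T) {k l : ℕ} (hkl : k ≠ l)
    (r t : Polynomial ℝ) : I ((harm α β k * rad r) * (harm α β l * rad t)) = 0 := by
  have h1 := h.angular_symm (harm α β k * rad r) (harm α β l * rad t)
  have h2 := h.angular_symm (harm α β l * rad t) (harm α β k * rad r)
  rw [mul_comm (dT (harm α β l * rad t)), ← h2] at h1
  rw [ang_mul_rad, ang_mul_rad, ang_harm (by linarith), ang_harm (by linarith), smul_mul_assoc,
    smul_mul_assoc, mul_smul_comm, mul_smul_comm, map_smul, map_smul,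
    mul_comm (harm α β l * rad t), smul_eq_mul, smul_eq_mul] at h1
  have h3 : ((k : ℝ) - l) * (k + l + (α + β + 1)) *
      I ((harm α β k * rad r) * (harm α β l * rad t)) = 0 := by linear_combination -h1
  refine (mul_eq_zero.1 h3).resolve_left (mul_ne_zero (sub_ne_zero.2 (by exact_mod_cast hkl)) ?_)
  have : (1 : ℝ) ≤ k + l := by
    have : 1 ≤ k + l := by omega
    exact_mod_cast this
  linarith

/-- The edge integral is an interior integral by `euler`, and `eul` only changes the radial factor
of each mode. -/
lemma harm_trace_orthogonal (hα : -1 < α + β + 1) (h : IsMoment α β I T) {k l : ℕ} (hkl : k ≠ l)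
    (r t : Polynomial ℝ) : T ((harm α β k * rad r) * (harm α β l * rad t)) = 0 := by
  rw [← h.euler, Derivation.leibniz, eul_mul_rad _ _ (eul_harm α β k),
    eul_mul_rad _ _ (eul_harm α β l), smul_eq_mul, smul_eq_mul, map_add, map_add, map_smul,
    h.harm_orthogonal hα hkl, h.harm_orthogonal hα hkl, h.harm_orthogonal hα hkl.symm]
  simp

/-- Multiplying by `harm ^ 2`, of degree `2 k`, shifts the radial weight exponent by `2 k`. This
turns the problem in each angular mode into one in the single variable `s`. -/
lemma isRadMoment (h : IsMoment α β I T) (k : ℕ) :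
    IsRadMoment (2 * k + (α + β + 1)) (Tri.radial I (harm α β k))
      (T (harm α β k * harm α β k)) := by
  refine ⟨fun r => ?_, fun r => ?_, fun r hr => ?_⟩
  · rw [radial_apply, ← h.green.trace_mul_rad, ← h.euler]
    congr 1
    have e : eul (harm α β k * harm α β k) = ((2 * k : ℕ) : ℝ) • (harm α β k * harm α β k) := by
      rw [Derivation.leibniz, eul_harm, smul_eq_mul, mul_smul_comm, ← add_smul]
      push_cast
      congr 1
      ring
    rw [eul_mul_rad _ _ e, ← mul_smul_comm, ← mul_add, ← rad_smul, ← rad_add]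
    congr 2
    rw [add_right_comm _ (Polynomial.X * _), ← add_smul, add_comm]
    push_cast
    congr 2
    ring
  · rw [radial_apply]
    have e : harm α β k * harm α β k * rad (Polynomial.X * (r * r)) =
        xP * ((harm α β k * rad r) * (harm α β k * rad r)) +
        yP * ((harm α β k * rad r) * (harm α β k * rad r)) := by
      simp only [rad_mul, rad_X]; rw [sP]; ring
    rw [e, map_add]
    exact add_nonneg (h.nx _) (h.ny _)
  · rw [radial_apply]
    have e : harm α β k * harm α β k * rad ((1 - Polynomial.X) * (r * r)) =
        (1 - sP) * ((harm α β k * rad r) * (harm α β k * rad r)) := by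
      simp only [rad_mul, rad_X, rad_sub, rad_one]; ring
    rw [e]
    exact h.pos _ (mul_ne_zero (harm_ne_zero α β k) (rad_ne_zero hr))

/-- By Green's formula the energy is minus the pairing with `lap`, the edge term being zero because
`r` vanishes at `1`. As `lap` is purely radial on a mode, only `r'` survives. -/
lemma dirichlet_harm_self (hα : -1 < α + β + 1) (h : IsMoment α β I T) (k : ℕ)
    {r : Polynomial ℝ} (hr : r.eval 1 = 0) :
    dirichlet I (harm α β k * rad r) (harm α β k * rad r) =
      Tri.radial I (harm α β k) (Polynomial.X * (r.derivative * r.derivative)) := by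
  have h1 := (h.isRadMoment k).mul_radLap r r
  rw [hr] at h1
  rw [h.dirichlet_eq, lap_harm_mul (by linarith)]
  have e1 : harm α β k * rad r * eul (harm α β k * rad r) =
      harm α β k * eul (harm α β k * rad r) * rad r := by ring
  have e2 : harm α β k * rad r * (harm α β k * rad (radLap (2 * k + α + β + 1) r)) =
      harm α β k * harm α β k * rad (r * radLap (2 * k + (α + β + 1)) r) := by
    rw [rad_mul, ← add_assoc, ← add_assoc]; ring
  rw [e1, h.green.trace_mul_rad, hr, e2, ← radial_apply, h1]
  ring

lemma dirichlet_harm_orthogonal (hα : -1 < α + β + 1) (h : IsMoment α β I T) {k l : ℕ}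
    (hkl : k ≠ l) (r t : Polynomial ℝ) :
    dirichlet I (harm α β k * rad r) (harm α β l * rad t) = 0 := by
  rw [h.dirichlet_eq, lap_harm_mul (by linarith), eul_mul_rad _ _ (eul_harm α β l),
    h.harm_orthogonal hα hkl, h.harm_trace_orthogonal hα hkl, sub_zero]

/-- Only the boundary term of Green's formula remains, as `lap` kills `harm`; homogeneity makes it
`k` times the edge pairing. -/
lemma sobolev_harm (hα : -1 < α + β + 1) (h : IsMoment α β I T) (lam : ℝ) (k : ℕ)
    (p : Poly2) : sobolev lam I T p (harm α β k) = (k + lam) * T (p * harm α β k) := by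
  rw [sobolev, h.dirichlet_eq, lap_harm (by linarith), eul_harm, mul_smul_comm, map_smul, mul_zero,
    map_zero, smul_eq_mul]
  ring

lemma trace_mul_sobPoly (hα : -1 < α + β + 1) (h : IsMoment α β I T) (k : ℕ) {j : ℕ}
    (hj : j ≠ 0) (p : Poly2) : T (p * sobPoly α β k j) = 0 := by
  have hk : (0 : ℝ) ≤ k := by positivity
  rw [sobPoly, ← mul_assoc, h.green.trace_mul_rad, eval_one_radJ (by linarith) hj, zero_mul]

/-- Different angular indices are orthogonal in every term. For equal indices, a mode with radial
index `0` is tested by `sobolev_harm` against a polynomial vanishing on the edge; for two positive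
radial indices Green's formula reduces the energy to `IsRadMoment.orthogonal`. -/
lemma sobolev_sobPoly_orthogonal (hα : -1 < α + β + 1) (h : IsMoment α β I T) (lam : ℝ)
    {k i l j : ℕ} (hne : (k, i) ≠ (l, j)) :
    sobolev lam I T (sobPoly α β k i) (sobPoly α β l j) = 0 := by
  by_cases hkl : k = l
  · subst hkl
    have hij : i ≠ j := fun e => hne (by rw [e])
    have hk : (0 : ℝ) ≤ k := by positivity
    have hb : -1 < 2 * (k : ℝ) + (α + β + 1) := by linarith
    rcases Nat.eq_zero_or_pos i with rfl | hi
    · rw [sobolev_comm, sobPoly_zero, h.sobolev_harm hα, mul_comm (sobPoly α β k j),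
        h.trace_mul_sobPoly hα k hij.symm, mul_zero]
    rcases Nat.eq_zero_or_pos j with rfl | hj
    · rw [sobPoly_zero, h.sobolev_harm hα, mul_comm (sobPoly α β k i),
        h.trace_mul_sobPoly hα k hi.ne', mul_zero]
    rw [sobolev, h.trace_mul_sobPoly hα k hj.ne', h.dirichlet_eq,
      mul_comm (sobPoly α β k i) (eul _), h.trace_mul_sobPoly hα k hi.ne', sobPoly, sobPoly,
      lap_harm_mul (by linarith)]
    have e : harm α β k * rad (radJ (2 * k + (α + β + 1)) i) *
        (harm α β k * rad (radLap (2 * k + α + β + 1) (radJ (2 * k + (α + β + 1)) j))) =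
        harm α β k * harm α β k * rad (radJ (2 * k + (α + β + 1)) i *
          radLap (2 * k + (α + β + 1)) (radJ (2 * k + (α + β + 1)) j)) := by
      rw [rad_mul, ← add_assoc, ← add_assoc]; ring
    have e2 := radLap_radJ hb i
    have hi1 : (1 : ℝ) ≤ i := by exact_mod_cast hi
    have hne0 : -((i : ℝ) * (i + (2 * k + (α + β + 1)))) ≠ 0 := by
      have : 0 < (i : ℝ) * (i + (2 * k + (α + β + 1))) := by apply mul_pos <;> linarith
      linarith
    -- The eigenvalue equation solved for `radJ`, which exhibits the weight `1 - X` of the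
    -- orthogonality relation.
    have e3 : radJ (2 * k + (α + β + 1)) i = (-((i : ℝ) * (i + (2 * k + (α + β + 1)))))⁻¹ •
        ((1 - Polynomial.X) * radLap (2 * k + (α + β + 1)) (radJ (2 * k + (α + β + 1)) i)) := by
      rw [e2, smul_smul, inv_mul_cancel₀ hne0, one_smul]
    have e4 : radJ (2 * k + (α + β + 1)) i *
          radLap (2 * k + (α + β + 1)) (radJ (2 * k + (α + β + 1)) j) =
        (-((i : ℝ) * (i + (2 * k + (α + β + 1)))))⁻¹ •
        ((1 - Polynomial.X) * (radLap (2 * k + (α + β + 1)) (radJ (2 * k + (α + β + 1)) i) *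
          radLap (2 * k + (α + β + 1)) (radJ (2 * k + (α + β + 1)) j))) := by
      conv_lhs => rw [e3]
      rw [smul_mul_assoc, mul_assoc]
    rw [e, ← radial_apply, e4, map_smul, (h.isRadMoment k).orthogonal hb hij]
    simp
  · rw [sobolev, sobPoly, sobPoly, h.dirichlet_harm_orthogonal hα hkl,
      h.harm_trace_orthogonal hα hkl, mul_zero, add_zero]

lemma trace_harm_sq_pos (hα : -1 < α + β + 1) (h : IsMoment α β I T) (k : ℕ) :
    0 < T (harm α β k * harm α β k) := by
  have e : eul (harm α β k * harm α β k) = (2 * (k : ℝ)) • (harm α β k * harm α β k) := by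
    rw [Derivation.leibniz, eul_harm, smul_eq_mul, mul_smul_comm, ← add_smul]
    congr 1
    ring
  have hk : (0 : ℝ) ≤ k := by positivity
  rw [← h.euler, e, ← add_smul, map_smul, smul_eq_mul]
  exact mul_pos (by linarith) (h.sq_pos (harm_ne_zero α β k))

/-- For `j = 0` positivity comes from the edge term, which is where `lam > 0` matters when `k = 0`.
For `j ≥ 1` the energy times the positive number `μ` is the squared norm of `L ≠ 0` for the weight
`1 - X`. -/
lemma sobolev_self_pos (hα : -1 < α + β + 1) (h : IsMoment α β I T) {lam : ℝ} (hl : 0 < lam)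
    (k j : ℕ) : 0 < sobolev lam I T (sobPoly α β k j) (sobPoly α β k j) := by
  have hk : (0 : ℝ) ≤ k := by positivity
  have hb : -1 < 2 * (k : ℝ) + (α + β + 1) := by linarith
  rcases Nat.eq_zero_or_pos j with rfl | hj
  · rw [sobPoly_zero, h.sobolev_harm hα]
    exact mul_pos (by linarith) (h.trace_harm_sq_pos hα k)
  · rw [sobolev, h.trace_mul_sobPoly hα k hj.ne', mul_zero, add_zero, sobPoly,
      h.dirichlet_harm_self hα k (eval_one_radJ hb hj.ne')]
    have hM := h.isRadMoment k
    set M := Tri.radial I (harm α β k)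
    set ρ := radJ (2 * k + (α + β + 1)) j
    have h1 := hM.mul_radLap ρ ρ
    rw [eval_one_radJ hb hj.ne'] at h1
    have e2 := radLap_radJ hb j
    have hj1 : (1 : ℝ) ≤ j := by exact_mod_cast hj
    have hpos : 0 < (j : ℝ) * (j + (2 * k + (α + β + 1))) := by apply mul_pos <;> linarith
    set L := radLap (2 * k + (α + β + 1)) ρ with hLdef
    set μ := (j : ℝ) * (j + (2 * k + (α + β + 1)))
    have hL : L ≠ 0 := by
      intro h0
      change (1 - Polynomial.X) * L = (-μ) • ρ at e2
      rw [h0, mul_zero] at e2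
      rcases smul_eq_zero.1 e2.symm with h3 | h3
      · linarith
      · exact radJ_ne_zero _ _ h3
    have h4 := hM.pos L hL
    rw [← mul_assoc, e2, smul_mul_assoc, map_smul, smul_eq_mul, h1] at h4
    have h5 : 0 < μ * M (Polynomial.X * (ρ.derivative * ρ.derivative)) := by linarith
    exact (mul_pos_iff_of_pos_left hpos).1 h5

end IsMoment

end
end Tri

namespace Tri
noncomputable section

/-! ### Polynomials of bounded degree -/

/-- The span of the monomials of degree at most `n`. -/
def degSpan (n : ℕ) : Submodule ℝ Poly2 :=
  Submodule.span ℝ {p | ∃ i j, i + j ≤ n ∧ p = xP ^ i * yP ^ j}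

/-- The polynomials of degree at most `n`, in terms of the polynomials `harm`. -/
def harmSpan (α β : ℝ) (n : ℕ) : Submodule ℝ Poly2 :=
  Submodule.span ℝ {p | ∃ k r, k ≤ n ∧ r.natDegree ≤ n - k ∧ p = harm α β k * rad r}

lemma mem_degSpan_of_totalDegree_le {n : ℕ} {p : Poly2} (h : p.totalDegree ≤ n) :
    p ∈ degSpan n := by
  rw [p.as_sum]
  refine Submodule.sum_mem _ fun d hd => ?_
  have e : MvPolynomial.monomial d (p.coeff d) = p.coeff d • (xP ^ d 0 * yP ^ d 1) := by
    rw [MvPolynomial.monomial_eq, Finsupp.prod_fintype _ _ (by simp), Fin.prod_univ_two,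
      MvPolynomial.smul_eq_C_mul]
  rw [e]
  refine Submodule.smul_mem _ _ (Submodule.subset_span ⟨_, _, ?_, rfl⟩)
  have := MvPolynomial.le_totalDegree hd
  rw [Finsupp.sum_fintype _ _ (by simp), Fin.sum_univ_two] at this
  exact this.trans h

lemma mem_degSpan_totalDegree (p : Poly2) : p ∈ degSpan p.totalDegree :=
  mem_degSpan_of_totalDegree_le le_rfl

lemma dX_monomial_mem (i j n : ℕ) (h : i + j ≤ n) :
    dX (xP ^ i * yP ^ j) ∈ degSpan (n - 1) := by
  rw [Derivation.leibniz, Derivation.leibniz_pow, Derivation.leibniz_pow, dX_x, dX_y, smul_zero,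
    smul_zero, smul_zero, zero_add]
  simp only [smul_eq_mul, mul_one]
  cases i with
  | zero => simp
  | succ i =>
    rw [Nat.add_sub_cancel, mul_smul_comm, ← Nat.cast_smul_eq_nsmul ℝ, mul_comm]
    refine Submodule.smul_mem _ _ (Submodule.subset_span ?_)
    exact ⟨i, j, by omega, rfl⟩

lemma dY_monomial_mem (i j n : ℕ) (h : i + j ≤ n) :
    dY (xP ^ i * yP ^ j) ∈ degSpan (n - 1) := by
  rw [Derivation.leibniz, Derivation.leibniz_pow, Derivation.leibniz_pow, dY_x, dY_y, smul_zero,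
    smul_zero, smul_zero, add_zero]
  simp only [smul_eq_mul, mul_one]
  cases j with
  | zero => simp
  | succ j =>
    rw [Nat.add_sub_cancel, mul_smul_comm, ← Nat.cast_smul_eq_nsmul ℝ]
    refine Submodule.smul_mem _ _ (Submodule.subset_span ?_)
    exact ⟨i, j, by omega, rfl⟩

lemma dX_mem_degSpan {n : ℕ} {p : Poly2} (h : p ∈ degSpan n) : dX p ∈ degSpan (n - 1) := by
  induction h using Submodule.span_induction with
  | mem p hp => obtain ⟨i, j, hij, rfl⟩ := hp; exact dX_monomial_mem i j n hij
  | zero => rw [map_zero]; exact Submodule.zero_mem _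
  | add p q _ _ hp hq => rw [map_add]; exact Submodule.add_mem _ hp hq
  | smul c p _ hp => rw [Derivation.map_smul]; exact Submodule.smul_mem _ _ hp

lemma dY_mem_degSpan {n : ℕ} {p : Poly2} (h : p ∈ degSpan n) : dY p ∈ degSpan (n - 1) := by
  induction h using Submodule.span_induction with
  | mem p hp => obtain ⟨i, j, hij, rfl⟩ := hp; exact dY_monomial_mem i j n hij
  | zero => rw [map_zero]; exact Submodule.zero_mem _
  | add p q _ _ hp hq => rw [map_add]; exact Submodule.add_mem _ hp hq
  | smul c p _ hp => rw [Derivation.map_smul]; exact Submodule.smul_mem _ _ hp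

lemma totalDegree_sP : sP.totalDegree ≤ 1 := by
  refine (MvPolynomial.totalDegree_add _ _).trans ?_
  simp [MvPolynomial.totalDegree_X]

lemma totalDegree_rad (r : Polynomial ℝ) : (rad r).totalDegree ≤ r.natDegree := by
  rw [rad, Polynomial.aeval_eq_sum_range]
  refine MvPolynomial.totalDegree_finsetSum_le fun i hi => ?_
  refine (MvPolynomial.totalDegree_smul_le _ _).trans ((MvPolynomial.totalDegree_pow _ _).trans ?_)
  have := Finset.mem_range.1 hi
  nlinarith [totalDegree_sP]

lemma totalDegree_harm (α β : ℝ) (k : ℕ) : (harm α β k).totalDegree ≤ k := by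
  refine MvPolynomial.totalDegree_finsetSum_le fun i hi => ?_
  refine (MvPolynomial.totalDegree_smul_le _ _).trans ((MvPolynomial.totalDegree_mul _ _).trans ?_)
  have h1 := MvPolynomial.totalDegree_pow sP (k - i)
  have h2 : (xP ^ i).totalDegree ≤ i * 1 := by
    refine (MvPolynomial.totalDegree_pow _ _).trans ?_
    rw [MvPolynomial.totalDegree_X]
  have h3 : (k - i) * sP.totalDegree ≤ (k - i) * 1 := Nat.mul_le_mul_left _ totalDegree_sP
  have := Finset.mem_range.1 hi
  omega

lemma totalDegree_sobPoly (α β : ℝ) (k j : ℕ) : (sobPoly α β k j).totalDegree ≤ k + j := by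
  refine (MvPolynomial.totalDegree_mul _ _).trans (add_le_add (totalDegree_harm α β k) ?_)
  exact (totalDegree_rad _).trans (natDegree_radJ _ _).le

lemma harm_mul_s_pow_mem (α β : ℝ) {k j n : ℕ} (h : k + j ≤ n) :
    harm α β k * sP ^ j ∈ harmSpan α β n := by
  refine Submodule.subset_span ⟨k, Polynomial.X ^ j, by omega, ?_, ?_⟩
  · rw [Polynomial.natDegree_X_pow]; omega
  · rw [rad, map_pow, Polynomial.aeval_X]

/-- The top term of `harm α β i` is a nonzero multiple of `x ^ i`, so the passage from `harm` to
powers of `x` is triangular. -/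
lemma x_pow_mul_s_pow_mem (α β : ℝ) {n : ℕ} (i : ℕ) :
    ∀ j, i + j ≤ n → xP ^ i * sP ^ j ∈ harmSpan α β n := by
  induction i using Nat.strong_induction_on with
  | _ i ih =>
    intro j hij
    have h1 := harm_mul_s_pow_mem α β hij
    rw [harm, Finset.sum_range_succ, add_mul, Nat.sub_self, pow_zero, mul_one, jcoef_self] at h1
    have h2 : (∑ l ∈ Finset.range i, ((-1) ^ l * jcoef α β i l) • (xP ^ l * sP ^ (i - l))) * sP ^ j ∈
        harmSpan α β n := by
      rw [Finset.sum_mul]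
      refine Submodule.sum_mem _ fun l hl => ?_
      have hl' := Finset.mem_range.1 hl
      rw [smul_mul_assoc, mul_assoc, ← pow_add]
      exact Submodule.smul_mem _ _ (ih l hl' _ (by omega))
    have h3 := (Submodule.add_mem_iff_right _ h2).1 h1
    rw [smul_mul_assoc] at h3
    have hf : (i.factorial : ℝ) ≠ 0 := by positivity
    exact (Submodule.smul_mem_iff _ (mul_ne_zero (pow_ne_zero _ (by norm_num))
      (one_div_ne_zero hf))).1 h3

/-- Each factor `y` is traded for `s - x`. -/
lemma monomial_mem_harmSpan (α β : ℝ) {n : ℕ} (j : ℕ) :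
    ∀ i l, i + j + l ≤ n → xP ^ i * yP ^ j * sP ^ l ∈ harmSpan α β n := by
  induction j with
  | zero => intro i l h; rw [pow_zero, mul_one]; exact x_pow_mul_s_pow_mem α β i l (by omega)
  | succ j ih =>
    intro i l h
    have e : xP ^ i * yP ^ (j + 1) * sP ^ l =
        xP ^ i * yP ^ j * sP ^ (l + 1) - xP ^ (i + 1) * yP ^ j * sP ^ l := by
      rw [pow_succ sP, pow_succ yP, pow_succ xP]
      conv_rhs => rw [sP, ← sP]
      have : yP = sP - xP := by simp [sP]
      rw [this]; ring
    rw [e]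
    exact Submodule.sub_mem _ (ih _ _ (by omega)) (ih _ _ (by omega))

lemma degSpan_le_harmSpan (α β : ℝ) (n : ℕ) : degSpan n ≤ harmSpan α β n := by
  refine Submodule.span_le.2 ?_
  rintro _ ⟨i, j, hij, rfl⟩
  have := monomial_mem_harmSpan α β (n := n) j i 0 (by omega)
  rwa [pow_zero, mul_one] at this

/-- The degrees of the radial factors are not recorded: the modes are orthogonal whatever these
factors are. -/
lemma exists_harm_expansion {α β : ℝ} {n : ℕ} {p : Poly2} (h : p ∈ harmSpan α β n) :
    ∃ r : ℕ → Polynomial ℝ, p = ∑ k ∈ Finset.range (n + 1), harm α β k * rad (r k) := by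
  induction h using Submodule.span_induction with
  | mem p hp =>
    obtain ⟨k, r, hk, -, rfl⟩ := hp
    refine ⟨fun i => if i = k then r else 0, ?_⟩
    rw [Finset.sum_eq_single k]
    · simp only [if_true]
    · intro i _ hi
      simp only [if_neg hi, rad, map_zero, mul_zero]
    · intro hk'
      exact absurd (Finset.mem_range.2 (Nat.lt_succ_of_le hk)) hk'
  | zero => exact ⟨0, by simp [rad]⟩
  | add p q _ _ hp hq =>
    obtain ⟨r, rfl⟩ := hp
    obtain ⟨t, rfl⟩ := hq
    exact ⟨r + t, by simp [rad_add, mul_add, Finset.sum_add_distrib]⟩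
  | smul c p _ hp =>
    obtain ⟨r, rfl⟩ := hp
    exact ⟨c • r, by simp [rad_smul, Finset.smul_sum]⟩

/-! ### The error estimate in terms of functionals -/

lemma bilin_sum_sum_of_orthogonal {ι : Type*} (B : Poly2 →ₗ[ℝ] Poly2 →ₗ[ℝ] ℝ) (S : Finset ι)
    (p : ι → Poly2) (h : ∀ i ∈ S, ∀ j ∈ S, i ≠ j → B (p i) (p j) = 0) :
    B (∑ i ∈ S, p i) (∑ i ∈ S, p i) = ∑ i ∈ S, B (p i) (p i) := by
  rw [map_sum]
  refine Finset.sum_congr rfl fun i hi => ?_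
  rw [map_sum, LinearMap.sum_apply, Finset.sum_eq_single i]
  · exact fun j hj hji => h j hj i hi hji
  · exact fun hi' => absurd hi hi'

/-- The bilinear form `I (p * q)`. -/
def mulForm (I : Poly2 →ₗ[ℝ] ℝ) : Poly2 →ₗ[ℝ] Poly2 →ₗ[ℝ] ℝ := (LinearMap.mul ℝ Poly2).compr₂ I

/-- The Dirichlet form as a bilinear map. -/
def dirichletForm (I : Poly2 →ₗ[ℝ] ℝ) : Poly2 →ₗ[ℝ] Poly2 →ₗ[ℝ] ℝ :=
  LinearMap.mk₂ ℝ (dirichlet I)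
    (fun p q r => by
      simp only [dirichlet, map_add, mul_add, add_mul]; ring)
    (fun c p q => by
      simp only [dirichlet, Derivation.map_smul, map_add, smul_mul_assoc, mul_smul_comm, map_smul,
        smul_add])
    (fun p q r => by
      simp only [dirichlet, map_add, mul_add]; ring)
    (fun c p q => by
      simp only [dirichlet, Derivation.map_smul, map_add, mul_smul_comm, map_smul,
        smul_add])

variable {α β : ℝ} {I T₀ F G₁ G₂ T : Poly2 →ₗ[ℝ] ℝ} {En : ℝ} {n : ℕ}

/-- Writing `q = -ang Ψ` turns `F q` into a pairing of `G₁`, `G₂` with the tangential field `(-y dT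
Ψ, x dT Ψ)`. The energy of this field is at most `I (Ψ q)`, which gains `n ^ 2` since every
eigenvalue involved is at least that large. No orthogonality of `F` is needed. -/
lemma high_modes (hα : -1 < α + β + 1) (hI : IsMoment α β I T₀) (hF : GreenId α β F G₁ G₂ T)
    (hEn : 0 ≤ En)
    (hb : ∀ p q, (G₁ p + G₂ q) ^ 2 ≤ En * I (xP * (p * p) + yP * (q * q))) (hn : 1 ≤ n)
    (S : Finset ℕ) (hS : ∀ k ∈ S, n < k) (r : ℕ → Polynomial ℝ) :
    (n : ℝ) ^ 2 * F (∑ k ∈ S, harm α β k * rad (r k)) ^ 2 ≤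
      En * I ((∑ k ∈ S, harm α β k * rad (r k)) * ∑ k ∈ S, harm α β k * rad (r k)) := by
  set q := ∑ k ∈ S, harm α β k * rad (r k) with hq
  set ν : ℕ → ℝ := fun k => (k : ℝ) * (k + α + β + 1) with hν
  -- Here `k ≥ n + 1`, and `α + β + 1 > -1` costs less than `1` in the second factor.
  have hνn : ∀ k ∈ S, (n : ℝ) ^ 2 ≤ ν k := by
    intro k hk
    have h1 : ((n + 1 : ℕ) : ℝ) ≤ k := by exact_mod_cast hS k hk
    push_cast at h1
    have hn0 : (0 : ℝ) ≤ n := by positivity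
    rw [sq]
    exact mul_le_mul (by linarith) (by linarith) hn0 (by linarith)
  have hn1 : (1 : ℝ) ≤ n := by exact_mod_cast hn
  have hn2 : 0 < (n : ℝ) ^ 2 := by positivity
  set Ψ := ∑ k ∈ S, (ν k)⁻¹ • (harm α β k * rad (r k)) with hΨ
  have hang : ang α β Ψ = -q := by
    rw [hΨ, ang_sum, hq, ← Finset.sum_neg_distrib]
    refine Finset.sum_congr rfl fun k hk => ?_
    have h0 : ν k ≠ 0 := (hn2.trans_le (hνn k hk)).ne'
    rw [ang_smul, ang_mul_rad, ang_harm (by linarith), smul_mul_assoc, smul_smul]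
    change ((ν k)⁻¹ * -ν k) • _ = _
    rw [mul_neg, inv_mul_cancel₀ h0, neg_one_smul]
  have h1 : F q = G₁ (-(yP * dT Ψ)) + G₂ (xP * dT Ψ) := by
    have := hF.angular Ψ
    rw [hang, map_neg, neg_neg] at this
    rw [map_neg]
    linarith
  -- The two squares add up to `x y (x + y) (dT Ψ) ^ 2`, and `x + y ≤ 1`.
  have h2 : I (xP * (-(yP * dT Ψ) * -(yP * dT Ψ)) + yP * (xP * dT Ψ * (xP * dT Ψ))) ≤
      I (xP * yP * (dT Ψ * dT Ψ)) := by
    have := hI.nxyz (dT Ψ)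
    rw [← sub_nonneg, ← map_sub]
    convert this using 2
    rw [sP]; ring
  have h3 : I (xP * yP * (dT Ψ * dT Ψ)) = I (Ψ * q) := by
    have := hI.angular_symm Ψ Ψ
    rw [hang, mul_neg, map_neg, neg_inj] at this
    exact this.symm
  have h4 : I (q * q) = ∑ k ∈ S, I ((harm α β k * rad (r k)) * (harm α β k * rad (r k))) :=
    bilin_sum_sum_of_orthogonal (mulForm I) S _ fun i _ j _ hij => hI.harm_orthogonal hα hij _ _
  have h5 : I (Ψ * q) = ∑ k ∈ S, (ν k)⁻¹ * I ((harm α β k * rad (r k)) * (harm α β k * rad (r k))) := by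
    rw [hΨ, hq, Finset.sum_mul, map_sum]
    refine Finset.sum_congr rfl fun k hk => ?_
    rw [smul_mul_assoc, map_smul, smul_eq_mul, Finset.mul_sum, map_sum, Finset.sum_eq_single k]
    · exact fun j _ hj => hI.harm_orthogonal hα hj.symm _ _
    · exact fun hk' => absurd hk hk'
  have h6 : (n : ℝ) ^ 2 * I (Ψ * q) ≤ I (q * q) := by
    rw [h4, h5, Finset.mul_sum]
    refine Finset.sum_le_sum fun k hk => ?_
    have h0 : 0 < ν k := hn2.trans_le (hνn k hk)
    rw [← mul_assoc]
    refine mul_le_of_le_one_left (hI.sq_nonneg _) ?_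
    rw [← div_eq_mul_inv, div_le_one h0]
    exact hνn k hk
  rw [h1]
  calc (n : ℝ) ^ 2 * (G₁ (-(yP * dT Ψ)) + G₂ (xP * dT Ψ)) ^ 2
      ≤ (n : ℝ) ^ 2 * (En * I (Ψ * q)) := by
        refine mul_le_mul_of_nonneg_left ((hb _ _).trans ?_) hn2.le
        exact mul_le_mul_of_nonneg_left (h2.trans h3.le) hEn
    _ = En * ((n : ℝ) ^ 2 * I (Ψ * q)) := by ring
    _ ≤ En * I (q * q) := mul_le_mul_of_nonneg_left h6 hEn

/-- In each mode `-lap` is inverted radially, so Green's identity expresses `F` by `G₁` and `G₂` on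
a gradient; the edge term is a multiple of `T (harm α β k) = 0`. Subtracting a polynomial of degree
`n` does not change the pairing, and by `exists_small_solution` it makes the energy small. -/
lemma low_modes (hα : -1 < α + β + 1) (hI : IsMoment α β I T₀) (hF : GreenId α β F G₁ G₂ T)
    (hEn : 0 ≤ En)
    (hb : ∀ p q, (G₁ p + G₂ q) ^ 2 ≤ En * I (xP * (p * p) + yP * (q * q)))
    (hT : ∀ k ≤ n, T (harm α β k) = 0)
    (hE : ∀ p ∈ harmSpan α β n, G₁ (dX p) + G₂ (dY p) = 0)
    (S : Finset ℕ) (hS : ∀ k ∈ S, k ≤ n) (r : ℕ → Polynomial ℝ) :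
    (n : ℝ) ^ 2 * F (∑ k ∈ S, harm α β k * rad (r k)) ^ 2 ≤
      4 * (En * I ((∑ k ∈ S, harm α β k * rad (r k)) * ∑ k ∈ S, harm α β k * rad (r k))) := by
  -- Membership is placed inside the existential so that `choose` yields a plain function of `k`.
  have key : ∀ k : ℕ, ∃ φ : Polynomial ℝ, k ∈ S →
      (G₁ (dX (harm α β k * rad φ)) + G₂ (dY (harm α β k * rad φ)) = F (harm α β k * rad (r k)) ∧
      (n : ℝ) ^ 2 * dirichlet I (harm α β k * rad φ) (harm α β k * rad φ) ≤
        4 * I ((harm α β k * rad (r k)) * (harm α β k * rad (r k)))) := by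
    intro k
    by_cases hk : k ∈ S
    swap
    · exact ⟨0, fun h => absurd h hk⟩
    obtain ⟨p, q, h1, h2, h3, h4⟩ := (hI.isRadMoment k).exists_small_solution hα (hS k hk) (r k)
    refine ⟨p - q, fun _ => ⟨?_, ?_⟩⟩
    · have e0 : 2 * (k : ℝ) + α + β + 1 = 2 * k + (α + β + 1) := by ring
      have e1 := hF.laplace (harm α β k * rad p)
      have e2 := hE (harm α β k * rad q) (Submodule.subset_span ⟨k, q, hS k hk, h2, rfl⟩)
      rw [lap_harm_mul (by linarith), eul_mul_rad _ _ (eul_harm α β k), hF.trace_mul_rad,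
        hT k (hS k hk), mul_zero, e0, h1, rad_neg, mul_neg,
        map_neg] at e1
      rw [rad_sub, mul_sub, map_sub, map_sub, map_sub, map_sub]
      linarith
    · rw [hI.dirichlet_harm_self hα k h3]
      refine h4.trans (le_of_eq ?_)
      rw [radial_apply, rad_mul]
      congr 2
      ring
  choose φ hφ using key
  set q := ∑ k ∈ S, harm α β k * rad (r k) with hq
  set Φ := ∑ k ∈ S, harm α β k * rad (φ k) with hΦ
  have h1 : F q = G₁ (dX Φ) + G₂ (dY Φ) := by
    rw [hq, hΦ, map_sum, map_sum, map_sum, map_sum, map_sum, ← Finset.sum_add_distrib]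
    exact Finset.sum_congr rfl fun k hk => (hφ k hk).1.symm
  have h4 : I (q * q) = ∑ k ∈ S, I ((harm α β k * rad (r k)) * (harm α β k * rad (r k))) :=
    bilin_sum_sum_of_orthogonal (mulForm I) S _ fun i _ j _ hij => hI.harm_orthogonal hα hij _ _
  have h5 : dirichlet I Φ Φ =
      ∑ k ∈ S, dirichlet I (harm α β k * rad (φ k)) (harm α β k * rad (φ k)) :=
    bilin_sum_sum_of_orthogonal (dirichletForm I) S _
      fun i _ j _ hij => hI.dirichlet_harm_orthogonal hα hij _ _
  have h6 : (n : ℝ) ^ 2 * dirichlet I Φ Φ ≤ 4 * I (q * q) := by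
    rw [h4, h5, Finset.mul_sum, Finset.mul_sum]
    exact Finset.sum_le_sum fun k hk => (hφ k hk).2
  rw [h1]
  calc (n : ℝ) ^ 2 * (G₁ (dX Φ) + G₂ (dY Φ)) ^ 2
      ≤ (n : ℝ) ^ 2 * (En * dirichlet I Φ Φ) :=
        mul_le_mul_of_nonneg_left (hb _ _) (by positivity)
    _ = En * ((n : ℝ) ^ 2 * dirichlet I Φ Φ) := by ring
    _ ≤ En * (4 * I (q * q)) := mul_le_mul_of_nonneg_left h6 hEn
    _ = _ := by ring

/-- The duality estimate: a functional satisfying Green's identities and the orthogonality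
conditions of degree `n` is bounded by `3 / n` times the energy. -/
theorem functional_bound (hα : -1 < α + β + 1) (hI : IsMoment α β I T₀)
    (hF : GreenId α β F G₁ G₂ T) (hEn : 0 ≤ En)
    (hb : ∀ p q, (G₁ p + G₂ q) ^ 2 ≤ En * I (xP * (p * p) + yP * (q * q)))
    (hT : ∀ k ≤ n, T (harm α β k) = 0)
    (hE : ∀ p ∈ harmSpan α β n, G₁ (dX p) + G₂ (dY p) = 0) (hn : 1 ≤ n) (p : Poly2) :
    (n : ℝ) ^ 2 * F p ^ 2 ≤ 9 * (En * I (p * p)) := by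
  obtain ⟨r, hr⟩ := exists_harm_expansion
    (degSpan_le_harmSpan α β _ (mem_degSpan_totalDegree p))
  set S := Finset.range (p.totalDegree + 1)
  have h1 := low_modes hα hI hF hEn hb hT hE (S.filter (· ≤ n))
    (fun k hk => (Finset.mem_filter.1 hk).2) r
  have h2 := high_modes hα hI hF hEn hb hn (S.filter (¬ · ≤ n))
    (fun k hk => not_le.1 (Finset.mem_filter.1 hk).2) r
  have hsum := Finset.sum_filter_add_sum_filter_not S (· ≤ n) (fun k => harm α β k * rad (r k))
  rw [← hr] at hsum
  have horth : I ((∑ k ∈ S.filter (· ≤ n), harm α β k * rad (r k)) *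
      ∑ k ∈ S.filter (¬ · ≤ n), harm α β k * rad (r k)) = 0 := by
    rw [Finset.sum_mul_sum, map_sum]
    refine Finset.sum_eq_zero fun k hk => ?_
    rw [map_sum]
    refine Finset.sum_eq_zero fun l hl => hI.harm_orthogonal hα ?_ _ _
    rintro rfl
    exact (Finset.mem_filter.1 hl).2 (Finset.mem_filter.1 hk).2
  set u := ∑ k ∈ S.filter (· ≤ n), harm α β k * rad (r k)
  set v := ∑ k ∈ S.filter (¬ · ≤ n), harm α β k * rad (r k)
  have e : p * p = u * u + v * v + (2 : ℝ) • (u * v) := by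
    rw [← hsum, two_smul]; ring
  have hI0 : I (p * p) = I (u * u) + I (v * v) := by
    rw [e, map_add, map_add, map_smul, horth, smul_zero, add_zero]
  rw [hI0, ← hsum, map_add]
  have hu := mul_nonneg hEn (hI.sq_nonneg u)
  have hv := mul_nonneg hEn (hI.sq_nonneg v)
  -- The two bounds have constants `4` and `1`, and `(2 a + b) ^ 2 ≤ 5 (a ^ 2 + b ^ 2)`; the value
  -- `9` leaves room and is a square.
  nlinarith [mul_nonneg (sq_nonneg (n : ℝ)) (sq_nonneg (F u - F v)),
    mul_nonneg (sq_nonneg (n : ℝ)) (sq_nonneg (F u - 2 * F v)),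
    mul_nonneg (sq_nonneg (n : ℝ)) (sq_nonneg (F u)),
    mul_nonneg (sq_nonneg (n : ℝ)) (sq_nonneg (F v))]

/-- Sobolev orthogonality to the basis polynomials of degree at most `n` extends to all
polynomials of degree at most `n`. -/
lemma sobolev_eq_zero_of_mem {lam : ℝ}
    (hS : ∀ k j, k + j ≤ n →
      G₁ (dX (sobPoly α β k j)) + G₂ (dY (sobPoly α β k j)) + lam * T (sobPoly α β k j) = 0)
    {p : Poly2} (hp : p ∈ harmSpan α β n) : G₁ (dX p) + G₂ (dY p) + lam * T p = 0 := by
  induction hp using Submodule.span_induction with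
  | mem p hp =>
    obtain ⟨k, r, hk, hr, rfl⟩ := hp
    obtain ⟨a, rfl⟩ := exists_radJ_expansion (2 * k + (α + β + 1)) (n - k) r hr
    have e : harm α β k * rad (∑ j ∈ Finset.range (n - k + 1), a j •
        radJ (2 * k + (α + β + 1)) j) = ∑ j ∈ Finset.range (n - k + 1), a j • sobPoly α β k j := by
      rw [rad_sum, Finset.mul_sum]
      exact Finset.sum_congr rfl fun j _ => by rw [rad_smul, mul_smul_comm, sobPoly]
    rw [e, map_sum, map_sum, map_sum, map_sum, map_sum, Finset.mul_sum, ← Finset.sum_add_distrib,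
      ← Finset.sum_add_distrib]
    refine Finset.sum_eq_zero fun j hj => ?_
    have hj' := Finset.mem_range.1 hj
    have := hS k j (by omega)
    rw [Derivation.map_smul, Derivation.map_smul, map_smul, map_smul, map_smul, smul_eq_mul,
      smul_eq_mul, smul_eq_mul]
    linear_combination a j * this
  | zero => simp
  | add p q _ _ hp hq =>
    simp only [map_add]
    linear_combination hp + hq
  | smul c p _ hp =>
    simp only [Derivation.map_smul, map_smul, smul_eq_mul]
    linear_combination c * hp

/-- Consequences of Sobolev orthogonality of degree `n`. -/
theorem orthogonality (hα : -1 < α + β + 1) (hF : GreenId α β F G₁ G₂ T) {lam : ℝ}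
    (hl : 0 < lam)
    (hS : ∀ p ∈ harmSpan α β n, G₁ (dX p) + G₂ (dY p) + lam * T p = 0) :
    (∀ p ∈ harmSpan α β n, T p = 0) ∧ (∀ p ∈ harmSpan α β n, G₁ (dX p) + G₂ (dY p) = 0) ∧
      (1 ≤ n → (∀ p ∈ degSpan (n - 1), G₁ p = 0) ∧ ∀ p ∈ degSpan (n - 1), G₂ p = 0) := by
  -- Since `lap` kills `harm`, Green's identity turns the energy pairing into `k * T (harm α β k)`.
  -- Positivity of `lam` covers `k = 0`.
  have hTh : ∀ k ≤ n, T (harm α β k) = 0 := by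
    intro k hk
    have h1 := hF.laplace (harm α β k)
    have h2 := hS (harm α β k) (Submodule.subset_span ⟨k, 1, hk, by simp, by
      rw [rad_one, mul_one]⟩)
    rw [lap_harm (by linarith), map_zero, add_zero, eul_harm, map_smul, smul_eq_mul] at h1
    have hk0 : (0 : ℝ) ≤ k := by positivity
    have h3 : ((k : ℝ) + lam) * T (harm α β k) = 0 := by rw [h1] at h2; linarith
    exact (mul_eq_zero.1 h3).resolve_left (by linarith)
  have hT : ∀ p ∈ harmSpan α β n, T p = 0 := by
    intro p hp
    induction hp using Submodule.span_induction with
    | mem p hp =>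
      obtain ⟨k, r, hk, -, rfl⟩ := hp
      rw [hF.trace_mul_rad, hTh k hk, mul_zero]
    | zero => rw [map_zero]
    | add p q _ _ hp hq => rw [map_add, hp, hq, add_zero]
    | smul c p _ hp => rw [map_smul, hp, smul_zero]
  have hE : ∀ p ∈ harmSpan α β n, G₁ (dX p) + G₂ (dY p) = 0 := by
    intro p hp
    have := hS p hp
    rwa [hT p hp, mul_zero, add_zero] at this
  refine ⟨hT, hE, fun hn => ?_⟩
  -- Every polynomial of degree `n - 1` is `lap` of one of degree `n`, for which the energy pairing
  -- and the edge term both vanish.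
  have hF0 : ∀ p ∈ harmSpan α β (n - 1), F p = 0 := by
    intro p hp
    induction hp using Submodule.span_induction with
    | mem p hp =>
      obtain ⟨k, r, hk, hr, rfl⟩ := hp
      have hk0 : (0 : ℝ) ≤ k := by positivity
      obtain ⟨q, hq, hqd⟩ := exists_radLap_eq (b := 2 * k + α + β + 1) (by linarith) r
      have hkn : k ≤ n := by omega
      have h1 := hF.laplace (harm α β k * rad q)
      rw [hE _ (Submodule.subset_span ⟨k, q, hkn, by omega, rfl⟩), zero_add,
        lap_harm_mul (by linarith), hq, eul_mul_rad _ _ (eul_harm α β k), hF.trace_mul_rad,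
        hTh k hkn, mul_zero] at h1
      exact h1
    | zero => rw [map_zero]
    | add p q _ _ hp hq => rw [map_add, hp, hq, add_zero]
    | smul c p _ hp => rw [map_smul, hp, smul_zero]
  have hTd : ∀ i j, i + j ≤ n → T (xP ^ i * yP ^ j) = 0 := fun i j hij =>
    hT _ (degSpan_le_harmSpan α β n (Submodule.subset_span ⟨i, j, hij, rfl⟩))
  have hFd : ∀ i j, i + j ≤ n - 1 → F (xP ^ i * yP ^ j) = 0 := fun i j hij =>
    hF0 _ (degSpan_le_harmSpan α β (n - 1) (Submodule.subset_span ⟨i, j, hij, rfl⟩))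
  have hpow : ∀ (d : Derivation ℝ Poly2 Poly2) (z : Poly2) (i : ℕ), d z = 1 →
      z * d (z ^ i) = (i : ℝ) • z ^ i := by
    intro d z i hz
    rw [Derivation.leibniz_pow, hz]
    cases i with
    | zero => simp
    | succ i =>
      rw [Nat.add_sub_cancel, smul_eq_mul, mul_one, mul_smul_comm, ← pow_succ',
        ← Nat.cast_smul_eq_nsmul ℝ]
  constructor
  · intro p hp
    induction hp using Submodule.span_induction with
    | mem p hp =>
      obtain ⟨i, j, hij, rfl⟩ := hp
      -- On a monomial `x ∂/∂x` is multiplication by `i`, so `G₁` is determined by `F` in degree `n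
      -- - 1` and `T` in degree `n`, both zero.
      have h1 := hF.gx (xP ^ i * yP ^ j)
      have e : xP * dX (xP ^ i * yP ^ j) = (i : ℝ) • (xP ^ i * yP ^ j) := by
        rw [Derivation.leibniz, Derivation.leibniz_pow dX (a := yP), dX_y, smul_zero, smul_zero, smul_zero,
          zero_add, smul_eq_mul, mul_left_comm, hpow dX xP i dX_x, mul_smul_comm, mul_comm]
      rw [e, ← add_smul, map_smul, hFd i j hij, smul_zero, add_zero, ← mul_assoc, ← pow_succ',
        hTd _ _ (by omega)] at h1
      exact h1
    | zero => rw [map_zero]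
    | add p q _ _ hp hq => rw [map_add, hp, hq, add_zero]
    | smul c p _ hp => rw [map_smul, hp, smul_zero]
  · intro p hp
    induction hp using Submodule.span_induction with
    | mem p hp =>
      obtain ⟨i, j, hij, rfl⟩ := hp
      have h1 := hF.gy (xP ^ i * yP ^ j)
      have e : yP * dY (xP ^ i * yP ^ j) = (j : ℝ) • (xP ^ i * yP ^ j) := by
        rw [Derivation.leibniz, Derivation.leibniz_pow dY (a := xP), dY_x, smul_zero, smul_zero, smul_zero,
          add_zero, smul_eq_mul, mul_left_comm, hpow dY yP j dY_y, mul_smul_comm]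
      rw [e, ← add_smul, map_smul, hFd i j hij, smul_zero, add_zero, mul_left_comm, ← pow_succ',
        hTd _ _ (by omega)] at h1
      exact h1
    | zero => rw [map_zero]
    | add p q _ _ hp hq => rw [map_add, hp, hq, add_zero]
    | smul c p _ hp => rw [map_smul, hp, smul_zero]

end
end Tri

namespace Tri
noncomputable section

open Filter Topology

/-! ### The triangle -/

lemma isOpen_tri : IsOpen tri := by
  have h : tri = {p : ℝ × ℝ | 0 < p.1} ∩ ({p | 0 < p.2} ∩ {p | p.1 + p.2 < 1}) := rfl
  rw [h]
  exact (isOpen_lt continuous_const continuous_fst).inter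
    ((isOpen_lt continuous_const continuous_snd).inter
      (isOpen_lt (continuous_fst.add continuous_snd) continuous_const))

lemma measurableSet_tri : MeasurableSet tri := isOpen_tri.measurableSet

lemma isClosed_closedTri : IsClosed closedTri := by
  have h : closedTri = {p : ℝ × ℝ | 0 ≤ p.1} ∩ ({p | 0 ≤ p.2} ∩ {p | p.1 + p.2 ≤ 1}) := rfl
  rw [h]
  exact (isClosed_le continuous_const continuous_fst).inter
    ((isClosed_le continuous_const continuous_snd).inter
      (isClosed_le (continuous_fst.add continuous_snd) continuous_const))

lemma tri_subset_closedTri : tri ⊆ closedTri := fun _ h => ⟨h.1.le, h.2.1.le, h.2.2.le⟩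

lemma closedTri_subset_Icc : closedTri ⊆ Set.Icc (0 : ℝ) 1 ×ˢ Set.Icc (0 : ℝ) 1 := by
  rintro p ⟨h1, h2, h3⟩
  exact ⟨⟨h1, by linarith⟩, ⟨h2, by linarith⟩⟩

lemma isCompact_closedTri : IsCompact closedTri :=
  (isCompact_Icc.prod isCompact_Icc).of_isClosed_subset isClosed_closedTri closedTri_subset_Icc

lemma tri_subset_Ioo : tri ⊆ Set.Ioo (0 : ℝ) 1 ×ˢ Set.Ioo (0 : ℝ) 1 := by
  rintro p ⟨h1, h2, h3⟩
  exact ⟨⟨h1, by linarith⟩, ⟨h2, by linarith⟩⟩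

lemma edge_subset : (fun t : ℝ => (t, 1 - t)) '' Set.Ioo 0 1 ⊆ closedTri := by
  rintro _ ⟨t, ⟨h0, h1⟩, rfl⟩
  exact ⟨h0.le, by simp only; linarith, by simp⟩

/-- The triangle together with the open edge `x + y = 1`. -/
def triZ : Set (ℝ × ℝ) := tri ∪ (fun t : ℝ => (t, 1 - t)) '' Set.Ioo 0 1

lemma mem_triZ {p : ℝ × ℝ} : p ∈ triZ ↔ 0 < p.1 ∧ 0 < p.2 ∧ p.1 + p.2 ≤ 1 := by
  constructor
  · rintro (h | ⟨t, ⟨h0, h1⟩, rfl⟩)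
    · exact ⟨h.1, h.2.1, h.2.2.le⟩
    · exact ⟨h0, by simp only; linarith, by simp⟩
  · rintro ⟨h1, h2, h3⟩
    rcases h3.lt_or_eq with h | h
    · exact Or.inl ⟨h1, h2, h⟩
    · exact Or.inr ⟨p.1, ⟨h1, by linarith⟩, Prod.ext rfl (by simp only; linarith)⟩

lemma volume_edge : volume ((fun t : ℝ => ((t, 1 - t) : ℝ × ℝ)) '' Set.Ioo 0 1) = 0 := by
  refine measure_mono_null (t := {p : ℝ × ℝ | p.1 + p.2 = 1}) ?_ ?_
  · rintro _ ⟨t, -, rfl⟩; simp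
  · have hm : MeasurableSet {p : ℝ × ℝ | p.1 + p.2 = 1} :=
      (isClosed_eq (continuous_fst.add continuous_snd) continuous_const).measurableSet
    rw [Measure.volume_eq_prod, Measure.measure_prod_null hm]
    refine Eventually.of_forall fun x => ?_
    have : Prod.mk x ⁻¹' {p : ℝ × ℝ | p.1 + p.2 = 1} ⊆ {1 - x} := by
      intro y hy
      simp only [Set.mem_preimage, Set.mem_ofPred_eq] at hy
      simp only [Set.mem_singleton_iff]
      linarith
    exact measure_mono_null this (measure_singleton _)

lemma triZ_ae_eq : (triZ : Set (ℝ × ℝ)) =ᵐ[volume] tri := union_ae_eq_left_of_ae_eq_empty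
  (ae_eq_empty.2 volume_edge)

/-! ### Smooth cutoff functions -/

/-- A smooth function vanishing for `(N + 1) x ≤ 1` and equal to `1` for `2 ≤ (N + 1) x`. -/
def cut (N : ℕ) (x : ℝ) : ℝ := Real.smoothTransition ((N + 1) * x - 1)

lemma contDiff_cut (N : ℕ) : ContDiff ℝ (⊤ : ℕ∞) (cut N) :=
  Real.smoothTransition.contDiff.comp ((contDiff_const.mul contDiff_id).sub contDiff_const)

lemma differentiable_cut (N : ℕ) : Differentiable ℝ (cut N) :=
  (contDiff_cut N).differentiable (by simp)

lemma cut_nonneg (N : ℕ) (x : ℝ) : 0 ≤ cut N x := Real.smoothTransition.nonneg _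
lemma cut_le_one (N : ℕ) (x : ℝ) : cut N x ≤ 1 := Real.smoothTransition.le_one _
lemma abs_cut_le_one (N : ℕ) (x : ℝ) : |cut N x| ≤ 1 := by
  rw [abs_of_nonneg (cut_nonneg N x)]; exact cut_le_one N x

lemma cut_eq_zero {N : ℕ} {x : ℝ} (h : (N + 1) * x ≤ 1) : cut N x = 0 :=
  Real.smoothTransition.zero_of_nonpos (by linarith)

lemma cut_eq_one {N : ℕ} {x : ℝ} (h : 2 ≤ (N + 1) * x) : cut N x = 1 :=
  Real.smoothTransition.one_of_one_le (by linarith)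

lemma deriv_cut (N : ℕ) (x : ℝ) :
    deriv (cut N) x = (N + 1) * deriv Real.smoothTransition ((N + 1) * x - 1) := by
  have h1 : HasDerivAt (fun x : ℝ => ((N : ℝ) + 1) * x - 1) (((N : ℝ) + 1) * 1) x :=
    ((hasDerivAt_id x).const_mul _).sub_const _
  have hd : Differentiable ℝ Real.smoothTransition :=
    (Real.smoothTransition.contDiff (n := 1)).differentiable (by simp)
  have h2 := (hd (((N : ℝ) + 1) * x - 1)).hasDerivAt.comp x h1
  have h3 : deriv (cut N) x = _ := h2.deriv
  rw [h3]; ring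

lemma deriv_cut_eq_zero {N : ℕ} {x : ℝ} (h : (N + 1) * x < 1 ∨ 2 < (N + 1) * x) :
    deriv (cut N) x = 0 := by
  have hc : Continuous fun x : ℝ => ((N : ℝ) + 1) * x := by fun_prop
  rcases h with h | h
  · have : cut N =ᶠ[𝓝 x] fun _ => 0 := by
      filter_upwards [(isOpen_Iio.preimage hc).mem_nhds h] with y hy
      exact cut_eq_zero (le_of_lt hy)
    rw [this.deriv_eq, deriv_const]
  · have : cut N =ᶠ[𝓝 x] fun _ => 1 := by
      filter_upwards [(isOpen_Ioi.preimage hc).mem_nhds h] with y hy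
      exact cut_eq_one (le_of_lt hy)
    rw [this.deriv_eq, deriv_const]

/-- The derivative has size `N + 1` but lives where `1 ≤ (N + 1) x ≤ 2`, so multiplication by `x`
makes it uniformly bounded. This bound drives the passages to the limit at the edges. -/
lemma exists_deriv_cut_bound :
    ∃ C : ℝ, 0 ≤ C ∧ (∀ (N : ℕ) (x : ℝ), |deriv (cut N) x| ≤ C * (N + 1)) ∧
      ∀ (N : ℕ) (x : ℝ), 0 ≤ x → x * |deriv (cut N) x| ≤ C := by
  have hc : Continuous (deriv Real.smoothTransition) :=
    (Real.smoothTransition.contDiff (n := 1)).continuous_deriv le_rfl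
  obtain ⟨C, hC⟩ := isCompact_Icc (a := (0 : ℝ)) (b := 1) |>.exists_bound_of_continuousOn
    hc.continuousOn
  have hC0 : 0 ≤ C := (norm_nonneg _).trans (hC 0 ⟨le_rfl, zero_le_one⟩)
  have hb : ∀ (N : ℕ) (x : ℝ), |deriv (cut N) x| ≤ C * (N + 1) := by
    intro N x
    have hN : (0 : ℝ) < N + 1 := by positivity
    by_cases h : (N + 1) * x < 1 ∨ 2 < (N + 1) * x
    · rw [deriv_cut_eq_zero h, abs_zero]; positivity
    · push Not at h
      rw [deriv_cut, abs_mul, abs_of_pos hN, mul_comm]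
      exact mul_le_mul_of_nonneg_right (hC _ ⟨by linarith, by linarith⟩) hN.le
  refine ⟨2 * C, by positivity, fun N x => (hb N x).trans ?_, fun N x hx => ?_⟩
  · have hN : (0 : ℝ) < N + 1 := by positivity
    nlinarith [mul_nonneg hC0 hN.le]
  · by_cases h : (N + 1) * x < 1 ∨ 2 < (N + 1) * x
    · rw [deriv_cut_eq_zero h, abs_zero, mul_zero]; positivity
    · push Not at h
      calc x * |deriv (cut N) x| ≤ x * (C * (N + 1)) := mul_le_mul_of_nonneg_left (hb N x) hx
        _ = C * ((N + 1) * x) := by ring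
        _ ≤ C * 2 := mul_le_mul_of_nonneg_left h.2 hC0
        _ = 2 * C := by ring

lemma eventually_cut_eq {x : ℝ} (hx : 0 < x) :
    ∀ᶠ N : ℕ in atTop, cut N x = 1 ∧ deriv (cut N) x = 0 := by
  have h1 : Tendsto (fun N : ℕ => ((N : ℝ) + 1) * x) atTop atTop :=
    (tendsto_natCast_atTop_atTop.atTop_add tendsto_const_nhds).atTop_mul_const hx
  filter_upwards [h1.eventually_gt_atTop 2] with N hN
  exact ⟨cut_eq_one hN.le, deriv_cut_eq_zero (Or.inr hN)⟩

/-- A compactly supported smooth function equal to `1` near the closed triangle. -/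
def bump : ContDiffBump (0 : ℝ × ℝ) := ⟨2, 3, by norm_num, by norm_num⟩

lemma bump_eventuallyEq {p : ℝ × ℝ} (hp : p ∈ closedTri) : (bump : ℝ × ℝ → ℝ) =ᶠ[𝓝 p] 1 := by
  refine bump.eventuallyEq_one_of_mem_ball ?_
  rw [Metric.mem_ball, dist_zero_right]
  obtain ⟨⟨h1, h2⟩, h3, h4⟩ := closedTri_subset_Icc hp
  refine lt_of_le_of_lt (b := 1) ?_ one_lt_two
  rw [Prod.norm_def]
  refine max_le ?_ ?_
  · rw [Real.norm_of_nonneg h1]; exact h2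
  · rw [Real.norm_of_nonneg h3]; exact h4

/-! ### Weak derivatives -/

/-- The support meets the closed triangle in a compact subset of `S`, where `f` is integrable. -/
lemma integrableOn_mul_of_tsupport {f φ : ℝ × ℝ → ℝ} {S : Set (ℝ × ℝ)}
    (hf : LocallyIntegrableOn f S) (hφ : Continuous φ) (hS : tsupport φ ∩ closedTri ⊆ S) :
    IntegrableOn (fun p => f p * φ p) tri := by
  have hK : IsCompact (tsupport φ ∩ closedTri) :=
    isCompact_closedTri.inter_left (isClosed_tsupport φ)
  have h1 : IntegrableOn f (tsupport φ ∩ closedTri) := hf.integrableOn_compact_subset hS hK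
  have h2 := h1.mul_continuousOn hφ.continuousOn hK
  have h3 : IntegrableOn (fun p => f p * φ p) closedTri := by
    refine h2.of_forall_sdiff_eq_zero isClosed_closedTri.measurableSet fun p hp => ?_
    have : p ∉ tsupport φ := fun h => hp.2 ⟨h, hp.1⟩
    rw [image_eq_zero_of_notMem_tsupport this, mul_zero]
  exact h3.mono_set tri_subset_closedTri

lemma tsupport_fderiv_apply_subset (φ : ℝ × ℝ → ℝ) (v : ℝ × ℝ) :
    tsupport (fun p => fderiv ℝ φ p v) ⊆ tsupport φ := by
  refine closure_minimal (fun p hp => ?_) (isClosed_tsupport φ)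
  have : fderiv ℝ φ p ≠ 0 := fun h => hp (by simp only [h, _root_.zero_apply])
  exact support_fderiv_subset ℝ this

lemma continuous_fderiv_apply {φ : ℝ × ℝ → ℝ} (hφ : ContDiff ℝ (⊤ : ℕ∞) φ) (v : ℝ × ℝ) :
    Continuous fun p => fderiv ℝ φ p v :=
  (hφ.continuous_fderiv (by simp)).clm_apply continuous_const

lemma setIntegral_tri_eq {φ : ℝ × ℝ → ℝ} (h : ∀ p ∉ tri, φ p = 0) :
    ∫ p in tri, φ p = ∫ p, φ p :=
  setIntegral_eq_integral_of_forall_compl_eq_zero h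

namespace HasWeakDeriv

variable {v v' : ℝ × ℝ} {f f' u u' : ℝ × ℝ → ℝ}

lemma ae_eq (h : HasWeakDeriv v f u) (h' : HasWeakDeriv v f u') :
    u =ᵐ[volume.restrict tri] u' := by
  have h0 := isOpen_tri.ae_eq_zero_of_integral_contDiff_smul_eq_zero (μ := volume)
    (h.2.1.sub h'.2.1) (fun φ h1 h2 h3 => by
      have e1 := h.2.2 φ h1 h2 h3
      have e2 := h'.2.2 φ h1 h2 h3
      have i1 := integrableOn_mul_of_tsupport h.2.1 h1.continuous (Set.inter_subset_left.trans h3)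
      have i2 := integrableOn_mul_of_tsupport h'.2.1 h1.continuous (Set.inter_subset_left.trans h3)
      rw [← setIntegral_tri_eq (φ := fun x => φ x • (u - u') x)]
      · have : ∀ x, φ x • (u - u') x = u x * φ x - u' x * φ x := by
          intro x; simp only [Pi.sub_apply, smul_eq_mul]; ring
        simp_rw [this]
        rw [integral_sub i1 i2]
        linarith
      · intro p hp
        rw [image_eq_zero_of_notMem_tsupport (fun hh => hp (h3 hh)), zero_smul])
  rw [Filter.EventuallyEq, ae_restrict_iff' measurableSet_tri]
  filter_upwards [h0] with x hx hx'
  exact sub_eq_zero.1 (hx hx')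

lemma congr_fun_left (h : HasWeakDeriv v f u) (hf : f =ᵐ[volume.restrict tri] f') :
    HasWeakDeriv v f' u := by
  refine ⟨h.1.congr hf, h.2.1, fun φ h1 h2 h3 => ?_⟩
  rw [← h.2.2 φ h1 h2 h3]
  exact integral_congr_ae (hf.mono fun x hx => by simp only [hx])

lemma congr_right (h : HasWeakDeriv v f u) (hu : u =ᵐ[volume.restrict tri] u') :
    HasWeakDeriv v f u' := by
  refine ⟨h.1, h.2.1.congr hu, fun φ h1 h2 h3 => ?_⟩
  rw [h.2.2 φ h1 h2 h3, neg_inj]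
  exact integral_congr_ae (hu.mono fun x hx => by simp only [hx])

lemma combo (h : HasWeakDeriv v f u) (h' : HasWeakDeriv v f' u') (a b : ℝ) :
    HasWeakDeriv v (fun p => a * f p + b * f' p) (fun p => a * u p + b * u' p) := by
  refine ⟨(h.1.smul a).add (h'.1.smul b), (h.2.1.smul a).add (h'.2.1.smul b),
    fun φ h1 h2 h3 => ?_⟩
  have s3 := Set.inter_subset_left (t := closedTri) |>.trans h3
  have s4 : tsupport (fun p => fderiv ℝ φ p v) ∩ closedTri ⊆ tri :=
    (Set.inter_subset_inter_left _ (tsupport_fderiv_apply_subset φ v)).trans s3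
  have c := continuous_fderiv_apply h1 v
  have i1 := integrableOn_mul_of_tsupport h.1 c s4
  have i2 := integrableOn_mul_of_tsupport h'.1 c s4
  have i3 := integrableOn_mul_of_tsupport h.2.1 h1.continuous s3
  have i4 := integrableOn_mul_of_tsupport h'.2.1 h1.continuous s3
  simp only [add_mul, mul_assoc]
  rw [integral_add (i1.const_mul a) (i2.const_mul b), integral_add (i3.const_mul a)
    (i4.const_mul b), integral_const_mul, integral_const_mul, integral_const_mul,
    integral_const_mul, h.2.2 φ h1 h2 h3, h'.2.2 φ h1 h2 h3]
  ring

lemma combo_dir (h : HasWeakDeriv v f u) (h' : HasWeakDeriv v' f u') (a b : ℝ) :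
    HasWeakDeriv (a • v + b • v') f (fun p => a * u p + b * u' p) := by
  refine ⟨h.1, (h.2.1.smul a).add (h'.2.1.smul b), fun φ h1 h2 h3 => ?_⟩
  have s3 := Set.inter_subset_left (t := closedTri) |>.trans h3
  have s4 : ∀ w, tsupport (fun p => fderiv ℝ φ p w) ∩ closedTri ⊆ tri := fun w =>
    (Set.inter_subset_inter_left _ (tsupport_fderiv_apply_subset φ w)).trans s3
  have i1 := integrableOn_mul_of_tsupport h.1 (continuous_fderiv_apply h1 v) (s4 v)
  have i2 := integrableOn_mul_of_tsupport h.1 (continuous_fderiv_apply h1 v') (s4 v')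
  have i3 := integrableOn_mul_of_tsupport h.2.1 h1.continuous s3
  have i4 := integrableOn_mul_of_tsupport h'.2.1 h1.continuous s3
  have e : ∀ p, f p * fderiv ℝ φ p (a • v + b • v') =
      a * (f p * fderiv ℝ φ p v) + b * (f p * fderiv ℝ φ p v') := by
    intro p; rw [map_add, map_smul, map_smul, smul_eq_mul, smul_eq_mul]; ring
  simp only [add_mul, mul_assoc, e]
  rw [integral_add (i1.const_mul a) (i2.const_mul b), integral_add (i3.const_mul a)
    (i4.const_mul b), integral_const_mul, integral_const_mul, integral_const_mul,
    integral_const_mul, h.2.2 φ h1 h2 h3, h'.2.2 φ h1 h2 h3]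
  ring

/-- The defining identity of a weak derivative for test functions whose support meets the closed
triangle only in the open triangle. -/
lemma integral_eq (h : HasWeakDeriv v f u) {φ : ℝ × ℝ → ℝ} (hφ : ContDiff ℝ (⊤ : ℕ∞) φ)
    (hs : tsupport φ ∩ closedTri ⊆ tri) :
    ∫ p in tri, f p * fderiv ℝ φ p v = - ∫ p in tri, u p * φ p := by
  classical
  -- Cutting `φ` off outside the triangle keeps it smooth, because by `hs` its support avoids the
  -- boundary of the triangle. The result is an admissible test function.
  set ψ := tri.indicator φ with hψ
  have hsup : tsupport ψ ⊆ tsupport φ ∩ closedTri := by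
    refine closure_minimal (fun p hp => ?_) ((isClosed_tsupport φ).inter isClosed_closedTri)
    rw [hψ, Set.support_indicator] at hp
    exact ⟨subset_tsupport φ hp.2, tri_subset_closedTri hp.1⟩
  have hin : ∀ p ∈ tri, ψ =ᶠ[𝓝 p] φ := fun p hp => by
    filter_upwards [isOpen_tri.mem_nhds hp] with q hq
    exact Set.indicator_of_mem hq φ
  have hc : HasCompactSupport ψ :=
    isCompact_closedTri.of_isClosed_subset (isClosed_tsupport ψ)
      (hsup.trans Set.inter_subset_right)
  have hd : ContDiff ℝ (⊤ : ℕ∞) ψ := by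
    refine contDiff_iff_contDiffAt.2 fun p => ?_
    by_cases hp : p ∈ tri
    · exact hφ.contDiffAt.congr_of_eventuallyEq (hin p hp)
    · have : p ∉ tsupport ψ := fun h' => hp (hs (hsup h'))
      exact contDiffAt_const.congr_of_eventuallyEq (notMem_tsupport_iff_eventuallyEq.1 this)
  have key := h.2.2 ψ hd hc (hsup.trans hs)
  have e1 : ∫ p in tri, f p * fderiv ℝ ψ p v = ∫ p in tri, f p * fderiv ℝ φ p v :=
    setIntegral_congr_fun measurableSet_tri fun p hp => by simp only [(hin p hp).fderiv_eq]
  have e2 : ∫ p in tri, u p * ψ p = ∫ p in tri, u p * φ p :=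
    setIntegral_congr_fun measurableSet_tri fun p hp => by simp only [(hin p hp).eq_of_nhds]
  rwa [e1, e2] at key

end HasWeakDeriv

lemma weakDeriv_ae_eq {v : ℝ × ℝ} {f u : ℝ × ℝ → ℝ} (h : HasWeakDeriv v f u) :
    weakDeriv v f =ᵐ[volume.restrict tri] u := by
  have hex : ∃ g, HasWeakDeriv v f g := ⟨u, h⟩
  rw [weakDeriv, dif_pos hex]
  exact hex.choose_spec.ae_eq h

lemma hasWeakDeriv_weakDeriv {v : ℝ × ℝ} {f u : ℝ × ℝ → ℝ} (h : HasWeakDeriv v f u) :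
    HasWeakDeriv v f (weakDeriv v f) := h.congr_right (weakDeriv_ae_eq h).symm

lemma hasWeakDeriv_of_contDiff {f : ℝ × ℝ → ℝ} (hf : ContDiff ℝ (⊤ : ℕ∞) f) (v : ℝ × ℝ) :
    HasWeakDeriv v f (fun p => fderiv ℝ f p v) := by
  have hc := continuous_fderiv_apply hf v
  refine ⟨hf.continuous.locallyIntegrable.locallyIntegrableOn _,
    hc.locallyIntegrable.locallyIntegrableOn _, fun φ h1 h2 h3 => ?_⟩
  have hz : ∀ p ∉ tri, φ p = 0 := fun p hp => image_eq_zero_of_notMem_tsupport (fun h => hp (h3 h))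
  have hz' : ∀ p ∉ tri, fderiv ℝ φ p v = 0 := fun p hp =>
    image_eq_zero_of_notMem_tsupport (f := fun p => fderiv ℝ φ p v)
      (fun h => hp (h3 (tsupport_fderiv_apply_subset φ v h)))
  have hcφ := continuous_fderiv_apply h1 v
  have hs : HasCompactSupport (fun p => fderiv ℝ φ p v) :=
    h2.of_isClosed_subset (isClosed_tsupport _) (tsupport_fderiv_apply_subset φ v)
  rw [setIntegral_tri_eq (fun p hp => by rw [hz' p hp, mul_zero]),
    setIntegral_tri_eq (fun p hp => by rw [hz p hp, mul_zero])]
  exact integral_mul_fderiv_eq_neg_fderiv_mul_of_integrable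
    ((hc.mul h1.continuous).integrable_of_hasCompactSupport h2.mul_left)
    ((hf.continuous.mul hcφ).integrable_of_hasCompactSupport hs.mul_left)
    ((hf.continuous.mul h1.continuous).integrable_of_hasCompactSupport h2.mul_left)
    (fun p _ => hf.differentiable (by simp) p) (fun p _ => h1.differentiable (by simp) p)

end
end Tri

namespace Tri
noncomputable section

open Filter Topology

/-! ### Integrability on the triangle and up to one edge -/

lemma IntegrableOn.mul_continuous_tri {F k : ℝ × ℝ → ℝ} (hF : IntegrableOn F tri)
    (hk : Continuous k) : IntegrableOn (fun p => F p * k p) tri := by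
  obtain ⟨C, hC⟩ := isCompact_closedTri.exists_bound_of_continuousOn hk.continuousOn
  refine Integrable.mul_bdd (c := C) hF hk.aestronglyMeasurable ?_
  rw [ae_restrict_iff' measurableSet_tri]
  exact Eventually.of_forall fun p hp => hC p (tri_subset_closedTri hp)

lemma locallyIntegrableOn_of_mul {X : Type*} [TopologicalSpace X] [LocallyCompactSpace X]
    [T2Space X] [MeasurableSpace X] [OpensMeasurableSpace X] [SecondCountableTopology X]
    {μ : Measure X} {f w : X → ℝ} {S : Set X} (hS : IsLocallyClosed S)
    (h : IntegrableOn (fun p => f p * w p) S μ) (hw : ContinuousOn w S) (h0 : ∀ p ∈ S, w p ≠ 0) :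
    LocallyIntegrableOn f S μ := by
  rw [locallyIntegrableOn_iff hS]
  intro K hK hKc
  have h1 := (h.mono_set hK).mul_continuousOn ((hw.mono hK).inv₀ fun p hp => h0 p (hK hp)) hKc
  refine h1.congr_fun (fun p hp => ?_) hKc.measurableSet
  simp only [Pi.inv_apply, mul_assoc]
  rw [mul_inv_cancel₀ (h0 p (hK hp)), mul_one]

lemma isLocallyClosed_triZ : IsLocallyClosed triZ := by
  have e : triZ = {p : ℝ × ℝ | 0 < p.1} ∩ {p | 0 < p.2} ∩ {p | p.1 + p.2 ≤ 1} := by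
    ext p; rw [mem_triZ]; exact and_assoc.symm
  rw [e]
  exact ((isOpen_lt continuous_const continuous_fst).inter
    (isOpen_lt continuous_const continuous_snd)).isLocallyClosed.inter
      (isClosed_le (continuous_fst.add continuous_snd) continuous_const).isLocallyClosed

lemma integrableOn_triZ_iff {F : ℝ × ℝ → ℝ} : IntegrableOn F triZ ↔ IntegrableOn F tri :=
  integrableOn_congr_set_ae triZ_ae_eq

/-! ### The divergence theorem near the edge `x + y = 1` -/

variable {f u u₁ u₂ : ℝ × ℝ → ℝ} {φ : ℝ × ℝ → ℝ} {v : ℝ × ℝ}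

lemma integrableOn_fderiv (hf : LocallyIntegrableOn f triZ) (hφ : ContDiff ℝ (⊤ : ℕ∞) φ)
    (hs : tsupport φ ∩ closedTri ⊆ triZ) (v : ℝ × ℝ) :
    IntegrableOn (fun p => f p * fderiv ℝ φ p v) tri :=
  integrableOn_mul_of_tsupport hf (continuous_fderiv_apply hφ v)
    ((Set.inter_subset_inter_left _ (tsupport_fderiv_apply_subset φ v)).trans hs)

/-- Testing with `φ * cut N (1 - x - y)`, which vanishes near the edge, the term where the
derivative hits the cutoff is an integral over a thin layer at the edge. Its limit is the defect in
the integration by parts with `φ` itself. -/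
lemma tendsto_layer_integral (h : HasWeakDeriv v f u) (hf : LocallyIntegrableOn f triZ)
    (hu : LocallyIntegrableOn u triZ) (hφ : ContDiff ℝ (⊤ : ℕ∞) φ)
    (hs : tsupport φ ∩ closedTri ⊆ triZ) :
    Tendsto (fun N : ℕ => (v.1 + v.2) * ∫ p in tri, f p * φ p * deriv (cut N) (1 - p.1 - p.2)) atTop
      (𝓝 (∫ p in tri, (f p * fderiv ℝ φ p v + u p * φ p))) := by
  have i1 := integrableOn_fderiv hf hφ hs v
  have i2 := integrableOn_mul_of_tsupport hu hφ.continuous hs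
  have i0 := integrableOn_mul_of_tsupport hf hφ.continuous hs
  have hlin : ContDiff ℝ (⊤ : ℕ∞) (fun p : ℝ × ℝ => 1 - p.1 - p.2) := by fun_prop
  have key : ∀ N : ℕ, (v.1 + v.2) * ∫ p in tri, f p * φ p * deriv (cut N) (1 - p.1 - p.2) =
      ∫ p in tri, (f p * fderiv ℝ φ p v + u p * φ p) * cut N (1 - p.1 - p.2) := by
    intro N
    have hc : ContDiff ℝ (⊤ : ℕ∞) (fun p : ℝ × ℝ => cut N (1 - p.1 - p.2)) :=
      (contDiff_cut N).comp hlin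
    have hcd : Continuous (fun p : ℝ × ℝ => deriv (cut N) (1 - p.1 - p.2)) :=
      ((contDiff_cut N).continuous_deriv (by simp)).comp hlin.continuous
    set ψ : ℝ × ℝ → ℝ := fun p => φ p * cut N (1 - p.1 - p.2) with hψ
    have hψs : tsupport ψ ∩ closedTri ⊆ tri := by
      rintro p ⟨hp, hp'⟩
      have h1 : p ∈ tsupport φ := closure_mono (Function.support_mul_subset_left _ _) hp
      have h2 : p ∈ {p : ℝ × ℝ | 1 ≤ ((N : ℝ) + 1) * (1 - p.1 - p.2)} := by
        refine closure_minimal ?_ (isClosed_le continuous_const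
          (continuous_const.mul hlin.continuous)) hp
        intro q hq
        by_contra hlt
        rw [Set.mem_ofPred_eq, not_le] at hlt
        exact hq (by simp only [hψ, cut_eq_zero hlt.le, mul_zero])
      obtain ⟨h3, h4, h5⟩ := mem_triZ.1 (hs ⟨h1, hp'⟩)
      refine ⟨h3, h4, ?_⟩
      have hN : (0 : ℝ) < N + 1 := by positivity
      have : 0 < 1 - p.1 - p.2 := by
        by_contra hneg
        have := mul_nonpos_of_nonneg_of_nonpos hN.le (not_lt.1 hneg)
        have h2' : 1 ≤ ((N : ℝ) + 1) * (1 - p.1 - p.2) := h2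
        linarith
      linarith
    have e := h.integral_eq (hφ.mul hc) hψs
    have hder : ∀ p, fderiv ℝ ψ p v =
        fderiv ℝ φ p v * cut N (1 - p.1 - p.2) -
          (v.1 + v.2) * (φ p * deriv (cut N) (1 - p.1 - p.2)) := by
      intro p
      have d1 : HasFDerivAt (fun p : ℝ × ℝ => 1 - p.1 - p.2)
          (-ContinuousLinearMap.fst ℝ ℝ ℝ - ContinuousLinearMap.snd ℝ ℝ ℝ) p :=
        (hasFDerivAt_fst.const_sub 1).sub hasFDerivAt_snd
      have d2 := ((differentiable_cut N) (1 - p.1 - p.2)).hasDerivAt.comp_hasFDerivAt p d1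
      have d3 := ((hφ.differentiable (by simp)) p).hasFDerivAt.mul d2
      have d4 : fderiv ℝ ψ p = _ := d3.fderiv
      rw [d4]
      simp only [add_apply, smul_apply, sub_apply, neg_apply, ContinuousLinearMap.coe_fst',
        ContinuousLinearMap.coe_snd', smul_eq_mul, Function.comp]
      ring
    change ∫ p in tri, f p * fderiv ℝ ψ p v = - ∫ p in tri, u p * ψ p at e
    have e1 : ∀ p, f p * fderiv ℝ ψ p v = (f p * fderiv ℝ φ p v) * cut N (1 - p.1 - p.2) -
        (v.1 + v.2) * (f p * φ p * deriv (cut N) (1 - p.1 - p.2)) := by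
      intro p; rw [hder]; ring
    have e2 : ∀ p, u p * ψ p = (u p * φ p) * cut N (1 - p.1 - p.2) := by
      intro p; simp only [hψ]; ring
    simp_rw [e1, e2] at e
    have j1 := IntegrableOn.mul_continuous_tri i1 hc.continuous
    have j2 := IntegrableOn.mul_continuous_tri i2 hc.continuous
    have j0 := IntegrableOn.mul_continuous_tri i0 hcd
    rw [integral_sub j1 (j0.const_mul _), integral_const_mul] at e
    simp_rw [add_mul]
    rw [integral_add j1 j2]
    linarith
  simp_rw [key]
  refine tendsto_integral_of_dominated_convergence
    (fun p => ‖f p * fderiv ℝ φ p v + u p * φ p‖) (fun N => ?_) (i1.add i2).norm (fun N => ?_) ?_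
  · exact (IntegrableOn.mul_continuous_tri (i1.add i2)
      ((contDiff_cut N).continuous.comp hlin.continuous)).aestronglyMeasurable
  · refine Eventually.of_forall fun p => ?_
    rw [norm_mul]
    exact mul_le_of_le_one_right (norm_nonneg _) (abs_cut_le_one N _)
  · rw [ae_restrict_iff' measurableSet_tri]
    refine Eventually.of_forall fun p hp => ?_
    have hp0 : 0 < 1 - p.1 - p.2 := by linarith [hp.2.2]
    refine tendsto_const_nhds.congr' ?_
    filter_upwards [eventually_cut_eq hp0] with N hN
    rw [hN.1, mul_one]

/-- The boundary functional of `f` on the edge `x + y = 1`. -/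
def edgeFunctional (f u₁ φ : ℝ × ℝ → ℝ) : ℝ :=
  ∫ p in tri, (f p * fderiv ℝ φ p d1 + u₁ p * φ p)

/-- The layer integrals depend on `v` only through the factor `v.1 + v.2`, so direction `d1`
suffices. -/
lemma integral_eq_edgeFunctional (h₁ : HasWeakDeriv d1 f u₁) (h : HasWeakDeriv v f u)
    (hf : LocallyIntegrableOn f triZ) (hu₁ : LocallyIntegrableOn u₁ triZ)
    (hu : LocallyIntegrableOn u triZ) (hφ : ContDiff ℝ (⊤ : ℕ∞) φ)
    (hs : tsupport φ ∩ closedTri ⊆ triZ) :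
    ∫ p in tri, (f p * fderiv ℝ φ p v + u p * φ p) =
      (v.1 + v.2) * edgeFunctional f u₁ φ := by
  have t1 := tendsto_layer_integral h₁ hf hu₁ hφ hs
  have t2 := tendsto_layer_integral h hf hu hφ hs
  simp only [d1, add_zero, one_mul] at t1
  exact tendsto_nhds_unique t2 (t1.const_mul _)

lemma convex_closedTri : Convex ℝ closedTri := by
  rintro p ⟨h1, h2, h3⟩ q ⟨g1, g2, g3⟩ a b ha hb hab
  refine ⟨?_, ?_, ?_⟩
  · simp only [Prod.fst_add, Prod.smul_fst, smul_eq_mul]; positivity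
  · simp only [Prod.snd_add, Prod.smul_snd, smul_eq_mul]; positivity
  · simp only [Prod.fst_add, Prod.smul_fst, Prod.snd_add, Prod.smul_snd, smul_eq_mul]
    nlinarith

/-- In the layer integrals the cutoff derivative is large, but `φ` is of the order of the distance
to the edge, so the product stays bounded and tends to zero pointwise. Thus the functional sees only
the values of `φ` on the edge. -/
lemma edgeFunctional_eq_zero (h₁ : HasWeakDeriv d1 f u₁)
    (hf : LocallyIntegrableOn f triZ) (hu₁ : LocallyIntegrableOn u₁ triZ)
    (hφ : ContDiff ℝ (⊤ : ℕ∞) φ) (hs : tsupport φ ∩ closedTri ⊆ triZ)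
    (h0 : ∀ t ∈ Set.Ioo (0 : ℝ) 1, φ (t, 1 - t) = 0) : edgeFunctional f u₁ φ = 0 := by
  classical
  have t1 := tendsto_layer_integral h₁ hf hu₁ hφ hs
  simp only [d1, add_zero, one_mul] at t1
  refine tendsto_nhds_unique t1 ?_
  obtain ⟨C, hC⟩ := isCompact_closedTri.exists_bound_of_continuousOn
    (hφ.continuous_fderiv (by simp)).continuousOn
  obtain ⟨D, hD0, -, hD⟩ := exists_deriv_cut_bound
  -- Mean value inequality along the horizontal segment from `p` to the edge.
  have hb : ∀ p ∈ tri, |φ p| ≤ C * (1 - p.1 - p.2) := by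
    intro p hp
    have hq : (1 - p.2, p.2) ∈ closedTri := ⟨by simp only; linarith [hp.1, hp.2.2], hp.2.1.le, by simp⟩
    have := convex_closedTri.norm_image_sub_le_of_norm_fderiv_le
      (fun x _ => hφ.differentiable (by simp) x) hC hq (tri_subset_closedTri hp)
    have hz : φ (1 - p.2, p.2) = 0 := by
      have := h0 (1 - p.2) ⟨by linarith [hp.1, hp.2.2], by linarith [hp.2.1]⟩
      rwa [sub_sub_cancel] at this
    rw [hz, sub_zero] at this
    have hn : ‖p - (1 - p.2, p.2)‖ = 1 - p.1 - p.2 := by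
      rw [Prod.norm_def]
      simp only [Prod.fst_sub, Prod.snd_sub, sub_self, norm_zero]
      rw [max_eq_left (norm_nonneg _), Real.norm_eq_abs, abs_of_nonpos] <;> linarith [hp.2.2]
    rwa [hn] at this
  -- Integrability of `f` is available only on the support of `φ`, so the majorant is built from
  -- this restriction.
  set k : ℝ × ℝ → ℝ := fun p => f p * (if p ∈ tsupport φ then 1 else 0) with hk
  have hfK : IntegrableOn k tri := by
    have hK : IsCompact (tsupport φ ∩ closedTri) :=
      isCompact_closedTri.inter_left (isClosed_tsupport φ)
    have h1 : IntegrableOn k (tsupport φ ∩ closedTri) :=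
      (hf.integrableOn_compact_subset hs hK).congr_fun (fun p hp => by
        simp only [hk, if_pos hp.1, mul_one]) hK.measurableSet
    have h3 : IntegrableOn k closedTri := by
      refine h1.of_forall_sdiff_eq_zero isClosed_closedTri.measurableSet fun p hp => ?_
      have : p ∉ tsupport φ := fun h => hp.2 ⟨h, hp.1⟩
      simp only [hk, if_neg this, mul_zero]
    exact h3.mono_set tri_subset_closedTri
  have hlim : Tendsto (fun N : ℕ => ∫ p in tri, f p * φ p * deriv (cut N) (1 - p.1 - p.2)) atTop
      (𝓝 (∫ p in tri, (0 : ℝ))) := by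
    refine tendsto_integral_of_dominated_convergence (fun p => ‖k p‖ * (C * D)) (fun N => ?_)
      (hfK.norm.mul_const _) (fun N => ?_) ?_
    · have hcd : Continuous (fun p : ℝ × ℝ => deriv (cut N) (1 - p.1 - p.2)) :=
        ((contDiff_cut N).continuous_deriv (by simp)).comp (by fun_prop)
      exact (IntegrableOn.mul_continuous_tri (integrableOn_mul_of_tsupport hf hφ.continuous hs)
        hcd).aestronglyMeasurable
    · rw [ae_restrict_iff' measurableSet_tri]
      refine Eventually.of_forall fun p hp => ?_
      have hp0 : 0 < 1 - p.1 - p.2 := by linarith [hp.2.2]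
      by_cases hpt : p ∈ tsupport φ
      · have hC0 : 0 ≤ C := (norm_nonneg _).trans (hC p (tri_subset_closedTri hp))
        simp only [hk, if_pos hpt, mul_one]
        rw [norm_mul, norm_mul, mul_assoc]
        refine mul_le_mul_of_nonneg_left ?_ (norm_nonneg _)
        calc |φ p| * |deriv (cut N) (1 - p.1 - p.2)|
            ≤ C * (1 - p.1 - p.2) * |deriv (cut N) (1 - p.1 - p.2)| :=
              mul_le_mul_of_nonneg_right (hb p hp) (abs_nonneg _)
          _ = C * ((1 - p.1 - p.2) * |deriv (cut N) (1 - p.1 - p.2)|) := by ring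
          _ ≤ C * D := mul_le_mul_of_nonneg_left (hD N _ hp0.le) hC0
      · rw [image_eq_zero_of_notMem_tsupport hpt]
        simp only [hk, if_neg hpt, mul_zero, zero_mul, norm_zero, le_refl]
    · rw [ae_restrict_iff' measurableSet_tri]
      refine Eventually.of_forall fun p hp => ?_
      have hp0 : 0 < 1 - p.1 - p.2 := by linarith [hp.2.2]
      refine tendsto_const_nhds.congr' ?_
      filter_upwards [eventually_cut_eq hp0] with N hN
      rw [hN.2, mul_zero]
  rwa [integral_zero] at hlim

/-! ### Polar coordinates -/

/-- The point with parameter `t` on the segment `x + y = s`; here `q = (t, s)`. -/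
def polar (q : ℝ × ℝ) : ℝ × ℝ := (q.2 * q.1, q.2 * (1 - q.1))

/-- The derivative of `polar`. -/
def polarDeriv (q : ℝ × ℝ) : ℝ × ℝ →L[ℝ] ℝ × ℝ :=
  (Matrix.toLin (.finTwoProd ℝ) (.finTwoProd ℝ) !![q.2, q.1; -q.2, 1 - q.1]).toContinuousLinearMap

lemma hasFDerivAt_polar (q : ℝ × ℝ) : HasFDerivAt polar (polarDeriv q) q := by
  unfold polarDeriv
  rw [Matrix.toLin_finTwoProd_toContinuousLinearMap]
  have a1 : HasFDerivAt (fun q : ℝ × ℝ => q.1) (ContinuousLinearMap.fst ℝ ℝ ℝ) q := hasFDerivAt_fst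
  have a2 : HasFDerivAt (fun q : ℝ × ℝ => q.2) (ContinuousLinearMap.snd ℝ ℝ ℝ) q := hasFDerivAt_snd
  refine ((a2.mul a1).prodMk (a2.mul (a1.const_sub 1))).congr_fderiv ?_
  ext <;> simp

lemma det_polarDeriv (q : ℝ × ℝ) : (polarDeriv q).det = q.2 := by
  unfold polarDeriv
  simp only [LinearMap.det_toContinuousLinearMap, LinearMap.det_toLin, Matrix.det_fin_two_of]
  ring

/-- The open unit square. -/
def square : Set (ℝ × ℝ) := Set.Ioo 0 1 ×ˢ Set.Ioo 0 1

lemma measurableSet_square : MeasurableSet square := measurableSet_Ioo.prod measurableSet_Ioo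

lemma injOn_polar : Set.InjOn polar square := by
  rintro ⟨t, s⟩ ⟨-, hs, -⟩ ⟨t', s'⟩ - h
  simp only [polar, Prod.mk.injEq] at h hs ⊢
  obtain ⟨h1, h2⟩ := h
  have h3 : s = s' := by linarith
  subst h3
  exact ⟨mul_left_cancel₀ hs.ne' h1, rfl⟩

lemma image_polar : polar '' square = tri := by
  ext ⟨x, y⟩
  constructor
  · rintro ⟨⟨t, s⟩, ⟨⟨h1, h2⟩, h3, h4⟩, h⟩
    simp only [polar, Prod.mk.injEq] at h h1 h2 h3 h4
    obtain ⟨rfl, rfl⟩ := h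
    exact ⟨mul_pos h3 h1, mul_pos h3 (by linarith), by simp only; linarith⟩
  · rintro ⟨h1, h2, h3⟩
    simp only at h1 h2 h3
    have hs : 0 < x + y := by linarith
    refine ⟨(x / (x + y), x + y), ⟨⟨by positivity, ?_⟩, hs, h3⟩, ?_⟩
    · simp only; rw [div_lt_one hs]; linarith
    · simp only [polar, Prod.mk.injEq]
      constructor <;> field_simp
      ring

lemma integral_polar (G : ℝ × ℝ → ℝ) : ∫ p in tri, G p = ∫ q in square, q.2 * G (polar q) := by
  rw [← image_polar, integral_image_eq_integral_abs_det_fderiv_smul volume measurableSet_square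
    (fun q _ => (hasFDerivAt_polar q).hasFDerivWithinAt) injOn_polar]
  refine setIntegral_congr_fun measurableSet_square fun q hq => ?_
  simp only [det_polarDeriv, smul_eq_mul]
  rw [abs_of_pos hq.2.1]

lemma integrableOn_polar (G : ℝ × ℝ → ℝ) :
    IntegrableOn G tri ↔ IntegrableOn (fun q => q.2 * G (polar q)) square := by
  rw [← image_polar, integrableOn_image_iff_integrableOn_abs_det_fderiv_smul volume
    measurableSet_square (fun q _ => (hasFDerivAt_polar q).hasFDerivWithinAt) injOn_polar]
  refine integrableOn_congr_fun (fun q hq => ?_) measurableSet_square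
  simp only [det_polarDeriv, smul_eq_mul]
  rw [abs_of_pos hq.2.1]

/-- The integrand of `traceFun`, as a function of `q = (t, s)`. -/
def traceKernel (f u₁ u₂ : ℝ × ℝ → ℝ) (q : ℝ × ℝ) : ℝ :=
  deriv (cut 2) q.2 * f (polar q) +
    cut 2 q.2 * (q.1 * u₁ (polar q) + (1 - q.1) * u₂ (polar q))

/-- An explicit representative of the trace on the edge `x + y = 1`. -/
def traceFun (f u₁ u₂ : ℝ × ℝ → ℝ) (t : ℝ) : ℝ :=
  ∫ s in Set.Ioo (0 : ℝ) 1, traceKernel f u₁ u₂ (t, s)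

/-- The homogeneous extension of degree `-2` of the restriction of `φ` to the edge, cut off near the
origin. -/
def homExt (φ : ℝ × ℝ → ℝ) (p : ℝ × ℝ) : ℝ :=
  cut 2 (p.1 + p.2) * ((p.1 + p.2) ^ 2)⁻¹ * φ ((p.1 + p.2)⁻¹ • p)

lemma cut_two_eq_zero {s : ℝ} (h : s ≤ 1 / 3) : cut 2 s = 0 := cut_eq_zero (by norm_num; linarith)

lemma contDiff_homExt (hφ : ContDiff ℝ (⊤ : ℕ∞) φ) : ContDiff ℝ (⊤ : ℕ∞) (homExt φ) := by
  refine contDiff_iff_contDiffAt.2 fun p => ?_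
  have hs : ContDiff ℝ (⊤ : ℕ∞) (fun p : ℝ × ℝ => p.1 + p.2) := by fun_prop
  rcases lt_or_ge (p.1 + p.2) (1 / 3) with h | h
  · have : homExt φ =ᶠ[𝓝 p] fun _ => 0 := by
      filter_upwards [(isOpen_Iio.preimage hs.continuous).mem_nhds h] with q hq
      rw [homExt, cut_two_eq_zero (le_of_lt hq), zero_mul, zero_mul]
    exact contDiffAt_const.congr_of_eventuallyEq this
  · have h0 : p.1 + p.2 ≠ 0 := by linarith
    exact (((contDiff_cut 2).contDiffAt.comp p hs.contDiffAt).mul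
      ((hs.contDiffAt.pow 2).inv (pow_ne_zero 2 h0))).mul
        (hφ.contDiffAt.comp p ((hs.contDiffAt.inv h0).smul contDiffAt_id))

lemma tsupport_homExt (hs : tsupport φ ∩ closedTri ⊆ triZ) :
    tsupport (homExt φ) ∩ closedTri ⊆ triZ := by
  rintro p ⟨hp, hp'⟩
  -- The maximum makes the radial projection to the edge continuous everywhere; it changes nothing
  -- on the support, where `x + y ≥ 1 / 3`.
  set m : ℝ × ℝ → ℝ × ℝ := fun p => (max (p.1 + p.2) (1 / 3))⁻¹ • p with hm
  have hmc : Continuous m := by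
    refine Continuous.smul (Continuous.inv₀
      ((continuous_fst.add continuous_snd).max continuous_const) fun p => ?_) continuous_id
    exact (lt_of_lt_of_le (by norm_num) (le_max_right _ (1 / 3 : ℝ))).ne'
  have hZ : IsClosed ({p : ℝ × ℝ | 1 / 3 ≤ p.1 + p.2} ∩ m ⁻¹' tsupport φ) :=
    (isClosed_le continuous_const (continuous_fst.add continuous_snd)).inter
      ((isClosed_tsupport φ).preimage hmc)
  have hsub : Function.support (homExt φ) ⊆
      {p : ℝ × ℝ | 1 / 3 ≤ p.1 + p.2} ∩ m ⁻¹' tsupport φ := by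
    intro q hq
    have h1 : 1 / 3 ≤ q.1 + q.2 := by
      by_contra hlt
      exact hq (by rw [homExt, cut_two_eq_zero (not_le.1 hlt).le, zero_mul, zero_mul])
    refine ⟨h1, ?_⟩
    rw [Set.mem_preimage, hm]
    simp only [max_eq_left h1]
    refine subset_tsupport φ fun h0 => hq ?_
    rw [homExt, h0, mul_zero]
  obtain ⟨h1, h2⟩ := closure_minimal hsub hZ hp
  have h1' : 1 / 3 ≤ p.1 + p.2 := h1
  rw [Set.mem_preimage, hm] at h2
  simp only [max_eq_left h1'] at h2
  have hpos : 0 < p.1 + p.2 := by linarith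
  have hip := inv_pos.2 hpos
  have h3 : (p.1 + p.2)⁻¹ • p ∈ closedTri := by
    refine ⟨mul_nonneg hip.le hp'.1, mul_nonneg hip.le hp'.2.1, ?_⟩
    simp only [Prod.smul_fst, Prod.smul_snd, smul_eq_mul]
    rw [← mul_add, inv_mul_cancel₀ hpos.ne']
  obtain ⟨g1, g2, -⟩ := mem_triZ.1 (hs ⟨h2, h3⟩)
  exact mem_triZ.2 ⟨(mul_pos_iff_of_pos_left hip).1 g1, (mul_pos_iff_of_pos_left hip).1 g2,
    hp'.2.2⟩

lemma homExt_polar {t s : ℝ} (hs : 0 < s) :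
    homExt φ (polar (t, s)) = cut 2 s * (s ^ 2)⁻¹ * φ (t, 1 - t) := by
  have e : s * t + s * (1 - t) = s := by ring
  have e2 : s⁻¹ • ((s * t, s * (1 - t)) : ℝ × ℝ) = (t, 1 - t) := by
    ext <;> simp <;> field_simp
  simp only [homExt, polar, e, e2]

/-- Differentiation along the ray through `(t, 1 - t)`. Homogeneity of degree `-2` yields the term
`-2`, cancelled later by the divergence of the field `(x, y)`. -/
lemma fderiv_homExt_polar (hφ : ContDiff ℝ (⊤ : ℕ∞) φ) {t s : ℝ} (hs : 0 < s) :
    fderiv ℝ (homExt φ) (polar (t, s)) (polar (t, s)) =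
      (deriv (cut 2) s * s⁻¹ - 2 * (cut 2 s * (s ^ 2)⁻¹)) * φ (t, 1 - t) := by
  have h1 : HasDerivAt (fun s : ℝ => polar (t, s)) (t, 1 - t) s := by
    have a1 : HasDerivAt (fun s : ℝ => s * t) (1 * t) s := (hasDerivAt_id s).mul_const t
    have a2 : HasDerivAt (fun s : ℝ => s * (1 - t)) (1 * (1 - t)) s :=
      (hasDerivAt_id s).mul_const _
    have := a1.prodMk a2
    rwa [one_mul, one_mul] at this
  have h2 := ((contDiff_homExt hφ).differentiable (by simp) (polar (t, s))).hasFDerivAt.comp_hasDerivAt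
    s h1
  have h3 : HasDerivAt (fun s : ℝ => cut 2 s * (s ^ 2)⁻¹ * φ (t, 1 - t))
      ((deriv (cut 2) s * (s ^ 2)⁻¹ + cut 2 s * (-(2 * s) / (s ^ 2) ^ 2)) * φ (t, 1 - t)) s := by
    have b1 := (differentiable_cut 2 s).hasDerivAt
    have b2 : HasDerivAt (fun s : ℝ => s ^ 2) (2 * s) s := by
      simpa using hasDerivAt_pow 2 s
    exact (b1.mul (b2.inv (pow_ne_zero 2 hs.ne'))).mul_const _
  have h4 : (homExt φ ∘ fun s : ℝ => polar (t, s)) =ᶠ[𝓝 s]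
      fun s : ℝ => cut 2 s * (s ^ 2)⁻¹ * φ (t, 1 - t) := by
    filter_upwards [lt_mem_nhds hs] with r hr
    exact homExt_polar hr
  have h5 := h2.unique (h3.congr_of_eventuallyEq h4)
  have e : polar (t, s) = s • ((t, 1 - t) : ℝ × ℝ) := rfl
  have h6 : fderiv ℝ (homExt φ) (polar (t, s)) (polar (t, s)) =
      s * fderiv ℝ (homExt φ) (polar (t, s)) (t, 1 - t) := by
    conv_lhs => rw [e, map_smul, smul_eq_mul]
    rw [← e]
  rw [h6, h5]
  field_simp
  ring

/-- Only edge values of `φ` matter, so it may be replaced by `(x + y) E` with `E = homExt φ`. This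
gives the divergence theorem for the radial field `(x, y) E f`. In polar coordinates the degree `-2`
of `E` cancels both the divergence of `(x, y)` and the powers of `s`, and the integral over `s`
splits off as `traceFun`. -/
lemma edgeFunctional_eq (h₁ : HasWeakDeriv d1 f u₁) (h₂ : HasWeakDeriv d2 f u₂)
    (hf : LocallyIntegrableOn f triZ) (hu₁ : LocallyIntegrableOn u₁ triZ)
    (hu₂ : LocallyIntegrableOn u₂ triZ) (hφ : ContDiff ℝ (⊤ : ℕ∞) φ)
    (hs : tsupport φ ∩ closedTri ⊆ triZ) :
    edgeFunctional f u₁ φ = ∫ t in Set.Ioo (0 : ℝ) 1, traceFun f u₁ u₂ t * φ (t, 1 - t) := by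
  have hE := contDiff_homExt hφ
  have hEs := tsupport_homExt hs
  set E := homExt φ
  have cx : ContDiff ℝ (⊤ : ℕ∞) (fun p : ℝ × ℝ => p.1 * E p) := contDiff_fst.mul hE
  have cy : ContDiff ℝ (⊤ : ℕ∞) (fun p : ℝ × ℝ => p.2 * E p) := contDiff_snd.mul hE
  have sx : tsupport (fun p : ℝ × ℝ => p.1 * E p) ∩ closedTri ⊆ triZ :=
    (Set.inter_subset_inter_left _ (closure_mono (Function.support_mul_subset_right _ _))).trans hEs
  have sy : tsupport (fun p : ℝ × ℝ => p.2 * E p) ∩ closedTri ⊆ triZ :=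
    (Set.inter_subset_inter_left _ (closure_mono (Function.support_mul_subset_right _ _))).trans hEs
  have dx : ∀ p, fderiv ℝ (fun p : ℝ × ℝ => p.1 * E p) p d1 = E p + p.1 * fderiv ℝ E p d1 := by
    intro p
    have := (hasFDerivAt_fst (𝕜 := ℝ) (p := p)).mul (hE.differentiable (by simp) p).hasFDerivAt
    have e : fderiv ℝ (fun p : ℝ × ℝ => p.1 * E p) p = _ := this.fderiv
    rw [e]; simp [d1]; ring
  have dxy : ∀ p, fderiv ℝ (fun p : ℝ × ℝ => p.2 * E p) p d1 = p.2 * fderiv ℝ E p d1 := by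
    intro p
    have := (hasFDerivAt_snd (𝕜 := ℝ) (p := p)).mul (hE.differentiable (by simp) p).hasFDerivAt
    have e : fderiv ℝ (fun p : ℝ × ℝ => p.2 * E p) p = _ := this.fderiv
    rw [e]; simp [d1]
  have dy : ∀ p, fderiv ℝ (fun p : ℝ × ℝ => p.2 * E p) p d2 = E p + p.2 * fderiv ℝ E p d2 := by
    intro p
    have := (hasFDerivAt_snd (𝕜 := ℝ) (p := p)).mul (hE.differentiable (by simp) p).hasFDerivAt
    have e : fderiv ℝ (fun p : ℝ × ℝ => p.2 * E p) p = _ := this.fderiv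
    rw [e]; simp [d2]; ring
  have i1 := integrableOn_fderiv hf cx sx d1
  have i1' := integrableOn_mul_of_tsupport hu₁ cx.continuous sx
  have i2 := integrableOn_fderiv hf cy sy d2
  have i2' := integrableOn_mul_of_tsupport hu₂ cy.continuous sy
  have i3 := integrableOn_fderiv hf cy sy d1
  have i3' := integrableOn_mul_of_tsupport hu₁ cy.continuous sy
  have i4 := integrableOn_fderiv hf hφ hs d1
  have i4' := integrableOn_mul_of_tsupport hu₁ hφ.continuous hs
  have j1 : IntegrableOn (fun p => f p * fderiv ℝ (fun p : ℝ × ℝ => p.1 * E p) p d1 +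
      u₁ p * (p.1 * E p)) tri := i1.add i1'
  have j2 : IntegrableOn (fun p => f p * fderiv ℝ (fun p : ℝ × ℝ => p.2 * E p) p d2 +
      u₂ p * (p.2 * E p)) tri := i2.add i2'
  have j3 : IntegrableOn (fun p => f p * fderiv ℝ (fun p : ℝ × ℝ => p.2 * E p) p d1 +
      u₁ p * (p.2 * E p)) tri := i3.add i3'
  have j4 : IntegrableOn (fun p => f p * fderiv ℝ φ p d1 + u₁ p * φ p) tri := i4.add i4'
  -- The difference of the two test functions vanishes on the edge, where `x + y = 1` and `E = φ`.
  set θ : ℝ × ℝ → ℝ := fun p => (p.1 * E p + p.2 * E p) - φ p with hθ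
  have cθ : ContDiff ℝ (⊤ : ℕ∞) θ := (cx.add cy).sub hφ
  have sθ : tsupport θ ∩ closedTri ⊆ triZ := by
    have : tsupport θ ⊆ tsupport E ∪ tsupport φ := by
      refine closure_minimal (fun p hp => ?_) ((isClosed_tsupport E).union (isClosed_tsupport φ))
      by_contra hc
      rw [Set.mem_union, not_or] at hc
      refine hp ?_
      simp only [hθ, image_eq_zero_of_notMem_tsupport hc.1, image_eq_zero_of_notMem_tsupport hc.2,
        mul_zero, add_zero, sub_zero]
    rintro p ⟨hp, hp'⟩
    rcases this hp with h | h
    · exact hEs ⟨h, hp'⟩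
    · exact hs ⟨h, hp'⟩
  have hθ0 : edgeFunctional f u₁ θ = 0 := by
    refine edgeFunctional_eq_zero h₁ hf hu₁ cθ sθ fun t _ => ?_
    have : E (t, 1 - t) = φ (t, 1 - t) := by
      have := homExt_polar (φ := φ) (t := t) one_pos
      have c1 : cut 2 1 = 1 := cut_eq_one (by norm_num)
      simpa [polar, c1] using this
    simp only [hθ, this]
    ring
  have e1 : edgeFunctional f u₁ φ =
      edgeFunctional f u₁ (fun p => p.1 * E p) + edgeFunctional f u₁ (fun p => p.2 * E p) := by
    have : edgeFunctional f u₁ θ = edgeFunctional f u₁ (fun p => p.1 * E p) +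
        edgeFunctional f u₁ (fun p => p.2 * E p) - edgeFunctional f u₁ φ := by
      rw [edgeFunctional, edgeFunctional, edgeFunctional, edgeFunctional,
        ← integral_add j1 j3]
      have j13 := (integral_sub (j1.add j3) j4).symm
      simp only [Pi.add_apply] at j13
      rw [j13]
      refine integral_congr_ae (Eventually.of_forall fun p => ?_)
      have dθ : fderiv ℝ θ p d1 = fderiv ℝ (fun p : ℝ × ℝ => p.1 * E p) p d1 +
          fderiv ℝ (fun p : ℝ × ℝ => p.2 * E p) p d1 - fderiv ℝ φ p d1 := by
        have := ((cx.differentiable (by simp) p).hasFDerivAt.add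
          (cy.differentiable (by simp) p).hasFDerivAt).sub
          (hφ.differentiable (by simp) p).hasFDerivAt
        have e : fderiv ℝ θ p = _ := this.fderiv
        rw [e]; simp
      beta_reduce
      rw [dθ]
      simp only [hθ]
      ring
    linarith
  -- For the second component, direction `d1` is exchanged for `d2`, which has the same factor `v.1
  -- + v.2 = 1`.
  have e2 : edgeFunctional f u₁ (fun p => p.2 * E p) =
      ∫ p in tri, (f p * fderiv ℝ (fun p : ℝ × ℝ => p.2 * E p) p d2 + u₂ p * (p.2 * E p)) := by
    have := integral_eq_edgeFunctional h₁ h₂ hf hu₁ hu₂ cy sy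
    rw [this]
    simp [d2]
  have e3 : edgeFunctional f u₁ φ = ∫ p in tri,
      (f p * (2 * E p + fderiv ℝ E p p) + (p.1 * u₁ p + p.2 * u₂ p) * E p) := by
    rw [e1, e2, edgeFunctional, ← integral_add j1 j2]
    refine integral_congr_ae (Eventually.of_forall fun p => ?_)
    have hpp : fderiv ℝ E p p = p.1 * fderiv ℝ E p d1 + p.2 * fderiv ℝ E p d2 := by
      have : p = p.1 • d1 + p.2 • d2 := by ext <;> simp [d1, d2]
      conv_lhs => rw [this, map_add, map_smul, map_smul, ← this]
      rfl
    simp only [dx, dy, hpp]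
    ring
  have i5 : IntegrableOn (fun p => f p * (2 * E p + fderiv ℝ E p p) +
      (p.1 * u₁ p + p.2 * u₂ p) * E p) tri := by
    refine (j1.add j2).congr (Eventually.of_forall fun p => ?_)
    have hpp : fderiv ℝ E p p = p.1 * fderiv ℝ E p d1 + p.2 * fderiv ℝ E p d2 := by
      have : p = p.1 • d1 + p.2 • d2 := by ext <;> simp [d1, d2]
      conv_lhs => rw [this, map_add, map_smul, map_smul, ← this]
      rfl
    simp only [Pi.add_apply, dx, dy, hpp]
    ring
  have e4 : ∀ q ∈ square, q.2 * (f (polar q) * (2 * E (polar q) + fderiv ℝ E (polar q) (polar q)) +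
      ((polar q).1 * u₁ (polar q) + (polar q).2 * u₂ (polar q)) * E (polar q)) =
      traceKernel f u₁ u₂ q * φ (q.1, 1 - q.1) := by
    rintro ⟨t, s⟩ hq
    have hs0 : 0 < s := hq.2.1
    have g1 : E (polar (t, s)) = cut 2 s * (s ^ 2)⁻¹ * φ (t, 1 - t) := homExt_polar hs0
    have g2 : fderiv ℝ E (polar (t, s)) (polar (t, s)) =
      (deriv (cut 2) s * s⁻¹ - 2 * (cut 2 s * (s ^ 2)⁻¹)) * φ (t, 1 - t) :=
      fderiv_homExt_polar hφ hs0
    rw [g1, g2, traceKernel]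
    simp only [polar]
    field_simp
    ring
  rw [e3, integral_polar, setIntegral_congr_fun measurableSet_square e4]
  have i6 : IntegrableOn (fun q => traceKernel f u₁ u₂ q * φ (q.1, 1 - q.1)) square :=
    ((integrableOn_polar _).1 i5).congr_fun e4 measurableSet_square
  rw [square, Measure.volume_eq_prod, setIntegral_prod _ i6]
  refine setIntegral_congr_fun measurableSet_Ioo fun t _ => ?_
  simp only [traceFun]
  rw [integral_mul_const]

end
end Tri

namespace Tri
noncomputable section

open Filter Topology

/-! ### Functions integrable with respect to the weight -/

/-- The weight `x ^ α * y ^ β`. -/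
def weight₂ (α β : ℝ) (p : ℝ × ℝ) : ℝ := p.1 ^ α * p.2 ^ β

/-- The weight `t ^ α * (1 - t) ^ β` on the edge. -/
def edgeWeight (α β : ℝ) (t : ℝ) : ℝ := t ^ α * (1 - t) ^ β

variable {α β : ℝ} {f f' u u₁ u₂ u₁' u₂' : ℝ × ℝ → ℝ} {g g' : ℝ → ℝ} {φ : ℝ × ℝ → ℝ} {v : ℝ × ℝ}

lemma weight₂_pos {p : ℝ × ℝ} (h1 : 0 < p.1) (h2 : 0 < p.2) : 0 < weight₂ α β p :=
  mul_pos (Real.rpow_pos_of_pos h1 _) (Real.rpow_pos_of_pos h2 _)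

lemma edgeWeight_pos {t : ℝ} (ht : t ∈ Set.Ioo (0 : ℝ) 1) : 0 < edgeWeight α β t :=
  mul_pos (Real.rpow_pos_of_pos ht.1 _) (Real.rpow_pos_of_pos (by linarith [ht.2]) _)

lemma continuousOn_weight₂ : ContinuousOn (weight₂ α β) {p | 0 < p.1 ∧ 0 < p.2} :=
  (continuous_fst.continuousOn.rpow_const fun _ h => Or.inl h.1.ne').mul
    (continuous_snd.continuousOn.rpow_const fun _ h => Or.inl h.2.ne')

lemma continuousOn_edgeWeight : ContinuousOn (edgeWeight α β) (Set.Ioo 0 1) :=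
  (continuousOn_id.rpow_const fun _ h => Or.inl h.1.ne').mul
    ((continuousOn_const.sub continuousOn_id).rpow_const fun _ h =>
      Or.inl (sub_ne_zero.2 (ne_of_gt h.2)))

lemma triZ_subset : triZ ⊆ {p | 0 < p.1 ∧ 0 < p.2} := fun _ h =>
  ⟨(mem_triZ.1 h).1, (mem_triZ.1 h).2.1⟩

lemma tri_subset_quadrant : tri ⊆ {p | 0 < p.1 ∧ 0 < p.2} := fun _ h => ⟨h.1, h.2.1⟩

lemma integrableOn_weight₂ (hα : -1 < α) (hβ : -1 < β) : IntegrableOn (weight₂ α β) tri := by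
  have h : ∀ r : ℝ, -1 < r → IntegrableOn (fun x : ℝ => x ^ r) (Set.Ioo 0 1) := fun r hr => by
    have := intervalIntegral.intervalIntegrable_rpow' (a := 0) (b := 1) hr
    rw [intervalIntegrable_iff_integrableOn_Ioo_of_le zero_le_one] at this
    exact this
  have := (h α hα).mul_prod (h β hβ)
  rw [Measure.prod_restrict, ← Measure.volume_eq_prod] at this
  exact IntegrableOn.mono_set this tri_subset_Ioo

/-- `f` is integrable with respect to the weight, and so are its first order weak derivatives
`u₁`, `u₂` with respect to the weights multiplied by `x` and `y`. -/
structure WeightedSobolev (α β : ℝ) (f u₁ u₂ : ℝ × ℝ → ℝ) : Prop where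
  h₁ : HasWeakDeriv d1 f u₁
  h₂ : HasWeakDeriv d2 f u₂
  i₀ : IntegrableOn (fun p => f p * weight₂ α β p) tri
  i₁ : IntegrableOn (fun p => u₁ p * (p.1 * weight₂ α β p)) tri
  i₂ : IntegrableOn (fun p => u₂ p * (p.2 * weight₂ α β p)) tri

namespace WeightedSobolev

lemma loc₀ (h : WeightedSobolev α β f u₁ u₂) : LocallyIntegrableOn f triZ :=
  locallyIntegrableOn_of_mul isLocallyClosed_triZ (integrableOn_triZ_iff.2 h.i₀)
    (continuousOn_weight₂.mono triZ_subset) fun _ hp =>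
      (weight₂_pos (triZ_subset hp).1 (triZ_subset hp).2).ne'

lemma loc₁ (h : WeightedSobolev α β f u₁ u₂) : LocallyIntegrableOn u₁ triZ :=
  locallyIntegrableOn_of_mul isLocallyClosed_triZ (integrableOn_triZ_iff.2 h.i₁)
    (continuous_fst.continuousOn.mul (continuousOn_weight₂.mono triZ_subset)) fun _ hp =>
      mul_ne_zero (triZ_subset hp).1.ne' (weight₂_pos (triZ_subset hp).1 (triZ_subset hp).2).ne'

lemma loc₂ (h : WeightedSobolev α β f u₁ u₂) : LocallyIntegrableOn u₂ triZ :=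
  locallyIntegrableOn_of_mul isLocallyClosed_triZ (integrableOn_triZ_iff.2 h.i₂)
    (continuous_snd.continuousOn.mul (continuousOn_weight₂.mono triZ_subset)) fun _ hp =>
      mul_ne_zero (triZ_subset hp).2.ne' (weight₂_pos (triZ_subset hp).1 (triZ_subset hp).2).ne'

/-- In polar coordinates the weight is `s ^ (α + β)` times the edge weight. As the kernel vanishes
for `s ≤ 1 / 3`, the surplus powers of `s` are compensated by bounded continuous factors. -/
lemma integrableOn_traceKernel (h : WeightedSobolev α β f u₁ u₂) :
    IntegrableOn (fun q => traceKernel f u₁ u₂ q * edgeWeight α β q.1) square := by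
  -- The exponents cancel `s ^ (α + β)` and the Jacobian `s`; in `k₂` there is one further `s` from
  -- the factors `x`, `y` at the derivatives.
  set k₁ : ℝ × ℝ → ℝ := fun p => deriv (cut 2) (p.1 + p.2) *
    (max (p.1 + p.2) (1 / 3)) ^ (-1 - α - β) with hk₁
  set k₂ : ℝ × ℝ → ℝ := fun p => cut 2 (p.1 + p.2) *
    (max (p.1 + p.2) (1 / 3)) ^ (-2 - α - β) with hk₂
  have cs : Continuous fun p : ℝ × ℝ => p.1 + p.2 := continuous_fst.add continuous_snd
  have cm : ∀ r : ℝ, Continuous fun p : ℝ × ℝ => (max (p.1 + p.2) (1 / 3)) ^ r := fun r =>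
    (cs.max continuous_const).rpow_const fun p =>
      Or.inl (lt_of_lt_of_le (by norm_num) (le_max_right _ (1 / 3 : ℝ))).ne'
  have c₁ : Continuous k₁ :=
    (((contDiff_cut 2).continuous_deriv (by simp)).comp cs).mul (cm _)
  have c₂ : Continuous k₂ := ((contDiff_cut 2).continuous.comp cs).mul (cm _)
  have := (IntegrableOn.mul_continuous_tri h.i₀ c₁).add
    (IntegrableOn.mul_continuous_tri (h.i₁.add h.i₂) c₂)
  refine ((integrableOn_polar _).1 this).congr_fun ?_ measurableSet_square
  rintro ⟨t, s⟩ ⟨⟨ht0, ht1⟩, hs0, hs1⟩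
  simp only at ht0 ht1 hs0 hs1
  have ht1' : 0 < 1 - t := by linarith
  have e : s * t + s * (1 - t) = s := by ring
  simp only [Pi.add_apply, polar, hk₁, hk₂, e, weight₂, edgeWeight, traceKernel]
  rcases lt_or_ge s (1 / 3) with hs | hs
  · have z1 : cut 2 s = 0 := cut_two_eq_zero hs.le
    have z2 : deriv (cut 2) s = 0 := deriv_cut_eq_zero (Or.inl (by norm_num; linarith))
    rw [z1, z2]; ring
  · rw [max_eq_left hs, Real.mul_rpow hs0.le ht0.le, Real.mul_rpow hs0.le ht1'.le]
    have p1 : s * (s ^ α * s ^ β * s ^ (-1 - α - β)) = 1 := by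
      rw [← Real.rpow_add hs0, ← Real.rpow_add hs0, show α + β + (-1 - α - β) = -1 by ring,
        Real.rpow_neg_one, mul_inv_cancel₀ hs0.ne']
    have p2 : s * s * (s ^ α * s ^ β * s ^ (-2 - α - β)) = 1 := by
      rw [← Real.rpow_add hs0, ← Real.rpow_add hs0, show α + β + (-2 - α - β) = -2 by ring,
        Real.rpow_neg hs0.le, Real.rpow_two, ← sq, mul_inv_cancel₀ (pow_ne_zero 2 hs0.ne')]
    linear_combination (deriv (cut 2) s * f (s * t, s * (1 - t)) * (t ^ α * (1 - t) ^ β)) * p1 +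
      (cut 2 s * (t * u₁ (s * t, s * (1 - t)) + (1 - t) * u₂ (s * t, s * (1 - t))) *
        (t ^ α * (1 - t) ^ β)) * p2

lemma integrableOn_traceFun (h : WeightedSobolev α β f u₁ u₂) :
    IntegrableOn (fun t => traceFun f u₁ u₂ t * edgeWeight α β t) (Set.Ioo 0 1) := by
  have h1 := h.integrableOn_traceKernel
  rw [square, IntegrableOn, Measure.volume_eq_prod, ← Measure.prod_restrict] at h1
  refine h1.integral_prod_left.congr (Eventually.of_forall fun t => ?_)
  simp only [traceFun, integral_mul_const]

lemma isTrace_traceFun (h : WeightedSobolev α β f u₁ u₂) :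
    IsTrace (fun t => (t, 1 - t)) (1, 1) f (traceFun f u₁ u₂) := by
  refine ⟨locallyIntegrableOn_of_mul isOpen_Ioo.isLocallyClosed h.integrableOn_traceFun
    continuousOn_edgeWeight fun t ht => (edgeWeight_pos ht).ne', h.loc₀, fun v => ?_⟩
  have hv := h.h₁.combo_dir h.h₂ v.1 v.2
  have e : v.1 • d1 + v.2 • d2 = v := by ext <;> simp [d1, d2]
  rw [e] at hv
  have hl : LocallyIntegrableOn (fun p => v.1 * u₁ p + v.2 * u₂ p) triZ :=
    (h.loc₁.smul v.1).add (h.loc₂.smul v.2)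
  refine ⟨_, hv, hl, fun φ hφ _ hs => ?_⟩
  rw [integral_eq_edgeFunctional h.h₁ hv h.loc₀ h.loc₁ hl hφ hs,
    edgeFunctional_eq h.h₁ h.h₂ h.loc₀ h.loc₁ h.loc₂ hφ hs]
  simp only [mul_one]

end WeightedSobolev

/-- Every test function on `(0, 1)` is the restriction to the edge of a test function admissible in
`IsTrace`, so two traces have the same moments. The weak derivatives appearing in the two
definitions agree almost everywhere. -/
lemma IsTrace.ae_eq (h : IsTrace (fun t => (t, 1 - t)) (1, 1) f g)
    (h' : IsTrace (fun t => (t, 1 - t)) (1, 1) f g') :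
    g =ᵐ[volume.restrict (Set.Ioo 0 1)] g' := by
  have key : ∀ ψ : ℝ → ℝ, ContDiff ℝ (⊤ : ℕ∞) ψ → HasCompactSupport ψ →
      tsupport ψ ⊆ Set.Ioo 0 1 → ∫ t, ψ t • (g t - g' t) = 0 := by
    intro ψ h1 h2 h3
    -- On the edge `y = 1 - t` is bounded below over the support of `ψ`, so a cutoff in `y` can
    -- avoid the edge `y = 0` without changing the values there.
    obtain ⟨N, hN⟩ : ∃ N : ℕ, ∀ t ∈ tsupport ψ, 2 ≤ ((N : ℝ) + 1) * (1 - t) := by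
      rcases (tsupport ψ).eq_empty_or_nonempty with he | hne
      · exact ⟨0, by simp [he]⟩
      · obtain ⟨t₀, ht₀, hmax⟩ := h2.isCompact.exists_isMaxOn hne continuousOn_id
        have hlt : 0 < 1 - t₀ := by linarith [(h3 ht₀).2]
        obtain ⟨N, hN⟩ := exists_nat_gt (2 / (1 - t₀))
        refine ⟨N, fun t ht => ?_⟩
        have h5 : t ≤ t₀ := hmax ht
        rw [div_lt_iff₀ hlt] at hN
        nlinarith
    set φ : ℝ × ℝ → ℝ := fun p => ψ p.1 * cut N p.2 * bump p with hφ
    have c1 : ContDiff ℝ (⊤ : ℕ∞) φ :=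
      ((h1.comp contDiff_fst).mul ((contDiff_cut N).comp contDiff_snd)).mul bump.contDiff
    have c2 : HasCompactSupport φ := bump.hasCompactSupport.mul_left
    have c3 : tsupport φ ∩ closedTri ⊆ triZ := by
      rintro p ⟨hp, hp'⟩
      have hsub : tsupport φ ⊆ Prod.fst ⁻¹' tsupport ψ ∩ {p | 1 ≤ ((N : ℝ) + 1) * p.2} := by
        refine closure_minimal (fun q hq => ⟨subset_tsupport ψ fun h0 => hq ?_, ?_⟩)
          (((isClosed_tsupport ψ).preimage continuous_fst).inter
            (isClosed_le continuous_const (continuous_const.mul continuous_snd)))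
        · simp only [hφ, h0, zero_mul]
        · by_contra hlt
          rw [Set.mem_ofPred_eq, not_le] at hlt
          exact hq (by simp only [hφ, cut_eq_zero hlt.le, mul_zero, zero_mul])
      obtain ⟨a1, a2⟩ := hsub hp
      refine mem_triZ.2 ⟨(h3 a1).1, ?_, hp'.2.2⟩
      by_contra hneg
      have := mul_nonpos_of_nonneg_of_nonpos (by positivity : (0 : ℝ) ≤ (N : ℝ) + 1) (not_lt.1 hneg)
      have a2' : 1 ≤ ((N : ℝ) + 1) * p.2 := a2
      linarith
    have ev : ∀ t ∈ Set.Ioo (0 : ℝ) 1, φ (t, 1 - t) = ψ t := by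
      intro t ht
      have hb : bump (t, 1 - t) = 1 := (bump_eventuallyEq (edge_subset ⟨t, ht, rfl⟩)).eq_of_nhds
      simp only [hφ, hb, mul_one]
      by_cases hts : t ∈ tsupport ψ
      · rw [cut_eq_one (hN t hts), mul_one]
      · rw [image_eq_zero_of_notMem_tsupport hts, zero_mul]
    obtain ⟨u, hu, -, e⟩ := h.2.2 d1
    obtain ⟨u', hu', -, e'⟩ := h'.2.2 d1
    have E := e φ c1 c2 c3
    have E' := e' φ c1 c2 c3
    have hE : ∫ p in tri, (f p * fderiv ℝ φ p d1 + u p * φ p) =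
        ∫ p in tri, (f p * fderiv ℝ φ p d1 + u' p * φ p) :=
      integral_congr_ae ((hu.ae_eq hu').mono fun p hp => by simp only [hp])
    rw [E, E'] at hE
    simp only [d1, one_mul, add_zero, mul_one] at hE
    have I : ∀ {k : ℝ → ℝ}, LocallyIntegrableOn k (Set.Ioo 0 1) →
        IntegrableOn (fun t => ψ t * k t) (Set.Ioo 0 1) := fun {k} hk => by
      have := (hk.integrableOn_compact_subset h3 h2.isCompact).continuousOn_mul
        h1.continuous.continuousOn h2.isCompact
      refine (this.of_forall_sdiff_eq_zero measurableSet_Ioo fun t ht => ?_)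
      rw [image_eq_zero_of_notMem_tsupport ht.2, zero_mul]
    have hz : ∀ t ∉ Set.Ioo (0 : ℝ) 1, ψ t • (g t - g' t) = 0 := fun t ht => by
      rw [image_eq_zero_of_notMem_tsupport fun hh => ht (h3 hh), zero_smul]
    rw [← setIntegral_eq_integral_of_forall_compl_eq_zero hz]
    simp only [smul_eq_mul, mul_sub]
    rw [integral_sub (I h.1) (I h'.1), sub_eq_zero]
    have E1 : ∀ k : ℝ → ℝ, ∫ t in Set.Ioo (0 : ℝ) 1, ψ t * k t =
        ∫ t in Set.Ioo (0 : ℝ) 1, k t * φ (t, 1 - t) := fun k =>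
      setIntegral_congr_fun measurableSet_Ioo fun t ht => by simp only [ev t ht]; ring
    rw [E1, E1, hE]
  have h0 := isOpen_Ioo.ae_eq_zero_of_integral_contDiff_smul_eq_zero (μ := volume)
    (h.1.sub h'.1) key
  rw [Filter.EventuallyEq, ae_restrict_iff' measurableSet_Ioo]
  filter_upwards [h0] with x hx hx'
  exact sub_eq_zero.1 (hx hx')

lemma IsTrace.congr_fun (h : IsTrace (fun t => (t, 1 - t)) (1, 1) f g)
    (hf : f =ᵐ[volume.restrict tri] f') : IsTrace (fun t => (t, 1 - t)) (1, 1) f' g := by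
  have hf' : f =ᵐ[volume.restrict triZ] f' := by
    rwa [Measure.restrict_congr_set triZ_ae_eq]
  refine ⟨h.1, h.2.1.congr hf', fun v => ?_⟩
  obtain ⟨u, h1, h2, h3⟩ := h.2.2 v
  refine ⟨u, h1.congr_fun_left hf, h2, fun φ c1 c2 c3 => ?_⟩
  rw [← h3 φ c1 c2 c3]
  exact integral_congr_ae (hf.mono fun p hp => by simp only [hp])

lemma isTrace_traceZ (h : IsTrace (fun t => (t, 1 - t)) (1, 1) f g) :
    IsTrace (fun t => (t, 1 - t)) (1, 1) f (traceZ f) := by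
  have hex : ∃ g, IsTrace (fun t => (t, 1 - t)) (1, 1) f g := ⟨g, h⟩
  rw [traceZ, trace, dif_pos hex]
  exact hex.choose_spec

lemma traceZ_ae_eq (h : IsTrace (fun t => (t, 1 - t)) (1, 1) f g) :
    traceZ f =ᵐ[volume.restrict (Set.Ioo 0 1)] g := (isTrace_traceZ h).ae_eq h

/-- The kernel is the derivative along the ray of `cut 2 s * f (polar (t, s))`, which is `0` at `s =
0` and `f (t, 1 - t)` at `s = 1`. -/
lemma traceFun_of_contDiff (hf : ContDiff ℝ (⊤ : ℕ∞) f) (t : ℝ) :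
    traceFun f (fun p => fderiv ℝ f p d1) (fun p => fderiv ℝ f p d2) t = f (t, 1 - t) := by
  have hd : ∀ s : ℝ, HasDerivAt (fun s => cut 2 s * f (polar (t, s)))
      (traceKernel f (fun p => fderiv ℝ f p d1) (fun p => fderiv ℝ f p d2) (t, s)) s := by
    intro s
    have h1 : HasDerivAt (fun s : ℝ => polar (t, s)) (t, 1 - t) s := by
      have a1 : HasDerivAt (fun s : ℝ => s * t) (1 * t) s := (hasDerivAt_id s).mul_const t
      have a2 : HasDerivAt (fun s : ℝ => s * (1 - t)) (1 * (1 - t)) s :=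
        (hasDerivAt_id s).mul_const _
      have := a1.prodMk a2
      rwa [one_mul, one_mul] at this
    have h2 := (hf.differentiable (by simp) (polar (t, s))).hasFDerivAt.comp_hasDerivAt s h1
    have e : ((t, 1 - t) : ℝ × ℝ) = t • d1 + (1 - t) • d2 := by ext <;> simp [d1, d2]
    rw [e, map_add, map_smul, map_smul] at h2
    exact (differentiable_cut 2 s).hasDerivAt.mul h2
  have hc : Continuous fun s => traceKernel f (fun p => fderiv ℝ f p d1)
      (fun p => fderiv ℝ f p d2) (t, s) := by
    have hp : Continuous fun s : ℝ => polar (t, s) := by unfold polar; fun_prop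
    have e1 := ((contDiff_cut 2).continuous_deriv (by simp)).mul (hf.continuous.comp hp)
    have e2 := ((continuous_fderiv_apply hf d1).comp hp).const_mul t
    have e3 := ((continuous_fderiv_apply hf d2).comp hp).const_mul (1 - t)
    exact e1.add ((contDiff_cut 2).continuous.mul (e2.add e3))
  rw [traceFun, ← integral_Ioc_eq_integral_Ioo, ← intervalIntegral.integral_of_le zero_le_one,
    intervalIntegral.integral_eq_sub_of_hasDerivAt (fun s _ => hd s) (hc.intervalIntegrable _ _),
    cut_eq_one (by norm_num), cut_eq_zero (by norm_num)]
  simp [polar]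

lemma weightedSobolev_of_contDiff (hα : -1 < α) (hβ : -1 < β) (hf : ContDiff ℝ (⊤ : ℕ∞) f) :
    WeightedSobolev α β f (fun p => fderiv ℝ f p d1) (fun p => fderiv ℝ f p d2) := by
  have h0 := integrableOn_weight₂ hα hβ
  refine ⟨hasWeakDeriv_of_contDiff hf _, hasWeakDeriv_of_contDiff hf _, ?_, ?_, ?_⟩
  · exact (IntegrableOn.mul_continuous_tri h0 hf.continuous).congr (Eventually.of_forall fun p => by
      simp only; ring)
  · exact (IntegrableOn.mul_continuous_tri h0 ((continuous_fderiv_apply hf d1).mul continuous_fst)).congr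
      (Eventually.of_forall fun p => by simp only [Pi.mul_apply]; ring)
  · exact (IntegrableOn.mul_continuous_tri h0 ((continuous_fderiv_apply hf d2).mul continuous_snd)).congr
      (Eventually.of_forall fun p => by simp only [Pi.mul_apply]; ring)

/-- `WeightedSobolev` together with a trace on the edge `x + y = 1`. -/
structure TracedSobolev (α β : ℝ) (f u₁ u₂ : ℝ × ℝ → ℝ) (g : ℝ → ℝ) : Prop extends
    WeightedSobolev α β f u₁ u₂ where
  tr : IsTrace (fun t => (t, 1 - t)) (1, 1) f g
  ig : IntegrableOn (fun t => g t * edgeWeight α β t) (Set.Ioo 0 1)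

lemma WeightedSobolev.traced (h : WeightedSobolev α β f u₁ u₂) :
    TracedSobolev α β f u₁ u₂ (traceZ f) := by
  refine ⟨h, isTrace_traceZ h.isTrace_traceFun, h.integrableOn_traceFun.congr ?_⟩
  exact (traceZ_ae_eq h.isTrace_traceFun).symm.mono fun t ht => by simp only [ht]

lemma tracedSobolev_of_contDiff (hα : -1 < α) (hβ : -1 < β) (hf : ContDiff ℝ (⊤ : ℕ∞) f) :
    TracedSobolev α β f (fun p => fderiv ℝ f p d1) (fun p => fderiv ℝ f p d2)
      (fun t => f (t, 1 - t)) := by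
  have h := weightedSobolev_of_contDiff hα hβ hf
  have e := funext (traceFun_of_contDiff hf)
  refine ⟨h, ?_, ?_⟩
  · rw [← e]; exact h.isTrace_traceFun
  · have := h.integrableOn_traceFun
    rwa [e] at this

namespace TracedSobolev

lemma combo (h : TracedSobolev α β f u₁ u₂ g) (h' : TracedSobolev α β f' u₁' u₂' g') (a b : ℝ) :
    TracedSobolev α β (fun p => a * f p + b * f' p) (fun p => a * u₁ p + b * u₁' p)
      (fun p => a * u₂ p + b * u₂' p) (fun t => a * g t + b * g' t) := by
  have hw : WeightedSobolev α β (fun p => a * f p + b * f' p) (fun p => a * u₁ p + b * u₁' p)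
      (fun p => a * u₂ p + b * u₂' p) := by
    refine ⟨h.h₁.combo h'.h₁ a b, h.h₂.combo h'.h₂ a b, ?_, ?_, ?_⟩
    · exact ((h.i₀.const_mul a).add (h'.i₀.const_mul b)).congr
        (Eventually.of_forall fun p => by simp only [Pi.add_apply]; ring)
    · exact ((h.i₁.const_mul a).add (h'.i₁.const_mul b)).congr
        (Eventually.of_forall fun p => by simp only [Pi.add_apply]; ring)
    · exact ((h.i₂.const_mul a).add (h'.i₂.const_mul b)).congr
        (Eventually.of_forall fun p => by simp only [Pi.add_apply]; ring)
  refine ⟨hw, ⟨(h.tr.1.smul a).add (h'.tr.1.smul b), hw.loc₀, fun v => ?_⟩,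
    ((h.ig.const_mul a).add (h'.ig.const_mul b)).congr
        (Eventually.of_forall fun p => by simp only [Pi.add_apply]; ring)⟩
  obtain ⟨u, k1, k2, k3⟩ := h.tr.2.2 v
  obtain ⟨u', k1', k2', k3'⟩ := h'.tr.2.2 v
  refine ⟨_, k1.combo k1' a b, (k2.smul a).add (k2'.smul b), fun φ c1 c2 c3 => ?_⟩
  have j : ∀ {f u : ℝ × ℝ → ℝ}, LocallyIntegrableOn f triZ → LocallyIntegrableOn u triZ →
      IntegrableOn (fun p => f p * fderiv ℝ φ p v + u p * φ p) tri := fun {f u} hf hu =>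
    (integrableOn_fderiv hf c1 c3 v).add (integrableOn_mul_of_tsupport hu c1.continuous c3)
  have J := integral_add ((j h.loc₀ k2).const_mul a) ((j h'.loc₀ k2').const_mul b)
  rw [integral_const_mul, integral_const_mul, k3 φ c1 c2 c3, k3' φ c1 c2 c3] at J
  have jt : ∀ {k : ℝ → ℝ}, LocallyIntegrableOn k (Set.Ioo 0 1) →
      IntegrableOn (fun t => k t * φ (t, 1 - t)) (Set.Ioo 0 1) := fun {k} hk => by
    have ce : Continuous fun t : ℝ => ((t, 1 - t) : ℝ × ℝ) := by fun_prop
    have hK : IsCompact ((fun t : ℝ => ((t, 1 - t) : ℝ × ℝ)) ⁻¹' tsupport φ ∩ Set.Icc 0 1) :=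
      isCompact_Icc.inter_left ((isClosed_tsupport φ).preimage ce)
    have hKs : (fun t : ℝ => ((t, 1 - t) : ℝ × ℝ)) ⁻¹' tsupport φ ∩ Set.Icc 0 1 ⊆ Set.Ioo 0 1 := by
      rintro t ⟨h1, h2, h3⟩
      have := mem_triZ.1 (c3 ⟨h1, ⟨h2, by simp only; linarith, by simp⟩⟩)
      exact ⟨this.1, by linarith [this.2.1]⟩
    refine ((hk.integrableOn_compact_subset hKs hK).mul_continuousOn
      (c1.continuous.comp ce).continuousOn hK).of_forall_sdiff_eq_zero measurableSet_Ioo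
        fun t ht => ?_
    have : (t, 1 - t) ∉ tsupport φ := fun hh => ht.2 ⟨hh, ht.1.1.le, ht.1.2.le⟩
    simp only [Function.comp, image_eq_zero_of_notMem_tsupport this, mul_zero]
  have Jt := integral_add ((jt h.tr.1).const_mul a) ((jt h'.tr.1).const_mul b)
  rw [integral_const_mul, integral_const_mul] at Jt
  have E1 : ∀ p, (a * f p + b * f' p) * fderiv ℝ φ p v + (a * u p + b * u' p) * φ p =
      a * (f p * fderiv ℝ φ p v + u p * φ p) + b * (f' p * fderiv ℝ φ p v + u' p * φ p) := by
    intro p; ring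
  have E2 : ∀ t, (a * g t + b * g' t) * φ (t, 1 - t) =
      a * (g t * φ (t, 1 - t)) + b * (g' t * φ (t, 1 - t)) := by intro t; ring
  simp only [E1, E2]
  rw [J, Jt]
  ring

lemma congr_fun (h : TracedSobolev α β f u₁ u₂ g) (hf : f =ᵐ[volume.restrict tri] f') :
    TracedSobolev α β f' u₁ u₂ g :=
  ⟨⟨h.h₁.congr_fun_left hf, h.h₂.congr_fun_left hf,
    h.i₀.congr (hf.mono fun p hp => by simp only [hp]), h.i₁, h.i₂⟩, h.tr.congr_fun hf, h.ig⟩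

end TracedSobolev

end
end Tri

namespace Tri
noncomputable section

open Filter Topology

/-! ### Polynomials as functions -/

/-- The value of a polynomial at a point of the plane. -/
def ev (p : Poly2) (z : ℝ × ℝ) : ℝ := MvPolynomial.eval ![z.1, z.2] p

lemma ev_add (p q : Poly2) (z : ℝ × ℝ) : ev (p + q) z = ev p z + ev q z := map_add _ _ _
lemma ev_sub (p q : Poly2) (z : ℝ × ℝ) : ev (p - q) z = ev p z - ev q z := map_sub _ _ _
lemma ev_mul (p q : Poly2) (z : ℝ × ℝ) : ev (p * q) z = ev p z * ev q z := map_mul _ _ _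
lemma ev_one (z : ℝ × ℝ) : ev 1 z = 1 := map_one _
lemma ev_smul (c : ℝ) (p : Poly2) (z : ℝ × ℝ) : ev (c • p) z = c * ev p z :=
  MvPolynomial.smul_eval _ _ _
lemma ev_sum {ι : Type*} (s : Finset ι) (p : ι → Poly2) (z : ℝ × ℝ) :
    ev (∑ i ∈ s, p i) z = ∑ i ∈ s, ev (p i) z := map_sum _ _ _
lemma ev_pow (p : Poly2) (n : ℕ) (z : ℝ × ℝ) : ev (p ^ n) z = ev p z ^ n := map_pow _ _ _
lemma ev_C (c : ℝ) (z : ℝ × ℝ) : ev (MvPolynomial.C c) z = c := MvPolynomial.eval_C _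
lemma ev_x (z : ℝ × ℝ) : ev xP z = z.1 := by simp [ev]
lemma ev_y (z : ℝ × ℝ) : ev yP z = z.2 := by simp [ev]
lemma ev_s (z : ℝ × ℝ) : ev sP z = z.1 + z.2 := by rw [sP, ev_add, ev_x, ev_y]

lemma contDiff_ev (p : Poly2) : ContDiff ℝ (⊤ : ℕ∞) (ev p) := by
  induction p using MvPolynomial.induction_on with
  | C c => simp only [funext (ev_C c)]; exact contDiff_const
  | add p q hp hq => simp only [funext (ev_add p q)]; exact hp.add hq
  | mul_X p i hp =>
    simp only [funext (ev_mul p _)]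
    refine hp.mul ?_
    fin_cases i
    · exact (funext ev_x : ev xP = Prod.fst) ▸ contDiff_fst
    · exact (funext ev_y : ev yP = Prod.snd) ▸ contDiff_snd

lemma continuous_ev (p : Poly2) : Continuous (ev p) := (contDiff_ev p).continuous

lemma hasFDerivAt_ev (p : Poly2) (z : ℝ × ℝ) : HasFDerivAt (ev p)
    (ev (dX p) z • ContinuousLinearMap.fst ℝ ℝ ℝ + ev (dY p) z • ContinuousLinearMap.snd ℝ ℝ ℝ)
      z := by
  induction p using MvPolynomial.induction_on with
  | C c =>
    refine ((hasFDerivAt_const c z).congr_of_eventuallyEq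
      (Eventually.of_forall (ev_C c))).congr_fderiv ?_
    simp [ev]
  | add p q hp hq =>
    refine ((hp.add hq).congr_of_eventuallyEq (Eventually.of_forall (ev_add p q))).congr_fderiv ?_
    rw [map_add, map_add, ev_add, ev_add, add_smul, add_smul]
    abel
  | mul_X p i hp =>
    have hX : HasFDerivAt (ev (MvPolynomial.X i))
        (ev (dX (MvPolynomial.X i)) z • ContinuousLinearMap.fst ℝ ℝ ℝ +
          ev (dY (MvPolynomial.X i)) z • ContinuousLinearMap.snd ℝ ℝ ℝ) z := by
      fin_cases i
      · refine (hasFDerivAt_fst.congr_of_eventuallyEq (Eventually.of_forall ev_x)).congr_fderiv ?_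
        change _ = ev (dX xP) z • _ + ev (dY xP) z • _
        rw [dX_x, dY_x, ev_one]
        simp [ev]
      · refine (hasFDerivAt_snd.congr_of_eventuallyEq (Eventually.of_forall ev_y)).congr_fderiv ?_
        change _ = ev (dX yP) z • _ + ev (dY yP) z • _
        rw [dX_y, dY_y, ev_one]
        simp [ev]
    refine ((hp.mul hX).congr_of_eventuallyEq (Eventually.of_forall (ev_mul p _))).congr_fderiv ?_
    rw [Derivation.leibniz, Derivation.leibniz]
    simp only [smul_eq_mul, ev_add, ev_mul]
    ext <;> simp

lemma fderiv_ev_d1 (p : Poly2) (z : ℝ × ℝ) : fderiv ℝ (ev p) z d1 = ev (dX p) z := by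
  rw [(hasFDerivAt_ev p z).fderiv]; simp [d1]

lemma fderiv_ev_d2 (p : Poly2) (z : ℝ × ℝ) : fderiv ℝ (ev p) z d2 = ev (dY p) z := by
  rw [(hasFDerivAt_ev p z).fderiv]; simp [d2]

/-- The triangle contains the square `(0, 1/2) × (0, 1/2)`, a product of infinite sets. -/
lemma eq_zero_of_ev_eq_zero {p : Poly2} (h : ∀ z ∈ tri, ev p z = 0) : p = 0 := by
  refine MvPolynomial.funext_set (fun _ : Fin 2 => Set.Ioo (0 : ℝ) (1 / 2))
    (fun _ => Set.Ioo_infinite (by norm_num)) fun x hx => ?_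
  have h0 := hx 0 (Set.mem_univ _)
  have h1 := hx 1 (Set.mem_univ _)
  have := h (x 0, x 1) ⟨h0.1, h1.1, by simp only; linarith [h0.2, h1.2]⟩
  have e : x = ![x 0, x 1] := by ext i; fin_cases i <;> rfl
  rw [map_zero, e]
  exact this

/-! ### Functionals on polynomials given by integrals -/

/-- The functional `p ↦ ∫ h p` on the triangle. -/
def triMap (h : ℝ × ℝ → ℝ) (hi : IntegrableOn h tri) : Poly2 →ₗ[ℝ] ℝ where
  toFun p := ∫ z in tri, h z * ev p z
  map_add' p q := by
    simp only [ev_add, mul_add]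
    exact integral_add (IntegrableOn.mul_continuous_tri hi (continuous_ev p))
      (IntegrableOn.mul_continuous_tri hi (continuous_ev q))
  map_smul' c p := by
    simp only [ev_smul, mul_left_comm _ c, RingHom.id_apply, smul_eq_mul]
    exact integral_const_mul _ _

lemma triMap_apply {h : ℝ × ℝ → ℝ} (hi : IntegrableOn h tri) (p : Poly2) :
    triMap h hi p = ∫ z in tri, h z * ev p z := rfl

lemma IntegrableOn.mul_continuous_edge {h k : ℝ → ℝ} (hh : IntegrableOn h (Set.Ioo 0 1))
    (hk : Continuous k) : IntegrableOn (fun t => h t * k t) (Set.Ioo 0 1) := by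
  obtain ⟨C, hC⟩ := (isCompact_Icc (a := (0 : ℝ)) (b := 1)).exists_bound_of_continuousOn
    hk.continuousOn
  refine Integrable.mul_bdd (c := C) hh hk.aestronglyMeasurable ?_
  rw [ae_restrict_iff' measurableSet_Ioo]
  exact Eventually.of_forall fun t ht => hC t ⟨ht.1.le, ht.2.le⟩

lemma continuous_ev_edge (p : Poly2) : Continuous fun t : ℝ => ev p (t, 1 - t) :=
  (continuous_ev p).comp (by fun_prop)

/-- The functional `p ↦ ∫ h(t) p(t, 1 - t)` on the edge. -/
def edgeMap (h : ℝ → ℝ) (hi : IntegrableOn h (Set.Ioo 0 1)) : Poly2 →ₗ[ℝ] ℝ where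
  toFun p := ∫ t in Set.Ioo (0 : ℝ) 1, h t * ev p (t, 1 - t)
  map_add' p q := by
    simp only [ev_add, mul_add]
    exact integral_add (IntegrableOn.mul_continuous_edge hi (continuous_ev_edge p))
      (IntegrableOn.mul_continuous_edge hi (continuous_ev_edge q))
  map_smul' c p := by
    simp only [ev_smul, mul_left_comm _ c, RingHom.id_apply, smul_eq_mul]
    exact integral_const_mul _ _

lemma edgeMap_apply {h : ℝ → ℝ} (hi : IntegrableOn h (Set.Ioo 0 1)) (p : Poly2) :
    edgeMap h hi p = ∫ t in Set.Ioo (0 : ℝ) 1, h t * ev p (t, 1 - t) := rfl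

/-! ### Green's identities -/

/-- The power `x ^ a`, smoothly cut off near `0`. -/
def cutPow (N : ℕ) (a x : ℝ) : ℝ := cut N x * x ^ a

lemma hasDerivAt_cutPow (N : ℕ) (a : ℝ) {x : ℝ} (hx : 0 < x) :
    HasDerivAt (cutPow N (a + 1)) ((x * deriv (cut N) x + (a + 1) * cut N x) * x ^ a) x := by
  have h := (differentiable_cut N x).hasDerivAt.mul
    (Real.hasDerivAt_rpow_const (p := a + 1) (Or.inl hx.ne'))
  refine h.congr_deriv ?_
  rw [add_sub_cancel_right, Real.rpow_add_one hx.ne']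
  ring

lemma contDiff_cutPow (N : ℕ) (a : ℝ) : ContDiff ℝ (⊤ : ℕ∞) (cutPow N a) := by
  refine contDiff_iff_contDiffAt.2 fun x => ?_
  rcases lt_or_ge (((N : ℝ) + 1) * x) 1 with h | h
  · have hc : Continuous fun x : ℝ => ((N : ℝ) + 1) * x := by fun_prop
    have : cutPow N a =ᶠ[𝓝 x] fun _ => 0 := by
      filter_upwards [(isOpen_Iio.preimage hc).mem_nhds h] with y hy
      rw [cutPow, cut_eq_zero (le_of_lt hy), zero_mul]
    exact contDiffAt_const.congr_of_eventuallyEq this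
  · have hx : x ≠ 0 := by
      rintro rfl
      rw [mul_zero] at h
      linarith
    exact (contDiff_cut N).contDiffAt.mul (Real.contDiffAt_rpow_const_of_ne hx)

lemma support_cutPow_subset (N : ℕ) (a : ℝ) :
    Function.support (cutPow N a) ⊆ {x | 1 ≤ ((N : ℝ) + 1) * x} := by
  intro x hx
  by_contra hlt
  rw [Set.mem_ofPred_eq, not_le] at hlt
  exact hx (by rw [cutPow, cut_eq_zero hlt.le, zero_mul])

lemma tendsto_integral_mul_of_bounded {X : Type*} [MeasurableSpace X] {μ : Measure X} {h k₀ : X → ℝ}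
    {k : ℕ → X → ℝ} {C : ℝ} (hh : Integrable h μ) (hk : ∀ N, AEStronglyMeasurable (k N) μ)
    (hb : ∀ N, ∀ᵐ x ∂μ, |k N x| ≤ C) (hl : ∀ᵐ x ∂μ, Tendsto (fun N => k N x) atTop (𝓝 (k₀ x))) :
    Tendsto (fun N => ∫ x, h x * k N x ∂μ) atTop (𝓝 (∫ x, h x * k₀ x ∂μ)) := by
  refine tendsto_integral_of_dominated_convergence (fun x => ‖h x‖ * C)
    (fun N => hh.aestronglyMeasurable.mul (hk N)) (hh.norm.mul_const C) (fun N => ?_) ?_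
  · filter_upwards [hb N] with x hx
    rw [norm_mul]
    exact mul_le_mul_of_nonneg_left hx (norm_nonneg _)
  · filter_upwards [hl] with x hx using hx.const_mul _

variable {α β : ℝ} {f u₁ u₂ : ℝ × ℝ → ℝ} {g : ℝ → ℝ}

/-- The test functions for Green's identities. -/
def greenTest (N : ℕ) (a b : ℝ) (p : Poly2) (z : ℝ × ℝ) : ℝ :=
  cutPow N a z.1 * cutPow N b z.2 * (ev p z * bump z)

lemma contDiff_greenTest (N : ℕ) (a b : ℝ) (p : Poly2) :
    ContDiff ℝ (⊤ : ℕ∞) (greenTest N a b p) :=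
  (((contDiff_cutPow N a).comp contDiff_fst).mul ((contDiff_cutPow N b).comp contDiff_snd)).mul
    ((contDiff_ev p).mul bump.contDiff)

lemma hasCompactSupport_greenTest (N : ℕ) (a b : ℝ) (p : Poly2) :
    HasCompactSupport (greenTest N a b p) :=
  bump.hasCompactSupport.mul_left.mul_left

lemma tsupport_greenTest (N : ℕ) (a b : ℝ) (p : Poly2) :
    tsupport (greenTest N a b p) ∩ closedTri ⊆ triZ := by
  rintro z ⟨hz, hz'⟩
  have hsub : tsupport (greenTest N a b p) ⊆
      {z : ℝ × ℝ | 1 ≤ ((N : ℝ) + 1) * z.1} ∩ {z | 1 ≤ ((N : ℝ) + 1) * z.2} := by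
    refine closure_minimal (fun q hq => ?_)
      ((isClosed_le continuous_const (continuous_const.mul continuous_fst)).inter
        (isClosed_le continuous_const (continuous_const.mul continuous_snd)))
    have h1 := left_ne_zero_of_mul (show _ ≠ (0 : ℝ) from hq)
    exact ⟨support_cutPow_subset N a (left_ne_zero_of_mul h1),
      support_cutPow_subset N b (right_ne_zero_of_mul h1)⟩
  have hpos : ∀ x : ℝ, 1 ≤ ((N : ℝ) + 1) * x → 0 < x := fun x hx => by
    by_contra hneg
    have := mul_nonpos_of_nonneg_of_nonpos (by positivity : (0 : ℝ) ≤ (N : ℝ) + 1) (not_lt.1 hneg)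
    linarith
  exact mem_triZ.2 ⟨hpos _ (hsub hz).1, hpos _ (hsub hz).2, hz'.2.2⟩

lemma bump_of_mem {z : ℝ × ℝ} (hz : z ∈ closedTri) : bump z = 1 :=
  (bump_eventuallyEq hz).eq_of_nhds

lemma exists_bound_ev (p : Poly2) : ∃ C : ℝ, 0 ≤ C ∧ ∀ z ∈ closedTri, |ev p z| ≤ C := by
  obtain ⟨C, hC⟩ := isCompact_closedTri.exists_bound_of_continuousOn (continuous_ev p).continuousOn
  exact ⟨C, (norm_nonneg _).trans (hC 0 ⟨le_rfl, le_rfl, by simp⟩), hC⟩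

lemma tendsto_edge (hg : IntegrableOn (fun t => g t * edgeWeight α β t) (Set.Ioo 0 1))
    (p : Poly2) :
    Tendsto (fun N : ℕ => ∫ t in Set.Ioo (0 : ℝ) 1,
      g t * edgeWeight α β t * (cut N t * cut N (1 - t) * ev p (t, 1 - t))) atTop
      (𝓝 (∫ t in Set.Ioo (0 : ℝ) 1, g t * edgeWeight α β t * ev p (t, 1 - t))) := by
  obtain ⟨C, hC0, hC⟩ := exists_bound_ev p
  refine tendsto_integral_mul_of_bounded (C := C) hg (fun N => ?_) (fun N => ?_) ?_
  · exact (((contDiff_cut N).continuous.mul ((contDiff_cut N).continuous.comp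
      (continuous_const.sub continuous_id))).mul (continuous_ev_edge p)).aestronglyMeasurable
  · rw [ae_restrict_iff' measurableSet_Ioo]
    refine Eventually.of_forall fun t ht => ?_
    rw [abs_mul, abs_mul]
    exact (mul_le_of_le_one_left (abs_nonneg _) (mul_le_one₀ (abs_cut_le_one _ _) (abs_nonneg _)
      (abs_cut_le_one _ _))).trans (hC _ (edge_subset ⟨t, ht, rfl⟩))
  · rw [ae_restrict_iff' measurableSet_Ioo]
    refine Eventually.of_forall fun t ht => tendsto_const_nhds.congr' ?_
    filter_upwards [eventually_cut_eq ht.1, eventually_cut_eq (sub_pos.2 ht.2)] with N h1 h2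
    rw [h1.1, h2.1, one_mul, one_mul]

lemma greenTest_edge (N : ℕ) (a b : ℝ) (p : Poly2) {t : ℝ} (ht : t ∈ Set.Ioo (0 : ℝ) 1) :
    greenTest N a b p (t, 1 - t) =
      edgeWeight a b t * (cut N t * cut N (1 - t) * ev p (t, 1 - t)) := by
  rw [greenTest, bump_of_mem (edge_subset ⟨t, ht, rfl⟩), cutPow, cutPow, edgeWeight]
  ring

lemma tendsto_volume {h : ℝ × ℝ → ℝ} (hh : IntegrableOn h tri) (p : Poly2) :
    Tendsto (fun N : ℕ => ∫ z in tri, h z * (cut N z.1 * cut N z.2 * ev p z)) atTop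
      (𝓝 (∫ z in tri, h z * ev p z)) := by
  obtain ⟨C, hC0, hC⟩ := exists_bound_ev p
  refine tendsto_integral_mul_of_bounded (C := C) hh (fun N => ?_) (fun N => ?_) ?_
  · exact ((((contDiff_cut N).continuous.comp continuous_fst).mul
      ((contDiff_cut N).continuous.comp continuous_snd)).mul
        (continuous_ev p)).aestronglyMeasurable
  · rw [ae_restrict_iff' measurableSet_tri]
    refine Eventually.of_forall fun z hz => ?_
    rw [abs_mul, abs_mul]
    exact (mul_le_of_le_one_left (abs_nonneg _) (mul_le_one₀ (abs_cut_le_one _ _) (abs_nonneg _)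
      (abs_cut_le_one _ _))).trans (hC _ (tri_subset_closedTri hz))
  · rw [ae_restrict_iff' measurableSet_tri]
    refine Eventually.of_forall fun z hz => tendsto_const_nhds.congr' ?_
    filter_upwards [eventually_cut_eq hz.1, eventually_cut_eq hz.2.1] with N h1 h2
    rw [h1.1, h2.1, one_mul, one_mul]

lemma fderiv_greenTest_d1 (N : ℕ) (p : Poly2) {z : ℝ × ℝ} (hz : z ∈ tri) :
    fderiv ℝ (greenTest N (α + 1) β p) z d1 = weight₂ α β z *
      (cut N z.2 * ((z.1 * deriv (cut N) z.1 + (α + 1) * cut N z.1) * ev p z +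
        cut N z.1 * (z.1 * ev (dX p) z))) := by
  have hx : HasFDerivAt (fun z : ℝ × ℝ => z.1) (ContinuousLinearMap.fst ℝ ℝ ℝ) z := hasFDerivAt_fst
  have hy : HasFDerivAt (fun z : ℝ × ℝ => z.2) (ContinuousLinearMap.snd ℝ ℝ ℝ) z := hasFDerivAt_snd
  have h1 := (hasDerivAt_cutPow N α hz.1).comp_hasFDerivAt z hx
  have h2 := ((contDiff_cutPow N β).differentiable (by simp) z.2).hasDerivAt.comp_hasFDerivAt z hy
  have h3 := (h1.mul h2).mul (hasFDerivAt_ev p z)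
  have h4 : greenTest N (α + 1) β p =ᶠ[𝓝 z]
      fun z => cutPow N (α + 1) z.1 * cutPow N β z.2 * ev p z := by
    filter_upwards [isOpen_tri.mem_nhds hz] with q hq
    rw [greenTest, bump_of_mem (tri_subset_closedTri hq), mul_one]
  rw [h4.fderiv_eq, (show fderiv ℝ (fun z : ℝ × ℝ => cutPow N (α + 1) z.1 * cutPow N β z.2 * ev p z)
    z = _ from h3.fderiv)]
  simp [d1, cutPow, weight₂, Real.rpow_add_one hz.1.ne']
  ring

/-- The trace identity is tested with `x ^ (α + 1) y ^ β p`, cut off near both axes, and the cutoff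
is removed by dominated convergence. No term from the axis `x = 0` survives because of the extra
power of `x`. -/
lemma TracedSobolev.green_x (h : TracedSobolev α β f u₁ u₂ g) (p : Poly2) :
    (∫ z in tri, u₁ z * (z.1 * weight₂ α β z) * ev p z) +
      (∫ z in tri, f z * weight₂ α β z * ev (xP * dX p + (α + 1) • p) z) =
    ∫ t in Set.Ioo (0 : ℝ) 1, g t * edgeWeight α β t * ev (xP * p) (t, 1 - t) := by
  obtain ⟨u, hu, -, e⟩ := h.tr.2.2 d1
  obtain ⟨D, hD0, -, hD⟩ := exists_deriv_cut_bound
  obtain ⟨C, hC0, hC⟩ := exists_bound_ev p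
  obtain ⟨C', hC0', hC'⟩ := exists_bound_ev (dX p)
  set k : ℕ → ℝ × ℝ → ℝ := fun N z =>
    cut N z.2 * ((z.1 * deriv (cut N) z.1 + (α + 1) * cut N z.1) * ev p z +
        cut N z.1 * (z.1 * ev (dX p) z)) with hk
  have T1 : Tendsto (fun N => ∫ z in tri, f z * weight₂ α β z * k N z) atTop
      (𝓝 (∫ z in tri, f z * weight₂ α β z * ev (xP * dX p + (α + 1) • p) z)) := by
    -- Differentiating the cutoff produces `x * deriv (cut N) x`, bounded by `D` uniformly in `N`.
    refine tendsto_integral_mul_of_bounded (C := (D + |α + 1|) * C + C') h.i₀ (fun N => ?_)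
      (fun N => ?_) ?_
    · have c1 : Continuous fun z : ℝ × ℝ => cut N z.1 :=
        (contDiff_cut N).continuous.comp continuous_fst
      have c2 : Continuous fun z : ℝ × ℝ => cut N z.2 :=
        (contDiff_cut N).continuous.comp continuous_snd
      have c3 : Continuous fun z : ℝ × ℝ => deriv (cut N) z.1 :=
        ((contDiff_cut N).continuous_deriv (by simp)).comp continuous_fst
      exact (c2.mul ((((continuous_fst.mul c3).add (c1.const_mul _)).mul (continuous_ev p)).add
        (c1.mul (continuous_fst.mul (continuous_ev _))))).aestronglyMeasurable
    · rw [ae_restrict_iff' measurableSet_tri]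
      refine Eventually.of_forall fun z hz => ?_
      have b1 : |z.1 * deriv (cut N) z.1| ≤ D := by
        rw [abs_mul, abs_of_pos hz.1]; exact hD N _ hz.1.le
      have b2 : |(α + 1) * cut N z.1| ≤ |α + 1| := by
        rw [abs_mul]; exact mul_le_of_le_one_right (abs_nonneg _) (abs_cut_le_one _ _)
      have b3 : |z.1 * ev (dX p) z| ≤ C' := by
        rw [abs_mul]
        refine (mul_le_of_le_one_left (abs_nonneg _) ?_).trans (hC' z (tri_subset_closedTri hz))
        rw [abs_of_pos hz.1]
        linarith [hz.1, hz.2.1, hz.2.2]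
      simp only [hk]
      rw [abs_mul]
      refine (mul_le_of_le_one_left (abs_nonneg _) (abs_cut_le_one _ _)).trans
        ((abs_add_le _ _).trans (add_le_add ?_ ?_))
      · rw [abs_mul]
        exact mul_le_mul ((abs_add_le _ _).trans (add_le_add b1 b2))
          (hC z (tri_subset_closedTri hz)) (abs_nonneg _) (by positivity)
      · rw [abs_mul]
        exact (mul_le_of_le_one_left (abs_nonneg _) (abs_cut_le_one _ _)).trans b3
    · rw [ae_restrict_iff' measurableSet_tri]
      refine Eventually.of_forall fun z hz => tendsto_const_nhds.congr' ?_
      filter_upwards [eventually_cut_eq hz.1, eventually_cut_eq hz.2.1] with N h1 h2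
      simp only [hk, h1.1, h1.2, h2.1, ev_add, ev_mul, ev_smul, ev_x]
      ring
  have T2 := tendsto_volume h.i₁ p
  have T3 := tendsto_edge h.ig (xP * p)
  have key : ∀ N, (∫ z in tri, u₁ z * (z.1 * weight₂ α β z) * (cut N z.1 * cut N z.2 * ev p z)) +
      (∫ z in tri, f z * weight₂ α β z * k N z) = ∫ t in Set.Ioo (0 : ℝ) 1,
        g t * edgeWeight α β t * (cut N t * cut N (1 - t) * ev (xP * p) (t, 1 - t)) := by
    intro N
    have c1 := contDiff_greenTest N (α + 1) β p
    have c3 := tsupport_greenTest N (α + 1) β p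
    have E := e _ c1 (hasCompactSupport_greenTest N (α + 1) β p) c3
    have E1 : ∫ z in tri, (f z * fderiv ℝ (greenTest N (α + 1) β p) z d1 +
        u z * greenTest N (α + 1) β p z) =
        ∫ z in tri, (f z * fderiv ℝ (greenTest N (α + 1) β p) z d1 +
          u₁ z * greenTest N (α + 1) β p z) :=
      integral_congr_ae ((hu.ae_eq h.h₁).mono fun z hz => by simp only [hz])
    rw [E1, integral_add (integrableOn_fderiv h.loc₀ c1 c3 d1)
      (integrableOn_mul_of_tsupport h.loc₁ c1.continuous c3)] at E
    have E2 : ∫ z in tri, f z * fderiv ℝ (greenTest N (α + 1) β p) z d1 =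
        ∫ z in tri, f z * weight₂ α β z * k N z :=
      setIntegral_congr_fun measurableSet_tri fun z hz => by
        simp only [fderiv_greenTest_d1 N p hz, hk]; ring
    have E3 : ∫ z in tri, u₁ z * greenTest N (α + 1) β p z =
        ∫ z in tri, u₁ z * (z.1 * weight₂ α β z) * (cut N z.1 * cut N z.2 * ev p z) :=
      setIntegral_congr_fun measurableSet_tri fun z hz => by
        simp only [greenTest, bump_of_mem (tri_subset_closedTri hz), cutPow, weight₂,
          Real.rpow_add_one hz.1.ne']
        ring
    have E4 : ∫ t in Set.Ioo (0 : ℝ) 1, g t * greenTest N (α + 1) β p (t, 1 - t) =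
        ∫ t in Set.Ioo (0 : ℝ) 1,
          g t * edgeWeight α β t * (cut N t * cut N (1 - t) * ev (xP * p) (t, 1 - t)) :=
      setIntegral_congr_fun measurableSet_Ioo fun t ht => by
        simp only [greenTest_edge N (α + 1) β p ht, edgeWeight, ev_mul, ev_x,
          Real.rpow_add_one ht.1.ne']
        ring
    rw [E2, E3, E4] at E
    simp only [d1, mul_one, add_zero, one_mul] at E
    linarith
  exact tendsto_nhds_unique (T2.add T1) (T3.congr fun N => (key N).symm)

lemma fderiv_greenTest_d2 (N : ℕ) (p : Poly2) {z : ℝ × ℝ} (hz : z ∈ tri) :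
    fderiv ℝ (greenTest N α (β + 1) p) z d2 = weight₂ α β z *
      (cut N z.1 * ((z.2 * deriv (cut N) z.2 + (β + 1) * cut N z.2) * ev p z +
        cut N z.2 * (z.2 * ev (dY p) z))) := by
  have hx : HasFDerivAt (fun z : ℝ × ℝ => z.1) (ContinuousLinearMap.fst ℝ ℝ ℝ) z := hasFDerivAt_fst
  have hy : HasFDerivAt (fun z : ℝ × ℝ => z.2) (ContinuousLinearMap.snd ℝ ℝ ℝ) z := hasFDerivAt_snd
  have h1 := ((contDiff_cutPow N α).differentiable (by simp) z.1).hasDerivAt.comp_hasFDerivAt z hx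
  have h2 := (hasDerivAt_cutPow N β hz.2.1).comp_hasFDerivAt z hy
  have h3 := (h1.mul h2).mul (hasFDerivAt_ev p z)
  have h4 : greenTest N α (β + 1) p =ᶠ[𝓝 z]
      fun z => cutPow N α z.1 * cutPow N (β + 1) z.2 * ev p z := by
    filter_upwards [isOpen_tri.mem_nhds hz] with q hq
    rw [greenTest, bump_of_mem (tri_subset_closedTri hq), mul_one]
  rw [h4.fderiv_eq, (show fderiv ℝ (fun z : ℝ × ℝ => cutPow N α z.1 * cutPow N (β + 1) z.2 * ev p z)
    z = _ from h3.fderiv)]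
  simp [d2, cutPow, weight₂, Real.rpow_add_one hz.2.1.ne']
  ring

lemma TracedSobolev.green_y (h : TracedSobolev α β f u₁ u₂ g) (p : Poly2) :
    (∫ z in tri, u₂ z * (z.2 * weight₂ α β z) * ev p z) +
      (∫ z in tri, f z * weight₂ α β z * ev (yP * dY p + (β + 1) • p) z) =
    ∫ t in Set.Ioo (0 : ℝ) 1, g t * edgeWeight α β t * ev (yP * p) (t, 1 - t) := by
  obtain ⟨u, hu, -, e⟩ := h.tr.2.2 d2
  obtain ⟨D, hD0, -, hD⟩ := exists_deriv_cut_bound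
  obtain ⟨C, hC0, hC⟩ := exists_bound_ev p
  obtain ⟨C', hC0', hC'⟩ := exists_bound_ev (dY p)
  set k : ℕ → ℝ × ℝ → ℝ := fun N z =>
    cut N z.1 * ((z.2 * deriv (cut N) z.2 + (β + 1) * cut N z.2) * ev p z +
        cut N z.2 * (z.2 * ev (dY p) z)) with hk
  have T1 : Tendsto (fun N => ∫ z in tri, f z * weight₂ α β z * k N z) atTop
      (𝓝 (∫ z in tri, f z * weight₂ α β z * ev (yP * dY p + (β + 1) • p) z)) := by
    refine tendsto_integral_mul_of_bounded (C := (D + |β + 1|) * C + C') h.i₀ (fun N => ?_)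
      (fun N => ?_) ?_
    · have c1 : Continuous fun z : ℝ × ℝ => cut N z.1 :=
        (contDiff_cut N).continuous.comp continuous_fst
      have c2 : Continuous fun z : ℝ × ℝ => cut N z.2 :=
        (contDiff_cut N).continuous.comp continuous_snd
      have c3 : Continuous fun z : ℝ × ℝ => deriv (cut N) z.2 :=
        ((contDiff_cut N).continuous_deriv (by simp)).comp continuous_snd
      exact (c1.mul ((((continuous_snd.mul c3).add (c2.const_mul _)).mul (continuous_ev p)).add
        (c2.mul (continuous_snd.mul (continuous_ev _))))).aestronglyMeasurable
    · rw [ae_restrict_iff' measurableSet_tri]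
      refine Eventually.of_forall fun z hz => ?_
      have b1 : |z.2 * deriv (cut N) z.2| ≤ D := by
        rw [abs_mul, abs_of_pos hz.2.1]; exact hD N _ hz.2.1.le
      have b2 : |(β + 1) * cut N z.2| ≤ |β + 1| := by
        rw [abs_mul]; exact mul_le_of_le_one_right (abs_nonneg _) (abs_cut_le_one _ _)
      have b3 : |z.2 * ev (dY p) z| ≤ C' := by
        rw [abs_mul]
        refine (mul_le_of_le_one_left (abs_nonneg _) ?_).trans (hC' z (tri_subset_closedTri hz))
        rw [abs_of_pos hz.2.1]
        linarith [hz.1, hz.2.1, hz.2.2]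
      simp only [hk]
      rw [abs_mul]
      refine (mul_le_of_le_one_left (abs_nonneg _) (abs_cut_le_one _ _)).trans
        ((abs_add_le _ _).trans (add_le_add ?_ ?_))
      · rw [abs_mul]
        exact mul_le_mul ((abs_add_le _ _).trans (add_le_add b1 b2))
          (hC z (tri_subset_closedTri hz)) (abs_nonneg _) (by positivity)
      · rw [abs_mul]
        exact (mul_le_of_le_one_left (abs_nonneg _) (abs_cut_le_one _ _)).trans b3
    · rw [ae_restrict_iff' measurableSet_tri]
      refine Eventually.of_forall fun z hz => tendsto_const_nhds.congr' ?_
      filter_upwards [eventually_cut_eq hz.1, eventually_cut_eq hz.2.1] with N h1 h2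
      simp only [hk, h1.1, h2.2, h2.1, ev_add, ev_mul, ev_smul, ev_y]
      ring
  have T2 := tendsto_volume h.i₂ p
  have T3 := tendsto_edge h.ig (yP * p)
  have key : ∀ N, (∫ z in tri, u₂ z * (z.2 * weight₂ α β z) * (cut N z.1 * cut N z.2 * ev p z)) +
      (∫ z in tri, f z * weight₂ α β z * k N z) = ∫ t in Set.Ioo (0 : ℝ) 1,
        g t * edgeWeight α β t * (cut N t * cut N (1 - t) * ev (yP * p) (t, 1 - t)) := by
    intro N
    have c1 := contDiff_greenTest N α (β + 1) p
    have c3 := tsupport_greenTest N α (β + 1) p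
    have E := e _ c1 (hasCompactSupport_greenTest N α (β + 1) p) c3
    have E1 : ∫ z in tri, (f z * fderiv ℝ (greenTest N α (β + 1) p) z d2 +
        u z * greenTest N α (β + 1) p z) =
        ∫ z in tri, (f z * fderiv ℝ (greenTest N α (β + 1) p) z d2 +
          u₂ z * greenTest N α (β + 1) p z) :=
      integral_congr_ae ((hu.ae_eq h.h₂).mono fun z hz => by simp only [hz])
    rw [E1, integral_add (integrableOn_fderiv h.loc₀ c1 c3 d2)
      (integrableOn_mul_of_tsupport h.loc₂ c1.continuous c3)] at E
    have E2 : ∫ z in tri, f z * fderiv ℝ (greenTest N α (β + 1) p) z d2 =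
        ∫ z in tri, f z * weight₂ α β z * k N z :=
      setIntegral_congr_fun measurableSet_tri fun z hz => by
        simp only [fderiv_greenTest_d2 N p hz, hk]; ring
    have E3 : ∫ z in tri, u₂ z * greenTest N α (β + 1) p z =
        ∫ z in tri, u₂ z * (z.2 * weight₂ α β z) * (cut N z.1 * cut N z.2 * ev p z) :=
      setIntegral_congr_fun measurableSet_tri fun z hz => by
        simp only [greenTest, bump_of_mem (tri_subset_closedTri hz), cutPow, weight₂,
          Real.rpow_add_one hz.2.1.ne']
        ring
    have E4 : ∫ t in Set.Ioo (0 : ℝ) 1, g t * greenTest N α (β + 1) p (t, 1 - t) =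
        ∫ t in Set.Ioo (0 : ℝ) 1,
          g t * edgeWeight α β t * (cut N t * cut N (1 - t) * ev (yP * p) (t, 1 - t)) :=
      setIntegral_congr_fun measurableSet_Ioo fun t ht => by
        simp only [greenTest_edge N α (β + 1) p ht, edgeWeight, ev_mul, ev_y,
          Real.rpow_add_one (sub_pos.2 ht.2).ne']
        ring
    rw [E2, E3, E4] at E
    simp only [d2, mul_one, zero_add, one_mul] at E
    linarith
  exact tendsto_nhds_unique (T2.add T1) (T3.congr fun N => (key N).symm)

/-- Green's identities for a function with a trace. -/
theorem TracedSobolev.green (h : TracedSobolev α β f u₁ u₂ g) :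
    GreenId α β (triMap _ h.i₀) (triMap _ h.i₁) (triMap _ h.i₂) (edgeMap _ h.ig) where
  gx := h.green_x
  gy := h.green_y
  ts p := by
    simp only [edgeMap_apply, ev_mul, ev_s, add_sub_cancel, one_mul]

end
end Tri

namespace Tri
noncomputable section

open Filter Topology

/-! ### The weighted measures -/

variable {α β a b c : ℝ} {f u u₁ u₂ : ℝ × ℝ → ℝ} {g : ℝ → ℝ}

lemma weight_pos {p : ℝ × ℝ} (hp : p ∈ tri) : 0 < weight a b c p := by
  have h3 : 0 < 1 - p.1 - p.2 := by linarith [hp.2.2]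
  exact mul_pos (mul_pos (Real.rpow_pos_of_pos hp.1 _) (Real.rpow_pos_of_pos hp.2.1 _))
    (Real.rpow_pos_of_pos h3 _)

lemma measurable_weight : Measurable (weight a b c) := by
  unfold weight
  fun_prop

lemma aemeasurable_ofReal_weight : AEMeasurable (fun p => ENNReal.ofReal (weight a b c p))
    (volume.restrict tri) := measurable_weight.ennreal_ofReal.aemeasurable

lemma toReal_ofReal_weight {E : Type*} (F : ℝ × ℝ → E) [NormedAddCommGroup E] [NormedSpace ℝ E] :
    (fun p => (ENNReal.ofReal (weight a b c p)).toReal • F p) =ᵐ[volume.restrict tri]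
      fun p => weight a b c p • F p := by
  filter_upwards [ae_restrict_mem measurableSet_tri] with p hp
  rw [ENNReal.toReal_ofReal (weight_pos hp).le]

lemma integral_wMeasure (F : ℝ × ℝ → ℝ) :
    ∫ p, F p ∂(wMeasure a b c) = ∫ p in tri, F p * weight a b c p := by
  rw [wMeasure, integral_withDensity_eq_integral_toReal_smul₀ aemeasurable_ofReal_weight
    (Eventually.of_forall fun p => ENNReal.ofReal_lt_top), integral_congr_ae
    (toReal_ofReal_weight F)]
  simp only [smul_eq_mul, mul_comm]

lemma integrable_wMeasure {F : ℝ × ℝ → ℝ} :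
    Integrable F (wMeasure a b c) ↔ IntegrableOn (fun p => F p * weight a b c p) tri := by
  rw [wMeasure, integrable_withDensity_iff_integrable_smul₀' aemeasurable_ofReal_weight
    (Eventually.of_forall fun p => ENNReal.ofReal_lt_top), integrable_congr
    (toReal_ofReal_weight F)]
  simp only [smul_eq_mul, mul_comm]
  rfl

lemma wMeasure_absolutelyContinuous : wMeasure a b c ≪ volume.restrict tri :=
  withDensity_absolutelyContinuous _ _

lemma weight_zero (p : ℝ × ℝ) : weight α β 0 p = weight₂ α β p := by
  rw [weight, Real.rpow_zero, mul_one, weight₂]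

lemma weight_add_one_left {p : ℝ × ℝ} (hp : p ∈ tri) :
    weight (α + 1) β 0 p = p.1 * weight₂ α β p := by
  rw [weight_zero, weight₂, weight₂, Real.rpow_add_one hp.1.ne']; ring

lemma weight_add_one_right {p : ℝ × ℝ} (hp : p ∈ tri) :
    weight α (β + 1) 0 p = p.2 * weight₂ α β p := by
  rw [weight_zero, weight₂, weight₂, Real.rpow_add_one hp.2.1.ne']; ring

lemma isFiniteMeasure_wMeasure (hα : -1 < α) (hβ : -1 < β) : IsFiniteMeasure (wMeasure α β 0) := by
  have h : Integrable (fun _ : ℝ × ℝ => (1 : ℝ)) (wMeasure α β 0) := by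
    rw [integrable_wMeasure]
    simpa only [one_mul, funext weight_zero] using integrableOn_weight₂ hα hβ
  exact (integrable_const_iff_isFiniteMeasure one_ne_zero).1 h

lemma memLp_ev (hα : -1 < α) (hβ : -1 < β) (p : Poly2) : MemLp (ev p) 2 (wMeasure α β 0) := by
  have := isFiniteMeasure_wMeasure hα hβ
  obtain ⟨C, -, hC⟩ := exists_bound_ev p
  refine MemLp.of_bound (continuous_ev p).aestronglyMeasurable C ?_
  refine wMeasure_absolutelyContinuous.ae_le ?_
  filter_upwards [ae_restrict_mem measurableSet_tri] with z hz
  exact hC z (tri_subset_closedTri hz)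

/-! ### Density of polynomials -/

/-- A polynomial as a continuous function. -/
def evC : Poly2 →ₐ[ℝ] C(ℝ × ℝ, ℝ) where
  toFun p := ⟨ev p, continuous_ev p⟩
  map_one' := by ext z; exact ev_one z
  map_mul' p q := by ext z; exact ev_mul p q z
  map_zero' := by ext z; exact (MvPolynomial.eval ![z.1, z.2]).map_zero
  map_add' p q := by ext z; exact ev_add p q z
  commutes' r := by ext z; exact ev_C r z

/-- Stone-Weierstrass on the compact closed triangle; the coordinates separate points. -/
lemma exists_poly_near (h : C(ℝ × ℝ, ℝ)) {ε : ℝ} (hε : 0 < ε) :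
    ∃ p : Poly2, ∀ z ∈ tri, |h z - ev p z| ≤ ε := by
  have hsep : evC.range.SeparatesPoints := by
    intro z w hzw
    by_cases h1 : z.1 = w.1
    · have h2 : z.2 ≠ w.2 := fun h2 => hzw (Prod.ext h1 h2)
      refine ⟨_, ⟨evC yP, ⟨yP, rfl⟩, rfl⟩, ?_⟩
      change ev yP z ≠ ev yP w
      rwa [ev_y, ev_y]
    · refine ⟨_, ⟨evC xP, ⟨xP, rfl⟩, rfl⟩, ?_⟩
      change ev xP z ≠ ev xP w
      rwa [ev_x, ev_x]
  obtain ⟨_, ⟨p, rfl⟩, hp⟩ :=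
    ContinuousMap.exists_mem_subalgebra_near_continuous_of_isCompact_of_separatesPoints hsep h
      isCompact_closedTri hε
  refine ⟨p, fun z hz => ?_⟩
  have := (hp z (tri_subset_closedTri hz)).le
  rwa [Real.norm_eq_abs, abs_sub_comm] at this

/-- Bounded continuous functions are dense in `L²`, polynomials approximate them uniformly on the
triangle, and the measure is finite. -/
lemma exists_poly_eLpNorm_sub_le (hα : -1 < α) (hβ : -1 < β) (hf : MemLp f 2 (wMeasure α β 0))
    {ε : ENNReal} (hε : ε ≠ 0) : ∃ p : Poly2, eLpNorm (f - ev p) 2 (wMeasure α β 0) ≤ ε := by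
  have := isFiniteMeasure_wMeasure hα hβ
  obtain ⟨k, hk, hk'⟩ := hf.exists_boundedContinuous_eLpNorm_sub_le ENNReal.ofNat_ne_top
    (ENNReal.half_pos hε).ne'
  set M := (wMeasure α β 0) Set.univ ^ (2 : ENNReal).toReal⁻¹ with hM
  have hMt : M ≠ ⊤ := ENNReal.rpow_ne_top_of_nonneg (by positivity) (measure_ne_top _ _)
  obtain ⟨δ, hδ, hδε⟩ : ∃ δ : ℝ, 0 < δ ∧ M * ENNReal.ofReal δ ≤ ε / 2 := by
    have hpos := ENNReal.half_pos hε
    -- Using `M + 1` instead of `M` avoids a separate case `M = 0`.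
    have hdiv : ε / 2 / (M + 1) ≠ 0 := (ENNReal.div_pos hpos.ne' (by finiteness)).ne'
    obtain ⟨δ, h1, h2⟩ := ENNReal.lt_iff_exists_nnreal_btwn.1 (pos_iff_ne_zero.2 hdiv)
    refine ⟨δ, by exact_mod_cast h1, ?_⟩
    rw [ENNReal.ofReal_coe_nnreal]
    calc M * δ ≤ (M + 1) * (ε / 2 / (M + 1)) := mul_le_mul' le_self_add h2.le
      _ ≤ ε / 2 := ENNReal.mul_div_le
  obtain ⟨p, hp⟩ := exists_poly_near k.toContinuousMap hδ
  refine ⟨p, ?_⟩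
  have h2 : eLpNorm (⇑k - ev p) 2 (wMeasure α β 0) ≤ ε / 2 := by
    refine (eLpNorm_le_of_ae_bound (C := δ) ?_).trans hδε
    refine wMeasure_absolutelyContinuous.ae_le ?_
    filter_upwards [ae_restrict_mem measurableSet_tri] with z hz
    exact hp z hz
  have e : f - ev p = (f - ⇑k) + (⇑k - ev p) := by abel
  rw [e]
  refine (eLpNorm_add_le (hf.sub hk').aestronglyMeasurable
    (hk'.sub (memLp_ev hα hβ p)).aestronglyMeasurable one_le_two).trans ?_
  exact (add_le_add hk h2).trans_eq (ENNReal.add_halves ε)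

lemma eLpNorm_eq_sqrt {X : Type*} [MeasurableSpace X] {μ : Measure X} {f : X → ℝ}
    (hf : MemLp f 2 μ) : eLpNorm f 2 μ = ENNReal.ofReal (√(∫ x, f x * f x ∂μ)) := by
  rw [hf.eLpNorm_eq_integral_rpow_norm two_ne_zero ENNReal.ofNat_ne_top, Real.sqrt_eq_rpow]
  simp [← sq]

lemma integral_mul_self_nonneg {X : Type*} [MeasurableSpace X] {μ : Measure X} (f : X → ℝ) :
    0 ≤ ∫ x, f x * f x ∂μ := integral_nonneg fun _ => mul_self_nonneg _

/-- A function whose pairing with polynomials is bounded in `L²` is bounded in `L²`. -/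
lemma integral_sq_le_of_forall_poly (hα : -1 < α) (hβ : -1 < β) (hf : MemLp f 2 (wMeasure α β 0))
    {K : ℝ} (hK : 0 ≤ K)
    (h : ∀ p, (∫ z, f z * ev p z ∂(wMeasure α β 0)) ^ 2 ≤
      K * ∫ z, ev p z * ev p z ∂(wMeasure α β 0)) :
    ∫ z, f z * f z ∂(wMeasure α β 0) ≤ K := by
  set μ := wMeasure α β 0
  have hi : ∀ {f g : ℝ × ℝ → ℝ} (hf : MemLp f 2 μ) (hg : MemLp g 2 μ),
      inner ℝ (hf.toLp f) (hg.toLp g) = ∫ z, f z * g z ∂μ := by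
    intro f g hf hg
    rw [L2.inner_def]
    refine integral_congr_ae ?_
    filter_upwards [hf.coeFn_toLp, hg.coeFn_toLp] with z h1 h2
    rw [h1, h2]
    simp [mul_comm]
  set G := hf.toLp f
  -- The inequality is a closed condition on the second argument and holds for polynomials, hence
  -- for `f` itself, where it reads `‖f‖ ^ 4 ≤ K ‖f‖ ^ 2`.
  set S : Set (Lp ℝ 2 μ) := {x | inner ℝ G x ^ 2 ≤ K * inner ℝ x x}
  have hS : IsClosed S := isClosed_le ((continuous_const.inner continuous_id).pow 2)
    (continuous_const.mul (continuous_id.inner continuous_id))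
  have hG : G ∈ closure S := by
    rw [EMetric.mem_closure_iff]
    intro ε hε
    obtain ⟨p, hp⟩ := exists_poly_eLpNorm_sub_le hα hβ hf (ENNReal.half_pos hε.ne').ne'
    -- Half of `⊤` is not smaller than `⊤`, so any element of `S` serves in this case.
    by_cases htop : ε = ⊤
    · refine ⟨0, by simp [S], ?_⟩
      rw [htop]; exact edist_lt_top _ _
    refine ⟨(memLp_ev hα hβ p).toLp _, ?_, ?_⟩
    · change inner ℝ G _ ^ 2 ≤ K * inner ℝ _ _
      rw [hi, hi]
      exact h p
    · rw [Lp.edist_toLp_toLp]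
      exact hp.trans_lt (ENNReal.half_lt_self hε.ne' htop)
  rw [hS.closure_eq] at hG
  have hG' : inner ℝ G G ^ 2 ≤ K * inner ℝ G G := hG
  rw [hi] at hG'
  have h0 := integral_mul_self_nonneg (μ := μ) f
  by_contra hlt
  push Not at hlt
  nlinarith

/-! ### The moment functionals -/

/-- The integral of polynomials with respect to the weight. -/
def triMoment (hα : -1 < α) (hβ : -1 < β) : Poly2 →ₗ[ℝ] ℝ :=
  triMap (weight₂ α β) (integrableOn_weight₂ hα hβ)

lemma triMoment_apply (hα : -1 < α) (hβ : -1 < β) (p : Poly2) :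
    triMoment hα hβ p = ∫ z in tri, weight₂ α β z * ev p z := rfl

lemma integrableOn_edgeWeight (hα : -1 < α) (hβ : -1 < β) :
    IntegrableOn (edgeWeight α β) (Set.Ioo 0 1) := by
  simpa only [one_mul] using
    (tracedSobolev_of_contDiff hα hβ (f := fun _ => 1) contDiff_const).ig

/-- The integral of polynomials on the edge with respect to the weight. -/
def edgeMoment (hα : -1 < α) (hβ : -1 < β) : Poly2 →ₗ[ℝ] ℝ :=
  edgeMap (edgeWeight α β) (integrableOn_edgeWeight hα hβ)

lemma edgeMoment_apply (hα : -1 < α) (hβ : -1 < β) (p : Poly2) :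
    edgeMoment hα hβ p = ∫ t in Set.Ioo (0 : ℝ) 1, edgeWeight α β t * ev p (t, 1 - t) := rfl

/-- Green's identities for the constant function `1`. -/
lemma greenId_moment (hα : -1 < α) (hβ : -1 < β) :
    GreenId α β (triMoment hα hβ) 0 0 (edgeMoment hα hβ) := by
  have h := (tracedSobolev_of_contDiff hα hβ (f := fun _ => 1) contDiff_const).green
  have e1 := h.gx
  have e2 := h.gy
  have e3 := h.ts
  simp only [triMap_apply, edgeMap_apply, fderiv_fun_const, Pi.zero_apply, _root_.zero_apply,
    zero_mul, integral_zero, zero_add, one_mul] at e1 e2 e3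
  exact ⟨fun p => by rw [LinearMap.zero_apply, zero_add]; exact e1 p,
    fun p => by rw [LinearMap.zero_apply, zero_add]; exact e2 p, e3⟩

lemma isMoment (hα : -1 < α) (hβ : -1 < β) :
    IsMoment α β (triMoment hα hβ) (edgeMoment hα hβ) := by
  have nn : ∀ p : Poly2, (∀ z ∈ tri, 0 ≤ ev p z) → 0 ≤ triMoment hα hβ p := fun p hp =>
    setIntegral_nonneg measurableSet_tri fun z hz => mul_nonneg (weight₂_pos hz.1 hz.2.1).le (hp z hz)
  have e1 : ∀ z, ev (1 - sP) z = 1 - (z.1 + z.2) := fun z => by rw [ev_sub, ev_one, ev_s]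
  refine ⟨greenId_moment hα hβ, fun p => nn _ fun z hz => ?_, fun p => nn _ fun z hz => ?_,
    fun p hp => ?_, fun p => nn _ fun z hz => ?_⟩
  · rw [ev_mul, ev_mul, ev_x]; exact mul_nonneg hz.1.le (mul_self_nonneg _)
  · rw [ev_mul, ev_mul, ev_y]; exact mul_nonneg hz.2.1.le (mul_self_nonneg _)
  · refine lt_of_le_of_ne (nn _ fun z hz => ?_) fun h0 => hp ?_
    · rw [ev_mul, ev_mul, e1]
      exact mul_nonneg (by linarith [hz.2.2]) (mul_self_nonneg _)
    · rw [triMoment_apply, eq_comm, integral_eq_zero_iff_of_nonneg_ae] at h0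
      · have hc : ContinuousOn (fun z => weight₂ α β z * ev ((1 - sP) * (p * p)) z) tri :=
          (continuousOn_weight₂.mono tri_subset_quadrant).mul (continuous_ev _).continuousOn
        have := Measure.eqOn_open_of_ae_eq h0 isOpen_tri hc continuousOn_const
        refine eq_zero_of_ev_eq_zero fun z hz => ?_
        have hz0 := this hz
        simp only [Pi.zero_apply, ev_mul, e1, mul_eq_zero, or_self,
          (weight₂_pos hz.1 hz.2.1).ne', false_or] at hz0
        exact hz0.resolve_left (by linarith [hz.2.2])
      · rw [EventuallyLE, ae_restrict_iff' measurableSet_tri]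
        refine Eventually.of_forall fun z hz => ?_
        rw [ev_mul, ev_mul, e1]
        exact mul_nonneg (weight₂_pos hz.1 hz.2.1).le
          (mul_nonneg (by linarith [hz.2.2]) (mul_self_nonneg _))
      · exact IntegrableOn.mul_continuous_tri (integrableOn_weight₂ hα hβ) (continuous_ev _)
  · rw [ev_mul, ev_mul, ev_mul, ev_mul, ev_x, ev_y, e1]
    exact mul_nonneg (by linarith [hz.2.2]) (mul_nonneg (mul_nonneg hz.1.le hz.2.1.le)
      (mul_self_nonneg _))

end
end Tri

namespace Tri
noncomputable section

open Filter Topology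

variable {α β lam : ℝ} {f u₁ u₂ f' u₁' u₂' : ℝ × ℝ → ℝ} {g g' : ℝ → ℝ} {n : ℕ}

/-! ### The error estimate in terms of the energy -/

lemma WeightedSobolev.of_memLp (hα : -1 < α) (hβ : -1 < β) (h₁ : HasWeakDeriv d1 f u₁)
    (h₂ : HasWeakDeriv d2 f u₂) (hf : MemLp f 2 (wMeasure α β 0))
    (hu₁ : MemLp u₁ 2 (wMeasure (α + 1) β 0)) (hu₂ : MemLp u₂ 2 (wMeasure α (β + 1) 0)) :
    WeightedSobolev α β f u₁ u₂ := by
  have := isFiniteMeasure_wMeasure hα hβ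
  have := isFiniteMeasure_wMeasure (by linarith : -1 < α + 1) hβ
  have := isFiniteMeasure_wMeasure hα (by linarith : -1 < β + 1)
  refine ⟨h₁, h₂, ?_, ?_, ?_⟩
  · refine (integrable_wMeasure.1 (hf.integrable one_le_two)).congr_fun (fun z _ => ?_)
      measurableSet_tri
    simp only [weight_zero]
  · refine (integrable_wMeasure.1 (hu₁.integrable one_le_two)).congr_fun (fun z hz => ?_)
      measurableSet_tri
    simp only [weight_add_one_left hz]
  · refine (integrable_wMeasure.1 (hu₂.integrable one_le_two)).congr_fun (fun z hz => ?_)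
      measurableSet_tri
    simp only [weight_add_one_right hz]

lemma integral_wMeasure_left (u v : ℝ × ℝ → ℝ) : ∫ z, u z * v z ∂(wMeasure (α + 1) β 0) =
    ∫ z in tri, u z * (z.1 * weight₂ α β z) * v z := by
  rw [integral_wMeasure]
  refine setIntegral_congr_fun measurableSet_tri fun z hz => ?_
  simp only [weight_add_one_left hz]; ring

lemma integral_wMeasure_right (u v : ℝ × ℝ → ℝ) : ∫ z, u z * v z ∂(wMeasure α (β + 1) 0) =
    ∫ z in tri, u z * (z.2 * weight₂ α β z) * v z := by
  rw [integral_wMeasure]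
  refine setIntegral_congr_fun measurableSet_tri fun z hz => ?_
  simp only [weight_add_one_right hz]; ring

lemma integral_wMeasure_zero (u v : ℝ × ℝ → ℝ) : ∫ z, u z * v z ∂(wMeasure α β 0) =
    ∫ z in tri, u z * weight₂ α β z * v z := by
  rw [integral_wMeasure]
  refine setIntegral_congr_fun measurableSet_tri fun z hz => ?_
  simp only [weight_zero]; ring

lemma integral_ev_left (hα : -1 < α) (hβ : -1 < β) (p q : Poly2) :
    ∫ z, ev p z * ev q z ∂(wMeasure (α + 1) β 0) = triMoment hα hβ (xP * (p * q)) := by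
  rw [integral_wMeasure_left, triMoment_apply]
  exact setIntegral_congr_fun measurableSet_tri fun z _ => by
    simp only [ev_mul, ev_x]; ring

lemma integral_ev_right (hα : -1 < α) (hβ : -1 < β) (p q : Poly2) :
    ∫ z, ev p z * ev q z ∂(wMeasure α (β + 1) 0) = triMoment hα hβ (yP * (p * q)) := by
  rw [integral_wMeasure_right, triMoment_apply]
  exact setIntegral_congr_fun measurableSet_tri fun z _ => by
    simp only [ev_mul, ev_y]; ring

lemma integral_ev_zero (hα : -1 < α) (hβ : -1 < β) (p q : Poly2) :
    ∫ z, ev p z * ev q z ∂(wMeasure α β 0) = triMoment hα hβ (p * q) := by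
  rw [integral_wMeasure_zero, triMoment_apply]
  exact setIntegral_congr_fun measurableSet_tri fun z _ => by
    simp only [ev_mul]; ring

lemma integral_sub_smul_sq {X : Type*} [MeasurableSpace X] {μ : Measure X} {u v : X → ℝ}
    (hu : MemLp u 2 μ) (hv : MemLp v 2 μ) (t : ℝ) :
    0 ≤ ∫ x, u x * u x ∂μ + t * (2 * ∫ x, u x * v x ∂μ) + t * t * ∫ x, v x * v x ∂μ := by
  have i1 : Integrable (fun x => u x * u x) μ := hu.integrable_mul hu
  have i2 : Integrable (fun x => u x * v x) μ := hu.integrable_mul hv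
  have i3 : Integrable (fun x => v x * v x) μ := hv.integrable_mul hv
  have h := integral_mul_self_nonneg (μ := μ) fun x => u x + t * v x
  have e : ∀ x, (u x + t * v x) * (u x + t * v x) =
      u x * u x + (t * 2) * (u x * v x) + (t * t) * (v x * v x) := fun x => by ring
  simp only [e] at h
  have j : Integrable (fun x => u x * u x + (t * 2) * (u x * v x)) μ := i1.add (i2.const_mul _)
  rw [integral_add j (i3.const_mul _), integral_add i1 (i2.const_mul _), integral_const_mul,
    integral_const_mul] at h
  linarith

/-- Cauchy-Schwarz for pairs of functions: the quadratic polynomial in `t` given by the energy of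
`(u₁ + t p, u₂ + t q)` is nonnegative, so its discriminant is not positive. -/
lemma energy_bound (hα : -1 < α) (hβ : -1 < β) (hu₁ : MemLp u₁ 2 (wMeasure (α + 1) β 0))
    (hu₂ : MemLp u₂ 2 (wMeasure α (β + 1) 0)) (p q : Poly2) :
    (∫ z, u₁ z * ev p z ∂(wMeasure (α + 1) β 0) + ∫ z, u₂ z * ev q z ∂(wMeasure α (β + 1) 0)) ^ 2 ≤
      (∫ z, u₁ z * u₁ z ∂(wMeasure (α + 1) β 0) + ∫ z, u₂ z * u₂ z ∂(wMeasure α (β + 1) 0)) *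
        triMoment hα hβ (xP * (p * p) + yP * (q * q)) := by
  have h1 := integral_sub_smul_sq hu₁ (memLp_ev (by linarith : -1 < α + 1) hβ p)
  have h2 := integral_sub_smul_sq hu₂ (memLp_ev hα (by linarith : -1 < β + 1) q)
  simp only [integral_ev_left hα hβ, integral_ev_right hα hβ] at h1 h2
  rw [map_add]
  have := discrim_le_zero (a := triMoment hα hβ (xP * (p * p)) + triMoment hα hβ (yP * (q * q)))
    (b := 2 * (∫ z, u₁ z * ev p z ∂(wMeasure (α + 1) β 0) +
      ∫ z, u₂ z * ev q z ∂(wMeasure α (β + 1) 0)))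
    (c := ∫ z, u₁ z * u₁ z ∂(wMeasure (α + 1) β 0) + ∫ z, u₂ z * u₂ z ∂(wMeasure α (β + 1) 0))
    (fun t => by linarith [h1 t, h2 t])
  rw [discrim] at this
  linarith

/-- The Sobolev inner product with a polynomial. -/
def sobPair (α β lam : ℝ) (u₁ u₂ : ℝ × ℝ → ℝ) (g : ℝ → ℝ) (p : Poly2) : ℝ :=
  ∫ z, u₁ z * ev (dX p) z ∂(wMeasure (α + 1) β 0) +
    ∫ z, u₂ z * ev (dY p) z ∂(wMeasure α (β + 1) 0) +
    lam * ∫ t in Set.Ioo (0 : ℝ) 1, g t * edgeWeight α β t * ev p (t, 1 - t)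

lemma sobPair_ev (hα : -1 < α) (hβ : -1 < β) (lam : ℝ) (p q : Poly2) :
    sobPair α β lam (ev (dX p)) (ev (dY p)) (fun t => ev p (t, 1 - t)) q =
      sobolev lam (triMoment hα hβ) (edgeMoment hα hβ) p q := by
  rw [sobPair, integral_ev_left hα hβ, integral_ev_right hα hβ, sobolev, dirichlet, map_add,
    edgeMoment_apply]
  congr 2
  exact setIntegral_congr_fun measurableSet_Ioo fun t _ => by simp only [ev_mul]; ring

/-- The estimate for functions that are orthogonal to polynomials of degree at most `n`. -/
theorem TracedSobolev.energy_estimate (hα : -1 < α) (hβ : -1 < β) (hl : 0 < lam)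
    (h : TracedSobolev α β f u₁ u₂ g) (hf : MemLp f 2 (wMeasure α β 0))
    (hu₁ : MemLp u₁ 2 (wMeasure (α + 1) β 0)) (hu₂ : MemLp u₂ 2 (wMeasure α (β + 1) 0))
    (hn : 1 ≤ n) (hS : ∀ k j, k + j ≤ n → sobPair α β lam u₁ u₂ g (sobPoly α β k j) = 0) :
    (∫ z, f z * f z ∂(wMeasure α β 0) ≤ (3 / n) ^ 2 *
      (∫ z, u₁ z * u₁ z ∂(wMeasure (α + 1) β 0) + ∫ z, u₂ z * u₂ z ∂(wMeasure α (β + 1) 0))) ∧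
    (∀ p ∈ degSpan (n - 1), ∫ z, u₁ z * ev p z ∂(wMeasure (α + 1) β 0) = 0) ∧
    (∀ p ∈ degSpan (n - 1), ∫ z, u₂ z * ev p z ∂(wMeasure α (β + 1) 0) = 0) := by
  have hαβ : -1 < α + β + 1 := by linarith
  have hF := h.green
  have e1 : ∀ p, triMap _ h.i₁ p = ∫ z, u₁ z * ev p z ∂(wMeasure (α + 1) β 0) := fun p =>
    (integral_wMeasure_left _ _).symm
  have e2 : ∀ p, triMap _ h.i₂ p = ∫ z, u₂ z * ev p z ∂(wMeasure α (β + 1) 0) := fun p =>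
    (integral_wMeasure_right _ _).symm
  have e0 : ∀ p, triMap _ h.i₀ p = ∫ z, f z * ev p z ∂(wMeasure α β 0) := fun p =>
    (integral_wMeasure_zero _ _).symm
  obtain ⟨o1, o2, o3⟩ := orthogonality hαβ hF hl (n := n) fun p hp =>
    sobolev_eq_zero_of_mem (fun k j hkj => by rw [e1, e2]; exact hS k j hkj) hp
  obtain ⟨o4, o5⟩ := o3 hn
  refine ⟨?_, fun p hp => by rw [← e1]; exact o4 p hp, fun p hp => by rw [← e2]; exact o5 p hp⟩
  have hEn := add_nonneg (integral_mul_self_nonneg (μ := wMeasure (α + 1) β 0) u₁)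
    (integral_mul_self_nonneg (μ := wMeasure α (β + 1) 0) u₂)
  have hn0 : (0 : ℝ) < n := by exact_mod_cast hn
  refine integral_sq_le_of_forall_poly hα hβ hf (by positivity) fun p => ?_
  have hb := functional_bound hαβ (isMoment hα hβ) hF hEn
    (fun p q => by rw [e1, e2]; exact energy_bound hα hβ hu₁ hu₂ p q)
    (fun k hk => o1 _ (Submodule.subset_span ⟨k, 1, hk, by simp, by rw [rad_one, mul_one]⟩)) o2 hn p
  rw [e0] at hb
  rw [integral_ev_zero hα hβ]
  have : (3 / (n : ℝ)) ^ 2 * (∫ z, u₁ z * u₁ z ∂(wMeasure (α + 1) β 0) +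
      ∫ z, u₂ z * u₂ z ∂(wMeasure α (β + 1) 0)) * triMoment hα hβ (p * p) =
      9 * ((∫ z, u₁ z * u₁ z ∂(wMeasure (α + 1) β 0) +
      ∫ z, u₂ z * u₂ z ∂(wMeasure α (β + 1) 0)) * triMoment hα hβ (p * p)) / (n : ℝ) ^ 2 := by
    field_simp
    ring
  rw [this, le_div_iff₀ (by positivity)]
  linarith

lemma eLpNorm_le_of_orthogonal {X : Type*} [MeasurableSpace X] {μ : Measure X} {u v : X → ℝ}
    (hu : MemLp u 2 μ) (hv : MemLp v 2 μ) (h : ∫ x, u x * v x ∂μ = 0) :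
    eLpNorm u 2 μ ≤ eLpNorm (fun x => u x + v x) 2 μ := by
  change _ ≤ eLpNorm (u + v) 2 μ
  rw [eLpNorm_eq_sqrt hu, eLpNorm_eq_sqrt (hu.add hv)]
  refine ENNReal.ofReal_le_ofReal (Real.sqrt_le_sqrt ?_)
  have i1 : Integrable (fun x => u x * u x) μ := hu.integrable_mul hu
  have i2 : Integrable (fun x => u x * v x) μ := hu.integrable_mul hv
  have i3 : Integrable (fun x => v x * v x) μ := hv.integrable_mul hv
  have e : ∀ x, (u + v) x * (u + v) x = u x * u x + 2 * (u x * v x) + v x * v x := fun x => by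
    simp only [Pi.add_apply]; ring
  have j : Integrable (fun x => u x * u x + 2 * (u x * v x)) μ := i1.add (i2.const_mul _)
  simp only [e]
  rw [integral_add j i3, integral_add i1 (i2.const_mul _), integral_const_mul, h]
  linarith [integral_mul_self_nonneg (μ := μ) v]

lemma eLpNorm_le_of_sq_le {X Y : Type*} [MeasurableSpace X] [MeasurableSpace Y] {μ : Measure X}
    {ν₁ ν₂ : Measure Y} {f : X → ℝ} {u v : Y → ℝ} {K : ℝ} (hK : 0 ≤ K) (hf : MemLp f 2 μ)
    (hu : MemLp u 2 ν₁) (hv : MemLp v 2 ν₂)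
    (h : ∫ x, f x * f x ∂μ ≤ K ^ 2 * (∫ y, u y * u y ∂ν₁ + ∫ y, v y * v y ∂ν₂)) :
    eLpNorm f 2 μ ≤ ENNReal.ofReal K * (eLpNorm u 2 ν₁ + eLpNorm v 2 ν₂) := by
  rw [eLpNorm_eq_sqrt hf, eLpNorm_eq_sqrt hu, eLpNorm_eq_sqrt hv,
    ← ENNReal.ofReal_add (Real.sqrt_nonneg _) (Real.sqrt_nonneg _), ← ENNReal.ofReal_mul hK]
  refine ENNReal.ofReal_le_ofReal (Real.sqrt_le_iff.2 ⟨by positivity, h.trans ?_⟩)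
  rw [mul_pow]
  refine mul_le_mul_of_nonneg_left ?_ (sq_nonneg K)
  have h1 := Real.sq_sqrt (integral_mul_self_nonneg (μ := ν₁) u)
  have h2 := Real.sq_sqrt (integral_mul_self_nonneg (μ := ν₂) v)
  nlinarith [Real.sqrt_nonneg (∫ y, u y * u y ∂ν₁), Real.sqrt_nonneg (∫ y, v y * v y ∂ν₂)]

/-! ### The basis and the Sobolev inner product -/

lemma basisJ_eq (hα : -1 < α) (hβ : -1 < β) {k m : ℕ} {z : ℝ × ℝ} (hz : z ∈ tri) :
    basisJ α β (-1) k m z = ev (sobPoly α β k (m - k)) z := by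
  have hs : z.1 + z.2 ≠ 0 := (add_pos hz.1 hz.2.1).ne'
  have hk : (0 : ℝ) ≤ k := by positivity
  rw [basisJ, sobPoly, ev_mul, jacobi_eq (by linarith), jacobi_eq (by linarith)]
  congr 1
  · rw [harm, ev_sum, Finset.mul_sum]
    refine Finset.sum_congr rfl fun i hi => ?_
    have hik : i ≤ k := Nat.lt_succ_iff.1 (Finset.mem_range.1 hi)
    -- The expansion variable `(t - 1) / 2` is `-x / (x + y)` for the angular factor and `-(x + y)`
    -- for the radial one; hence the signs in `harm` and `radJ`.
    have e : ((z.2 - z.1) / (z.1 + z.2) - 1) / 2 = -z.1 / (z.1 + z.2) := by field_simp; ring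
    obtain ⟨j, rfl⟩ := Nat.exists_eq_add_of_le hik
    rw [ev_smul, ev_mul, ev_pow, ev_pow, ev_x, ev_s, e, div_pow, neg_pow, Nat.add_sub_cancel_left,
      pow_add]
    field_simp
  · have hev : ∀ r : Polynomial ℝ, ev (rad r) z = r.eval (z.1 + z.2) := fun r => by
      rw [rad, ev, ← MvPolynomial.coe_aeval_eq_eval, RingHom.coe_coe, ← Polynomial.aeval_algHom_apply,
        Polynomial.coe_aeval_eq_eval, ← ev_s z]
      rfl
    rw [hev, radJ, Polynomial.eval_finsetSum, show 2 * (k : ℝ) + α + β + 1 = 2 * k + (α + β + 1) by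
      ring]
    refine Finset.sum_congr rfl fun i _ => ?_
    have e : (1 - 2 * z.1 - 2 * z.2 - 1) / 2 = -(z.1 + z.2) := by ring
    rw [e, neg_pow, Polynomial.eval_smul, Polynomial.eval_pow, Polynomial.eval_X, smul_eq_mul]
    ring

lemma basisJ_ae_eq (hα : -1 < α) (hβ : -1 < β) (k m : ℕ) :
    ev (sobPoly α β k (m - k)) =ᵐ[volume.restrict tri] basisJ α β (-1) k m := by
  filter_upwards [ae_restrict_mem measurableSet_tri] with z hz
  exact (basisJ_eq hα hβ hz).symm

lemma tracedSobolev_ev (hα : -1 < α) (hβ : -1 < β) (p : Poly2) :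
    TracedSobolev α β (ev p) (ev (dX p)) (ev (dY p)) (fun t => ev p (t, 1 - t)) := by
  have := tracedSobolev_of_contDiff hα hβ (contDiff_ev p)
  rwa [funext (fderiv_ev_d1 p), funext (fderiv_ev_d2 p)] at this

lemma sobZ_eq (h : TracedSobolev α β f u₁ u₂ g) {p : Poly2}
    (h' : TracedSobolev α β f' (ev (dX p)) (ev (dY p)) (fun t => ev p (t, 1 - t))) :
    sobZ lam α β f f' = sobPair α β lam u₁ u₂ g p := by
  rw [sobZ, sobPair, wInner, wInner, edgeInner, integral_wMeasure, integral_wMeasure]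
  congr 1
  · congr 1
    · refine integral_congr_ae ?_
      filter_upwards [weakDeriv_ae_eq h.h₁, weakDeriv_ae_eq h'.h₁] with z h1 h2
      rw [h1, h2]
    · refine integral_congr_ae ?_
      filter_upwards [weakDeriv_ae_eq h.h₂, weakDeriv_ae_eq h'.h₂] with z h1 h2
      rw [h1, h2]
  · congr 1
    refine integral_congr_ae ?_
    filter_upwards [traceZ_ae_eq h.tr, traceZ_ae_eq h'.tr] with t h1 h2
    rw [h1, h2, edgeWeight]
    ring

lemma sobZ_basisJ (hα : -1 < α) (hβ : -1 < β) (h : TracedSobolev α β f u₁ u₂ g) (k m : ℕ) :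
    sobZ lam α β f (basisJ α β (-1) k m) = sobPair α β lam u₁ u₂ g (sobPoly α β k (m - k)) :=
  sobZ_eq h ((tracedSobolev_ev hα hβ _).congr_fun (basisJ_ae_eq hα hβ k m))

lemma sobZ_basisJ_self (hα : -1 < α) (hβ : -1 < β) (k m : ℕ) :
    sobZ lam α β (basisJ α β (-1) k m) (basisJ α β (-1) k m) =
      sobolev lam (triMoment hα hβ) (edgeMoment hα hβ) (sobPoly α β k (m - k))
        (sobPoly α β k (m - k)) := by
  rw [sobZ_basisJ hα hβ ((tracedSobolev_ev hα hβ _).congr_fun (basisJ_ae_eq hα hβ k m)),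
    sobPair_ev hα hβ]

/-- The Fourier coefficients in the Sobolev expansion. -/
def sobCoeff (lam α β : ℝ) (f : ℝ × ℝ → ℝ) (k m : ℕ) : ℝ :=
  sobZ lam α β f (basisJ α β (-1) k m) /
    sobZ lam α β (basisJ α β (-1) k m) (basisJ α β (-1) k m)

/-- The polynomial that agrees with the partial sum on the triangle. -/
def sumPoly (lam α β : ℝ) (n : ℕ) (f : ℝ × ℝ → ℝ) : Poly2 :=
  ∑ m ∈ Finset.range (n + 1), ∑ k ∈ Finset.range (m + 1),
    sobCoeff lam α β f k m • sobPoly α β k (m - k)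

lemma sumZ_eq (hα : -1 < α) (hβ : -1 < β) (f : ℝ × ℝ → ℝ) {z : ℝ × ℝ} (hz : z ∈ tri) :
    sumZ lam α β n f z = ev (sumPoly lam α β n f) z := by
  rw [sumZ, fourierSum, sumPoly, ev_sum]
  refine Finset.sum_congr rfl fun m _ => ?_
  rw [ev_sum]
  refine Finset.sum_congr rfl fun k _ => ?_
  rw [ev_smul, basisJ_eq hα hβ hz, sobCoeff]

lemma totalDegree_sumPoly (lam α β : ℝ) (n : ℕ) (f : ℝ × ℝ → ℝ) :
    (sumPoly lam α β n f).totalDegree ≤ n := by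
  refine MvPolynomial.totalDegree_finsetSum_le fun m hm => ?_
  refine MvPolynomial.totalDegree_finsetSum_le fun k hk => ?_
  rw [Finset.mem_range] at hm hk
  refine (MvPolynomial.totalDegree_smul_le _ _).trans ((totalDegree_sobPoly α β _ _).trans ?_)
  omega

lemma sobPair_sub (h : TracedSobolev α β f u₁ u₂ g) (h' : TracedSobolev α β f' u₁' u₂' g')
    (p : Poly2) : sobPair α β lam (fun z => 1 * u₁ z + (-1) * u₁' z)
      (fun z => 1 * u₂ z + (-1) * u₂' z) (fun t => 1 * g t + (-1) * g' t) p =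
      sobPair α β lam u₁ u₂ g p - sobPair α β lam u₁' u₂' g' p := by
  have H := h.combo h' 1 (-1)
  simp only [sobPair, integral_wMeasure_left, integral_wMeasure_right]
  have a1 := integral_sub (IntegrableOn.mul_continuous_tri h.i₁ (continuous_ev (dX p)))
    (IntegrableOn.mul_continuous_tri h'.i₁ (continuous_ev (dX p)))
  have a2 := integral_sub (IntegrableOn.mul_continuous_tri h.i₂ (continuous_ev (dY p)))
    (IntegrableOn.mul_continuous_tri h'.i₂ (continuous_ev (dY p)))
  have a3 := integral_sub (IntegrableOn.mul_continuous_edge h.ig (continuous_ev_edge p))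
    (IntegrableOn.mul_continuous_edge h'.ig (continuous_ev_edge p))
  simp only [one_mul, neg_mul, ← sub_eq_add_neg, sub_mul]
  rw [a1, a2, a3]
  ring

/-- The partial sum has the same Sobolev products with the basis as `f`: orthogonality leaves one
term, and positivity of its norm cancels the denominator. -/
lemma sobPair_sumPoly (hα : -1 < α) (hβ : -1 < β) (hl : 0 < lam)
    (h : TracedSobolev α β f u₁ u₂ g) {k j : ℕ} (hkj : k + j ≤ n) :
    sobolev lam (triMoment hα hβ) (edgeMoment hα hβ) (sumPoly lam α β n f) (sobPoly α β k j) =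
      sobPair α β lam u₁ u₂ g (sobPoly α β k j) := by
  have hαβ : -1 < α + β + 1 := by linarith
  have hM := isMoment hα hβ
  set I := triMoment hα hβ
  set T := edgeMoment hα hβ
  set B : Poly2 →ₗ[ℝ] Poly2 →ₗ[ℝ] ℝ := dirichletForm I + lam • mulForm T with hB
  have eB : ∀ p q, sobolev lam I T p q = B p q := fun p q => rfl
  have o : ∀ l i, (l, i) ≠ (k, j) → B (sobPoly α β l i) (sobPoly α β k j) = 0 := fun l i hne => by
    rw [← eB]; exact hM.sobolev_sobPoly_orthogonal hαβ lam hne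
  have hp := hM.sobolev_self_pos hαβ hl k j
  rw [eB, sumPoly, map_sum, LinearMap.sum_apply, Finset.sum_eq_single (k + j), map_sum,
    LinearMap.sum_apply, Finset.sum_eq_single k]
  · rw [map_smul, LinearMap.smul_apply, smul_eq_mul, sobCoeff, sobZ_basisJ hα hβ h,
      sobZ_basisJ_self hα hβ, Nat.add_sub_cancel_left, ← eB, div_mul_cancel₀ _ hp.ne']
  · intro l hl' hne
    rw [map_smul, LinearMap.smul_apply, o _ _ fun he => hne (Prod.mk.inj he).1, smul_zero]
  · intro hk
    exact absurd (Finset.mem_range.2 (by omega)) hk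
  · intro m _ hne
    rw [map_sum, LinearMap.sum_apply]
    refine Finset.sum_eq_zero fun l hl' => ?_
    rw [Finset.mem_range] at hl'
    rw [map_smul, LinearMap.smul_apply, o, smul_zero]
    intro he
    obtain ⟨h1, h2⟩ := Prod.mk.inj he
    omega
  · intro hk
    exact absurd (Finset.mem_range.2 (by omega)) hk

/-- Finiteness provides a polynomial at finite distance, and polynomials are square integrable. -/
lemma memLp_of_bestApprox_lt_top (hα : -1 < α) (hβ : -1 < β)
    (hm : AEStronglyMeasurable f (volume.restrict tri)) (h : bestApprox n f α β 0 < ⊤) :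
    MemLp f 2 (wMeasure α β 0) := by
  obtain ⟨q, hq⟩ := iInf_lt_iff.1 h
  have hm' : AEStronglyMeasurable f (wMeasure α β 0) := hm.mono_ac wMeasure_absolutelyContinuous
  have hq' := memLp_ev hα hβ q.1
  have : MemLp (fun z => f z - ev q.1 z) 2 (wMeasure α β 0) :=
    ⟨hm'.sub hq'.aestronglyMeasurable, hq⟩
  exact (this.add hq').ae_eq (Eventually.of_forall fun z => by simp)

/-- The error estimate for the parameters `(α, β, -1)`. -/
theorem sumZ_estimate (hα : -1 < α) (hβ : -1 < β) (hl : 0 < lam) (hf : MemSobolev α β 0 f)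
    (hn : 1 ≤ n) :
    wNorm α β 0 (fun p => f p - sumZ lam α β n f p) ≤ ENNReal.ofReal (3 / n) *
      (bestApprox (n - 1) (weakDeriv d1 f) (α + 1) β 0 +
        bestApprox (n - 1) (weakDeriv d2 f) α (β + 1) 0) := by
  have hα' : -1 < α + 1 := by linarith
  have hβ' : -1 < β + 1 := by linarith
  have hn0 : (0 : ℝ) < n := by exact_mod_cast hn
  -- The integrability in the Sobolev condition has an extra factor `1 - x - y` in the weight and is
  -- too weak. The stronger integrability comes from finiteness of the right-hand side; the infinite
  -- case is trivial.
  obtain ⟨hf0, ⟨w₁, hw₁, -⟩, ⟨w₂, hw₂, -⟩, -⟩ := hf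
  have h₁ := hasWeakDeriv_weakDeriv hw₁
  have h₂ := hasWeakDeriv_weakDeriv hw₂
  set u₁ := weakDeriv d1 f
  set u₂ := weakDeriv d2 f
  by_cases htop : bestApprox (n - 1) u₁ (α + 1) β 0 + bestApprox (n - 1) u₂ α (β + 1) 0 = ⊤
  · rw [htop, ENNReal.mul_top (ENNReal.ofReal_pos.2 (by positivity)).ne']
    exact le_top
  obtain ⟨ht1, ht2⟩ := ENNReal.add_ne_top.1 htop
  have hu₁ := memLp_of_bestApprox_lt_top hα' hβ h₁.2.1.aestronglyMeasurable
    (lt_top_iff_ne_top.2 ht1)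
  have hu₂ := memLp_of_bestApprox_lt_top hα hβ' h₂.2.1.aestronglyMeasurable
    (lt_top_iff_ne_top.2 ht2)
  have h := (WeightedSobolev.of_memLp hα hβ h₁ h₂ hf0 hu₁ hu₂).traced
  set S := sumPoly lam α β n f with hS
  have hSd : S ∈ degSpan n := mem_degSpan_of_totalDegree_le (totalDegree_sumPoly lam α β n f)
  have hSt := tracedSobolev_ev hα hβ S
  have H := h.combo hSt 1 (-1)
  have m0 := hf0.sub (memLp_ev hα hβ S)
  have m1 := hu₁.sub (memLp_ev hα' hβ (dX S))
  have m2 := hu₂.sub (memLp_ev hα hβ' (dY S))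
  have r : ∀ a b : ℝ × ℝ → ℝ, (fun z => 1 * a z + (-1) * b z) = a - b := fun a b => by
    ext z; simp only [Pi.sub_apply]; ring
  rw [r, r, r] at H
  obtain ⟨b0, b1, b2⟩ := H.energy_estimate hα hβ hl m0 m1 m2 hn fun k j hkj => by
    have := sobPair_sub (lam := lam) h hSt (sobPoly α β k j)
    rw [r, r, sobPair_ev hα hβ, sobPair_sumPoly hα hβ hl h hkj, sub_self] at this
    exact this
  have hE : wNorm α β 0 (fun p => f p - sumZ lam α β n f p) =
      eLpNorm (f - ev S) 2 (wMeasure α β 0) := by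
    refine eLpNorm_congr_ae (wMeasure_absolutelyContinuous.ae_le ?_)
    filter_upwards [ae_restrict_mem measurableSet_tri] with z hz
    rw [sumZ_eq hα hβ f hz, Pi.sub_apply]
  rw [hE]
  refine (eLpNorm_le_of_sq_le (by positivity) m0 m1 m2 b0).trans ?_
  gcongr
  -- Pythagoras: for a competitor `q` the difference `∂₁ S - q` has degree at most `n - 1`, so it is
  -- orthogonal to `∂₁ f - ∂₁ S`.
  · refine le_iInf fun q => ?_
    have hq := mem_degSpan_of_totalDegree_le q.2
    have := eLpNorm_le_of_orthogonal m1 (memLp_ev hα' hβ (dX S - q.1))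
      (b1 _ (Submodule.sub_mem _ (dX_mem_degSpan hSd) hq))
    refine this.trans_eq (congrArg (fun k => eLpNorm k 2 _) (funext fun z => ?_))
    rw [ev_sub, Pi.sub_apply, ev, ev]
    ring
  · refine le_iInf fun q => ?_
    have hq := mem_degSpan_of_totalDegree_le q.2
    have := eLpNorm_le_of_orthogonal m2 (memLp_ev hα hβ' (dY S - q.1))
      (b2 _ (Submodule.sub_mem _ (dY_mem_degSpan hSd) hq))
    refine this.trans_eq (congrArg (fun k => eLpNorm k 2 _) (funext fun z => ?_))
    rw [ev_sub, Pi.sub_apply, ev, ev]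
    ring

end
end Tri

namespace Tri
noncomputable section

open Filter Topology

/-! ### Rotation of the triangle -/

/-- The affine map of order three that permutes the vertices of the triangle cyclically. -/
def rot (p : ℝ × ℝ) : ℝ × ℝ := (p.2, 1 - p.1 - p.2)

/-- The square of the linear part of `rot`, which is its inverse. -/
def rotVec (v : ℝ × ℝ) : ℝ × ℝ := (-v.1 - v.2, v.1)

variable {f f' g g' u : ℝ × ℝ → ℝ} {v w : ℝ × ℝ} {φ : ℝ × ℝ → ℝ}

lemma rot_rot_rot (p : ℝ × ℝ) : rot (rot (rot p)) = p := by
  ext <;> simp only [rot] <;> ring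

lemma comp_rot_three (f : ℝ × ℝ → ℝ) : ((f ∘ rot) ∘ rot) ∘ rot = f := by
  funext p; simp only [Function.comp, rot_rot_rot]

lemma rotVec_three (v : ℝ × ℝ) : rotVec (rotVec (rotVec v)) = v := by
  ext <;> simp only [rotVec] <;> ring

lemma contDiff_rot : ContDiff ℝ (⊤ : ℕ∞) rot := by unfold rot; fun_prop

lemma continuous_rot : Continuous rot := contDiff_rot.continuous

/-- `rot` as a homeomorphism. -/
def rotHomeo : ℝ × ℝ ≃ₜ ℝ × ℝ where
  toFun := rot
  invFun p := rot (rot p)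
  left_inv := rot_rot_rot
  right_inv := rot_rot_rot
  continuous_toFun := continuous_rot
  continuous_invFun := continuous_rot.comp continuous_rot

lemma measurableEmbedding_rot : MeasurableEmbedding rot := rotHomeo.measurableEmbedding

/-- A swap of coordinates followed by a shear with reflection. -/
lemma measurePreserving_rot : MeasurePreserving rot := by
  have h : MeasurePreserving (fun p : ℝ × ℝ => (id p.1, 1 - p.1 - p.2)) :=
    (MeasurePreserving.id volume).skew_product (g := fun x y : ℝ => 1 - x - y)
      (by simp only [Function.uncurry_def]; fun_prop)
      (Eventually.of_forall fun x => (Measure.measurePreserving_sub_left volume (1 - x)).map_eq)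
  have e : rot = (fun p : ℝ × ℝ => (id p.1, 1 - p.1 - p.2)) ∘ Prod.swap := by
    funext p
    simp only [Function.comp, Prod.swap, id, rot, sub_right_comm]
  rw [e]
  exact h.comp Measure.measurePreserving_swap

lemma mem_tri_rot {p : ℝ × ℝ} : rot p ∈ tri ↔ p ∈ tri := by
  simp only [tri, rot, Set.mem_ofPred_eq]
  constructor
  · rintro ⟨h1, h2, h3⟩; exact ⟨by linarith, h1, by linarith⟩
  · rintro ⟨h1, h2, h3⟩; exact ⟨h2, by linarith, by linarith⟩

lemma mem_closedTri_rot {p : ℝ × ℝ} : rot p ∈ closedTri ↔ p ∈ closedTri := by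
  simp only [closedTri, rot, Set.mem_ofPred_eq]
  constructor
  · rintro ⟨h1, h2, h3⟩; exact ⟨by linarith, h1, by linarith⟩
  · rintro ⟨h1, h2, h3⟩; exact ⟨h2, by linarith, by linarith⟩

lemma preimage_rot_tri : rot ⁻¹' tri = tri := Set.ext fun _ => mem_tri_rot

lemma measurePreserving_rot_restrict :
    MeasurePreserving rot (volume.restrict tri) (volume.restrict tri) := by
  have := measurePreserving_rot.restrict_preimage measurableSet_tri
  rwa [preimage_rot_tri] at this

lemma integral_comp_rot (F : ℝ × ℝ → ℝ) : ∫ p in tri, F (rot p) = ∫ p in tri, F p :=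
  measurePreserving_rot_restrict.integral_comp measurableEmbedding_rot F

lemma ae_comp_rot (h : f =ᵐ[volume.restrict tri] g) :
    f ∘ rot =ᵐ[volume.restrict tri] g ∘ rot :=
  measurePreserving_rot_restrict.quasiMeasurePreserving.ae_eq_comp h

/-! ### Weights and norms -/

variable {a b c : ℝ} {n : ℕ}

lemma weight_rot (p : ℝ × ℝ) : weight a b c (rot p) = weight c a b p := by
  simp only [weight, rot, show 1 - p.2 - (1 - p.1 - p.2) = p.1 by ring]
  ring

lemma measurePreserving_rot_wMeasure :
    MeasurePreserving rot (wMeasure c a b) (wMeasure a b c) := by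
  refine ⟨continuous_rot.measurable, Measure.ext fun s hs => ?_⟩
  rw [Measure.map_apply continuous_rot.measurable hs, wMeasure, wMeasure, withDensity_apply _ hs,
    withDensity_apply _ (continuous_rot.measurable hs),
    ← measurePreserving_rot_restrict.setLIntegral_comp_preimage_emb measurableEmbedding_rot
      (fun p => ENNReal.ofReal (weight a b c p))]
  simp only [weight_rot]

lemma wNorm_comp_rot (f : ℝ × ℝ → ℝ) : wNorm c a b (f ∘ rot) = wNorm a b c f := by
  rw [wNorm, wNorm, ← (measurePreserving_rot_wMeasure (a := a) (b := b) (c := c)).map_eq,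
    measurableEmbedding_rot.eLpNorm_map_measure]

lemma memLp_comp_rot (hf : MemLp f 2 (wMeasure a b c)) : MemLp (f ∘ rot) 2 (wMeasure c a b) :=
  hf.comp_measurePreserving measurePreserving_rot_wMeasure

lemma wInner_comp_rot (f g : ℝ × ℝ → ℝ) :
    wInner c a b (f ∘ rot) (g ∘ rot) = wInner a b c f g := by
  rw [wInner, wInner, ← integral_comp_rot (fun p => f p * g p * weight a b c p)]
  simp only [weight_rot, Function.comp]

lemma wNorm_congr (h : f =ᵐ[volume.restrict tri] g) : wNorm a b c f = wNorm a b c g :=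
  eLpNorm_congr_ae (wMeasure_absolutelyContinuous.ae_le h)

/-- Composition of a polynomial with `rot`. -/
def rotPoly : Poly2 →ₐ[ℝ] Poly2 := MvPolynomial.aeval ![yP, 1 - xP - yP]

lemma ev_rotPoly (p : Poly2) (z : ℝ × ℝ) : ev (rotPoly p) z = ev p (rot z) := by
  induction p using MvPolynomial.induction_on with
  | C c =>
    rw [ev_C, rotPoly, MvPolynomial.aeval_C]
    exact ev_C c z
  | add p q hp hq => rw [map_add, ev_add, ev_add, hp, hq]
  | mul_X p i hp =>
    rw [map_mul, ev_mul, ev_mul, hp, rotPoly, MvPolynomial.aeval_X]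
    congr 1
    fin_cases i
    · exact (ev_y z).trans (ev_x (rot z)).symm
    · refine Eq.trans ?_ (ev_y (rot z)).symm
      change ev (1 - xP - yP) z = _
      rw [ev_sub, ev_sub, ev_one, ev_x, ev_y, rot]

lemma totalDegree_rotPoly (p : Poly2) : (rotPoly p).totalDegree ≤ p.totalDegree := by
  have h0 : (1 - xP - yP : Poly2).totalDegree ≤ 1 := by
    refine (MvPolynomial.totalDegree_sub _ _).trans (max_le
      ((MvPolynomial.totalDegree_sub _ _).trans (max_le ?_ ?_)) ?_) <;>
    simp [MvPolynomial.totalDegree_X]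
  have h1 : (yP : Poly2).totalDegree ≤ 1 := by simp [MvPolynomial.totalDegree_X]
  rw [rotPoly, MvPolynomial.aeval_def, MvPolynomial.eval₂_eq']
  refine MvPolynomial.totalDegree_finsetSum_le fun d hd => ?_
  have h2 := MvPolynomial.le_totalDegree hd
  rw [Finsupp.sum_fintype _ _ (by simp), Fin.sum_univ_two] at h2
  rw [← Algebra.smul_def, Fin.prod_univ_two]
  refine (MvPolynomial.totalDegree_smul_le _ _).trans ((MvPolynomial.totalDegree_mul _ _).trans ?_)
  have h3 := (MvPolynomial.totalDegree_pow (yP : Poly2) (d 0)).trans (Nat.mul_le_mul_left _ h1)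
  have h4 := (MvPolynomial.totalDegree_pow (1 - xP - yP : Poly2) (d 1)).trans
    (Nat.mul_le_mul_left _ h0)
  simp only [Matrix.cons_val_zero, Matrix.cons_val_one]
  omega

/-- Rotation carries polynomials to polynomials without raising the degree. The sign `s = ±1`
accounts for directions that `rotVec` matches only up to sign. -/
lemma bestApprox_comp_rot_le {s : ℝ} (hs : s * s = 1)
    (h : g =ᵐ[volume.restrict tri] fun p => s * f (rot p)) :
    bestApprox n g c a b ≤ bestApprox n f a b c := by
  refine le_iInf fun q => ?_
  have hd : (s • rotPoly q.1).totalDegree ≤ n :=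
    (MvPolynomial.totalDegree_smul_le _ _).trans ((totalDegree_rotPoly _).trans q.2)
  refine (iInf_le _ ⟨s • rotPoly q.1, hd⟩).trans_eq ?_
  rw [← wNorm_comp_rot (a := a) (b := b) (c := c)]
  have e : wNorm c a b (fun p => g p - MvPolynomial.eval ![p.1, p.2] (s • rotPoly q.1)) =
      wNorm c a b (s • ((fun p => f p - MvPolynomial.eval ![p.1, p.2] q.1) ∘ rot)) := by
    refine wNorm_congr ?_
    filter_upwards [h] with p hp
    change g p - ev (s • rotPoly q.1) p = s * (f (rot p) - ev q.1 (rot p))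
    rw [hp, ev_smul, ev_rotPoly]
    ring
  rw [e, wNorm, wNorm, eLpNorm_const_smul]
  rcases mul_self_eq_one_iff.1 hs with rfl | rfl <;> simp

/-! ### Weak derivatives -/

lemma locallyIntegrableOn_comp {X Y : Type*} [TopologicalSpace X] [MeasurableSpace X]
    [TopologicalSpace Y] [MeasurableSpace Y] {μ : Measure X} {ν : Measure Y} {k : Y → ℝ}
    {r : X → Y} (hr : MeasurePreserving r μ ν) (hc : Continuous r) (he : MeasurableEmbedding r)
    {S : Set X} {T : Set Y} (hST : Set.MapsTo r S T) (hk : LocallyIntegrableOn k T ν) :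
    LocallyIntegrableOn (k ∘ r) S μ := by
  intro x hx
  obtain ⟨t, ht, hi⟩ := hk (r x) (hST hx)
  exact ⟨r ⁻¹' t, (hc.continuousWithinAt.tendsto_nhdsWithin hST) ht,
    (hr.integrableOn_comp_preimage he).2 hi⟩

lemma fderiv_comp_rot_rot (hφ : ContDiff ℝ (⊤ : ℕ∞) φ) (p v : ℝ × ℝ) :
    fderiv ℝ (fun p => φ (rot (rot p))) (rot p) v = fderiv ℝ φ p (rotVec v) := by
  have hx : HasFDerivAt (fun p : ℝ × ℝ => p.1) (ContinuousLinearMap.fst ℝ ℝ ℝ) (rot p) :=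
    hasFDerivAt_fst
  have hy : HasFDerivAt (fun p : ℝ × ℝ => p.2) (ContinuousLinearMap.snd ℝ ℝ ℝ) (rot p) :=
    hasFDerivAt_snd
  have h1 := (((hx.const_sub 1).sub hy).prodMk hx)
  have e : (fun p => φ (rot (rot p))) = φ ∘ fun p : ℝ × ℝ => (1 - p.1 - p.2, p.1) := by
    funext p; simp [rot]
  have h2 : ((1 - (rot p).1 - (rot p).2, (rot p).1) : ℝ × ℝ) = p := by
    ext <;> simp [rot]
  have h3 : HasFDerivAt φ (fderiv ℝ φ p) (1 - (rot p).1 - (rot p).2, (rot p).1) := by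
    rw [h2]; exact (hφ.differentiable (by simp) p).hasFDerivAt
  have h4 : fderiv ℝ (φ ∘ fun p : ℝ × ℝ => (1 - p.1 - p.2, p.1)) (rot p) = _ :=
    (h3.comp (rot p) h1).fderiv
  rw [e, h4]
  simp [rotVec]

/-- Change of variables, with the test function moved by `rot ∘ rot`, the inverse of `rot`. -/
lemma HasWeakDeriv.comp_rot (h : HasWeakDeriv v f u) :
    HasWeakDeriv (rotVec v) (f ∘ rot) (u ∘ rot) := by
  have hm : Set.MapsTo rot tri tri := fun p hp => mem_tri_rot.2 hp
  refine ⟨locallyIntegrableOn_comp measurePreserving_rot continuous_rot measurableEmbedding_rot hm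
    h.1, locallyIntegrableOn_comp measurePreserving_rot continuous_rot measurableEmbedding_rot hm
    h.2.1, fun φ h1 h2 h3 => ?_⟩
  have hs : tsupport (fun p => φ (rot (rot p))) ∩ closedTri ⊆ tri := by
    rintro p ⟨hp, -⟩
    have := h3 (closure_minimal (t := (rot ∘ rot) ⁻¹' tsupport φ)
      (fun q hq => subset_tsupport φ hq)
      ((isClosed_tsupport φ).preimage (continuous_rot.comp continuous_rot)) hp)
    exact mem_tri_rot.1 (mem_tri_rot.1 this)
  have key := h.integral_eq (h1.comp (contDiff_rot.comp contDiff_rot)) hs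
  rw [← integral_comp_rot, ← integral_comp_rot (fun p => u p * _)] at key
  simp only [Function.comp_def, rot_rot_rot] at key ⊢
  rw [← key]
  exact integral_congr_ae (Eventually.of_forall fun p => by
    simp only [fderiv_comp_rot_rot h1])

lemma HasWeakDeriv.const_smul (h : HasWeakDeriv v f u) (s : ℝ) :
    HasWeakDeriv (s • v) f fun p => s * u p := by
  have := h.combo_dir h s 0
  simpa using this

lemma exists_hasWeakDeriv_comp_rot {s : ℝ} (hs : s * s = 1) (hw : w = s • rotVec v)
    (h : HasWeakDeriv w (f ∘ rot) u) : ∃ u', HasWeakDeriv v f u' := by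
  have h1 := h.const_smul s
  rw [hw, smul_smul, hs, one_smul] at h1
  have h2 := h1.comp_rot.comp_rot
  rw [rotVec_three, comp_rot_three] at h2
  exact ⟨_, h2⟩

/-- If `f` has no weak derivative, neither has `f ∘ rot`, as `rot` has order three; then both sides
are the default value `0`. So no regularity of `f` is required. -/
lemma weakDeriv_comp_rot {s : ℝ} (hs : s * s = 1) (hw : w = s • rotVec v) (f : ℝ × ℝ → ℝ) :
    weakDeriv w (f ∘ rot) =ᵐ[volume.restrict tri] fun p => s * weakDeriv v f (rot p) := by
  by_cases hex : ∃ u, HasWeakDeriv v f u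
  · obtain ⟨u, hu⟩ := hex
    have := (hasWeakDeriv_weakDeriv hu).comp_rot.const_smul s
    rw [← hw] at this
    exact weakDeriv_ae_eq this
  · have hex' : ¬ ∃ u, HasWeakDeriv w (f ∘ rot) u := fun ⟨u, hu⟩ =>
      hex (exists_hasWeakDeriv_comp_rot hs hw hu)
    rw [weakDeriv, weakDeriv, dif_neg hex, dif_neg hex']
    exact Eventually.of_forall fun p => by simp

lemma d1_eq : d1 = (-1 : ℝ) • rotVec d2 := by ext <;> simp [d1, d2, rotVec]
lemma d2_eq : d2 = (-1 : ℝ) • rotVec d3 := by ext <;> simp [d2, d3, rotVec]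
lemma d3_eq : d3 = (1 : ℝ) • rotVec d1 := by ext <;> simp [d1, d3, rotVec]

lemma MemSobolev.comp_rot (h : MemSobolev a b c f) : MemSobolev c a b (f ∘ rot) := by
  obtain ⟨h0, ⟨u₁, h1, m1⟩, ⟨u₂, h2, m2⟩, ⟨u₃, h3, m3⟩⟩ := h
  refine ⟨memLp_comp_rot h0, ⟨_, ?_, (memLp_comp_rot m2).const_mul (-1)⟩,
    ⟨_, ?_, (memLp_comp_rot m3).const_mul (-1)⟩, ⟨_, ?_, (memLp_comp_rot m1).const_mul 1⟩⟩
  · rw [d1_eq]; exact h2.comp_rot.const_smul _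
  · rw [d2_eq]; exact h3.comp_rot.const_smul _
  · rw [d3_eq]; exact h1.comp_rot.const_smul _

lemma wInner_weakDeriv_comp_rot {s : ℝ} (hs : s * s = 1) (hw : w = s • rotVec v)
    (f g : ℝ × ℝ → ℝ) : wInner c a b (weakDeriv w (f ∘ rot)) (weakDeriv w (g ∘ rot)) =
      wInner a b c (weakDeriv v f) (weakDeriv v g) := by
  rw [← wInner_comp_rot (weakDeriv v f), wInner, wInner]
  refine integral_congr_ae ?_
  filter_upwards [weakDeriv_comp_rot hs hw f, weakDeriv_comp_rot hs hw g] with p h1 h2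
  rw [h1, h2]
  simp only [Function.comp]
  linear_combination (weakDeriv v f (rot p) * weakDeriv v g (rot p) * weight c a b p) * hs

/-- The representative is chosen from a predicate that does not distinguish `f` from `f'`, hence
equality everywhere. -/
lemma weakDeriv_congr (h : f =ᵐ[volume.restrict tri] f') : weakDeriv v f = weakDeriv v f' := by
  classical
  have e : HasWeakDeriv v f = HasWeakDeriv v f' := funext fun u =>
    propext ⟨fun hu => hu.congr_fun_left h, fun hu => hu.congr_fun_left h.symm⟩
  have e' : ∀ f, weakDeriv v f = (fun P : (ℝ × ℝ → ℝ) → Prop =>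
      if h : ∃ g, P g then h.choose else 0) (HasWeakDeriv v f) := fun f => by
    simp only [weakDeriv]
  rw [e', e', e]

/-! ### Traces -/

/-- The unit interval reversed. -/
def rev (t : ℝ) : ℝ := 1 - t

lemma rev_rev (t : ℝ) : rev (rev t) = t := by simp [rev]

/-- Data for the transport of traces from the edge `e` to the edge `e'` by `rot`; here `r` is the
change of parameter. -/
structure EdgeRot (e : ℝ → ℝ × ℝ) (N : ℝ × ℝ) (e' : ℝ → ℝ × ℝ) (N' : ℝ × ℝ) (r : ℝ → ℝ) :
    Prop where
  pres : MeasurePreserving r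
  cont : Continuous r
  emb : MeasurableEmbedding r
  pre : r ⁻¹' Set.Ioo 0 1 = Set.Ioo 0 1
  edge : ∀ t, rot (e' t) = e (r t)
  normal : ∀ v : ℝ × ℝ, v.1 * N.1 + v.2 * N.2 = (rotVec v).1 * N'.1 + (rotVec v).2 * N'.2

/-- The divergence identity for `f` is used with the test function moved by `rot ∘ rot` and the
direction `rotVec (rotVec v)`; `EdgeRot` matches edge parameters and normals. -/
lemma IsTrace.comp_rot {e e' : ℝ → ℝ × ℝ} {N N' : ℝ × ℝ} {r : ℝ → ℝ} {k : ℝ → ℝ}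
    (hr : EdgeRot e N e' N' r) (h : IsTrace e N f k) : IsTrace e' N' (f ∘ rot) (k ∘ r) := by
  have hr0 : Set.MapsTo r (Set.Ioo 0 1) (Set.Ioo 0 1) := fun t ht => by
    rw [← hr.pre] at ht; exact ht
  have hm : Set.MapsTo rot (tri ∪ e' '' Set.Ioo 0 1) (tri ∪ e '' Set.Ioo 0 1) := by
    rintro p (hp | ⟨t, ht, rfl⟩)
    · exact Or.inl (mem_tri_rot.2 hp)
    · exact Or.inr ⟨r t, hr0 ht, (hr.edge t).symm⟩
  refine ⟨locallyIntegrableOn_comp hr.pres hr.cont hr.emb hr0 h.1,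
    locallyIntegrableOn_comp measurePreserving_rot continuous_rot measurableEmbedding_rot hm h.2.1,
    fun v => ?_⟩
  obtain ⟨u, h1, h2, h3⟩ := h.2.2 (rotVec (rotVec v))
  have h1' := h1.comp_rot
  rw [rotVec_three] at h1'
  refine ⟨_, h1', locallyIntegrableOn_comp measurePreserving_rot continuous_rot
    measurableEmbedding_rot hm h2, fun φ c1 c2 c3 => ?_⟩
  have hs : tsupport (fun p => φ (rot (rot p))) ∩ closedTri ⊆ tri ∪ e '' Set.Ioo 0 1 := by
    rintro p ⟨hp, hp'⟩
    have := hm (c3 ⟨closure_minimal (t := (rot ∘ rot) ⁻¹' tsupport φ)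
      (fun q hq => subset_tsupport φ hq)
      ((isClosed_tsupport φ).preimage (continuous_rot.comp continuous_rot)) hp,
      mem_closedTri_rot.2 (mem_closedTri_rot.2 hp')⟩)
    rwa [Function.comp, rot_rot_rot] at this
  have key := h3 _ (c1.comp (contDiff_rot.comp contDiff_rot))
    (c2.comp_homeomorph (rotHomeo.trans rotHomeo)) hs
  have e1 : ∫ t in Set.Ioo (0 : ℝ) 1, k t * φ (rot (rot (e t))) =
      ∫ t in Set.Ioo (0 : ℝ) 1, k (r t) * φ (e' t) := by
    have := (hr.pres.restrict_preimage_emb hr.emb (Set.Ioo 0 1)).integral_comp hr.emb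
      fun t => k t * φ (rot (rot (e t)))
    rw [hr.pre] at this
    rw [← this]
    simp only [← hr.edge, rot_rot_rot]
  rw [← integral_comp_rot] at key
  simp only [Function.comp_def, rot_rot_rot] at key ⊢
  rw [e1, hr.normal, rotVec_three] at key
  rw [← key]
  exact integral_congr_ae (Eventually.of_forall fun p => by
    change _ = f (rot p) * fderiv ℝ (fun p => φ (rot (rot p))) (rot p) (rotVec (rotVec v)) + _
    rw [fderiv_comp_rot_rot c1, rotVec_three])

lemma measurePreserving_rev : MeasurePreserving rev := Measure.measurePreserving_sub_left volume 1

lemma measurableEmbedding_rev : MeasurableEmbedding rev :=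
  (Homeomorph.subLeft (1 : ℝ)).measurableEmbedding

lemma preimage_rev : rev ⁻¹' Set.Ioo 0 1 = Set.Ioo 0 1 := by
  ext t
  simp only [Set.mem_preimage, Set.mem_Ioo, rev]
  constructor <;> rintro ⟨h1, h2⟩ <;> constructor <;> linarith

lemma continuous_rev : Continuous rev := continuous_const.sub continuous_id

lemma measurePreserving_rev_restrict :
    MeasurePreserving rev (volume.restrict (Set.Ioo 0 1)) (volume.restrict (Set.Ioo 0 1)) := by
  have := measurePreserving_rev.restrict_preimage (measurableSet_Ioo (a := (0 : ℝ)) (b := 1))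
  rwa [preimage_rev] at this

lemma ae_comp_rev {k k' : ℝ → ℝ} (h : k =ᵐ[volume.restrict (Set.Ioo 0 1)] k') :
    k ∘ rev =ᵐ[volume.restrict (Set.Ioo 0 1)] k' ∘ rev :=
  measurePreserving_rev_restrict.quasiMeasurePreserving.ae_eq_comp h

lemma edgeRot_YZ : EdgeRot (fun t => (t, 0)) (0, -1) (fun t => (t, 1 - t)) (1, 1) rev := by
  refine ⟨measurePreserving_rev, continuous_rev, measurableEmbedding_rev, preimage_rev,
    fun t => ?_, fun v => ?_⟩
  · ext <;> simp [rot, rev]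
  · simp only [rotVec]; ring

lemma edgeRot_XY : EdgeRot (fun t => (0, t)) (-1, 0) (fun t => (t, 0)) (0, -1) rev := by
  refine ⟨measurePreserving_rev, continuous_rev, measurableEmbedding_rev, preimage_rev,
    fun t => ?_, fun v => ?_⟩
  · ext <;> simp [rot, rev]
  · simp [rotVec]

lemma edgeRot_ZX : EdgeRot (fun t => (t, 1 - t)) (1, 1) (fun t => (0, t)) (-1, 0) id := by
  refine ⟨MeasurePreserving.id _, continuous_id, MeasurableEmbedding.id, rfl, fun t => ?_,
    fun v => ?_⟩
  · ext <;> simp [rot]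
  · simp only [rotVec]; ring

lemma trace_spec {e : ℝ → ℝ × ℝ} {N : ℝ × ℝ} (h : ∃ k, IsTrace e N f k) :
    IsTrace e N f (trace e N f) := by
  rw [trace, dif_pos h]
  exact h.choose_spec

lemma trace_eq_zero {e : ℝ → ℝ × ℝ} {N : ℝ × ℝ} (h : ¬ ∃ k, IsTrace e N f k) :
    trace e N f = 0 := by rw [trace, dif_neg h]

lemma traceZ_comp_rot (f : ℝ × ℝ → ℝ) :
    traceZ (f ∘ rot) =ᵐ[volume.restrict (Set.Ioo 0 1)] traceY f ∘ rev := by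
  by_cases h : ∃ k, IsTrace (fun t => (t, 0)) (0, -1) f k
  · exact traceZ_ae_eq ((trace_spec h).comp_rot edgeRot_YZ)
  · have h' : ¬ ∃ k, IsTrace (fun t => (t, 1 - t)) (1, 1) (f ∘ rot) k := by
      rintro ⟨k, hk⟩
      have := (hk.comp_rot edgeRot_ZX).comp_rot edgeRot_XY
      rw [comp_rot_three] at this
      exact h ⟨_, this⟩
    rw [traceZ, traceY, trace_eq_zero h, trace_eq_zero h']
    rfl

/-- Uniqueness of traces is known on the edge `x + y = 1`, so two traces on `y = 0` are compared
after one more rotation. -/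
lemma traceY_comp_rot (f : ℝ × ℝ → ℝ) :
    traceY (f ∘ rot) =ᵐ[volume.restrict (Set.Ioo 0 1)] traceX f ∘ rev := by
  by_cases h : ∃ k, IsTrace (fun t => (0, t)) (-1, 0) f k
  · have h1 := (trace_spec h).comp_rot edgeRot_XY
    have h2 := (trace_spec ⟨_, h1⟩).comp_rot edgeRot_YZ
    have h3 := ae_comp_rev (h2.ae_eq (h1.comp_rot edgeRot_YZ))
    have e : ∀ k : ℝ → ℝ, (k ∘ rev) ∘ rev = k := fun k => by
      funext t; simp only [Function.comp, rev_rev]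
    rwa [e, e] at h3
  · have h' : ¬ ∃ k, IsTrace (fun t => (t, 0)) (0, -1) (f ∘ rot) k := by
      rintro ⟨k, hk⟩
      have := (hk.comp_rot edgeRot_YZ).comp_rot edgeRot_ZX
      rw [comp_rot_three] at this
      exact h ⟨_, this⟩
    rw [traceY, traceX, trace_eq_zero h, trace_eq_zero h']
    rfl

lemma traceZ_congr (h : f =ᵐ[volume.restrict tri] f') : traceZ f = traceZ f' := by
  classical
  have e : IsTrace (fun t => (t, 1 - t)) (1, 1) f = IsTrace (fun t => (t, 1 - t)) (1, 1) f' :=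
    funext fun u => propext ⟨fun hu => hu.congr_fun h, fun hu => hu.congr_fun h.symm⟩
  have e' : ∀ f, traceZ f = (fun P : (ℝ → ℝ) → Prop =>
      if h : ∃ g, P g then h.choose else 0) (IsTrace (fun t => (t, 1 - t)) (1, 1) f) := fun f => by
    simp only [traceZ, trace]
  rw [e', e', e]

lemma edgeInner_comp_rev {k k' l l' : ℝ → ℝ} (hk : k =ᵐ[volume.restrict (Set.Ioo 0 1)] l ∘ rev)
    (hk' : k' =ᵐ[volume.restrict (Set.Ioo 0 1)] l' ∘ rev) :
    edgeInner a b k k' = edgeInner b a l l' := by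
  rw [edgeInner, edgeInner, ← measurePreserving_rev_restrict.integral_comp measurableEmbedding_rev
    (fun t => l t * l' t * (t ^ b * (1 - t) ^ a))]
  refine integral_congr_ae ?_
  filter_upwards [hk, hk'] with t h1 h2
  simp only [h1, h2, Function.comp, rev, sub_sub_cancel]
  ring

/-! ### The Sobolev inner products and the partial sums -/

variable {lam : ℝ}

lemma sobZ_comp_rot (lam a c : ℝ) (f g : ℝ × ℝ → ℝ) :
    sobZ lam c a (f ∘ rot) (g ∘ rot) = sobY lam a c f g := by
  rw [sobZ, sobY, wInner_weakDeriv_comp_rot (by norm_num) d1_eq,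
    wInner_weakDeriv_comp_rot (by norm_num) d2_eq,
    edgeInner_comp_rev (traceZ_comp_rot f) (traceZ_comp_rot g)]

lemma sobY_comp_rot (lam b c : ℝ) (f g : ℝ × ℝ → ℝ) :
    sobY lam c b (f ∘ rot) (g ∘ rot) = sobX lam b c f g := by
  rw [sobY, sobX, wInner_weakDeriv_comp_rot (by norm_num) d2_eq,
    wInner_weakDeriv_comp_rot (by norm_num) d3_eq,
    edgeInner_comp_rev (traceY_comp_rot f) (traceY_comp_rot g)]

lemma sobZ_congr (hf : f =ᵐ[volume.restrict tri] f') (hg : g =ᵐ[volume.restrict tri] g') :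
    sobZ lam a b f g = sobZ lam a b f' g' := by
  rw [sobZ, sobZ, weakDeriv_congr hf, weakDeriv_congr hg, weakDeriv_congr hf, weakDeriv_congr hg,
    traceZ_congr hf, traceZ_congr hg]

lemma sobY_congr (hf : f =ᵐ[volume.restrict tri] f') (hg : g =ᵐ[volume.restrict tri] g') :
    sobY lam a b f g = sobY lam a b f' g' := by
  rw [← sobZ_comp_rot, ← sobZ_comp_rot, sobZ_congr (ae_comp_rot hf) (ae_comp_rot hg)]

lemma basisK_rot {k m : ℕ} {p : ℝ × ℝ} (hp : p ∈ tri) :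
    basisK a b c k m (rot p) = basisJ c a b k m p := by
  have hs : p.1 + p.2 ≠ 0 := (add_pos hp.1 hp.2.1).ne'
  rw [basisK, basisJ]
  simp only [rot]
  have e1 : 1 - (1 - p.1 - p.2) = p.1 + p.2 := by ring
  have e2 : 2 * p.2 / (p.1 + p.2) - 1 = (p.2 - p.1) / (p.1 + p.2) := by field_simp; ring
  have e3 : 2 * (1 - p.1 - p.2) - 1 = 1 - 2 * p.1 - 2 * p.2 := by ring
  rw [e1, e2, e3, add_right_comm (2 * (k : ℝ)) a c]

lemma basisL_rot {k m : ℕ} {p : ℝ × ℝ} (hp : p ∈ tri) :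
    basisL a b c k m (rot p) = basisK c a b k m p := by
  have hs : 1 - p.2 ≠ 0 := (sub_pos.2 (by linarith [hp.1, hp.2.2] : p.2 < 1)).ne'
  rw [basisL, basisK]
  simp only [rot]
  have e2 : 1 - 2 * (1 - p.1 - p.2) / (1 - p.2) = 2 * p.1 / (1 - p.2) - 1 := by field_simp; ring
  rw [e2, add_right_comm (2 * (k : ℝ)) b c]

/-- The rotated basis agrees with the target basis only on the triangle, since the quotients in the
definition may degenerate outside; hence the hypothesis that `B'` ignores null sets. -/
lemma fourierSum_rot {B B' : (ℝ × ℝ → ℝ) → (ℝ × ℝ → ℝ) → ℝ} {P P' : ℕ → ℕ → ℝ × ℝ → ℝ}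
    (hB : ∀ f g, B' (f ∘ rot) (g ∘ rot) = B f g)
    (hB' : ∀ f f' g g', f =ᵐ[volume.restrict tri] f' → g =ᵐ[volume.restrict tri] g' →
      B' f g = B' f' g')
    (hP : ∀ k m, ∀ p ∈ tri, P k m (rot p) = P' k m p) (n : ℕ) (f : ℝ × ℝ → ℝ) {p : ℝ × ℝ}
    (hp : p ∈ tri) : fourierSum B P n f (rot p) = fourierSum B' P' n (f ∘ rot) p := by
  have e : ∀ k m, P k m ∘ rot =ᵐ[volume.restrict tri] P' k m := fun k m => by
    filter_upwards [ae_restrict_mem measurableSet_tri] with p hp using hP k m p hp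
  rw [fourierSum, fourierSum]
  refine Finset.sum_congr rfl fun m _ => Finset.sum_congr rfl fun k _ => ?_
  rw [← hB, ← hB, hB' _ _ _ _ (EventuallyEq.refl _ _) (e k m), hB' _ _ _ _ (e k m) (e k m),
    hP k m p hp]

lemma sumY_rot (lam a c : ℝ) (n : ℕ) (f : ℝ × ℝ → ℝ) {p : ℝ × ℝ} (hp : p ∈ tri) :
    sumY lam a c n f (rot p) = sumZ lam c a n (f ∘ rot) p :=
  fourierSum_rot (sobZ_comp_rot lam a c) (fun _ _ _ _ => sobZ_congr) (fun _ _ _ => basisK_rot) n f hp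

lemma sumX_rot (lam b c : ℝ) (n : ℕ) (f : ℝ × ℝ → ℝ) {p : ℝ × ℝ} (hp : p ∈ tri) :
    sumX lam b c n f (rot p) = sumY lam c b n (f ∘ rot) p :=
  fourierSum_rot (sobY_comp_rot lam b c) (fun _ _ _ _ => sobY_congr) (fun _ _ _ => basisL_rot) n f hp

/-- The error estimate for the parameters `(a, -1, c)`. -/
theorem sumY_estimate (ha : -1 < a) (hc : -1 < c) (hl : 0 < lam) (hf : MemSobolev a 0 c f)
    (hn : 1 ≤ n) :
    wNorm a 0 c (fun p => f p - sumY lam a c n f p) ≤ ENNReal.ofReal (3 / n) *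
      (bestApprox (n - 1) (weakDeriv d2 f) a 0 (c + 1) +
        bestApprox (n - 1) (weakDeriv d3 f) (a + 1) 0 c) := by
  rw [← wNorm_comp_rot]
  have e : (fun p => f p - sumY lam a c n f p) ∘ rot =ᵐ[volume.restrict tri]
      fun p => (f ∘ rot) p - sumZ lam c a n (f ∘ rot) p := by
    filter_upwards [ae_restrict_mem measurableSet_tri] with p hp
    simp only [Function.comp, sumY_rot lam a c n f hp]
  rw [wNorm_congr e]
  refine (sumZ_estimate hc ha hl hf.comp_rot hn).trans ?_
  gcongr
  · exact bestApprox_comp_rot_le (by norm_num) (weakDeriv_comp_rot (by norm_num) d1_eq f)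
  · exact bestApprox_comp_rot_le (by norm_num) (weakDeriv_comp_rot (by norm_num) d2_eq f)

/-- The error estimate for the parameters `(-1, b, c)`. -/
theorem sumX_estimate (hb : -1 < b) (hc : -1 < c) (hl : 0 < lam) (hf : MemSobolev 0 b c f)
    (hn : 1 ≤ n) :
    wNorm 0 b c (fun p => f p - sumX lam b c n f p) ≤ ENNReal.ofReal (3 / n) *
      (bestApprox (n - 1) (weakDeriv d3 f) 0 (b + 1) c +
        bestApprox (n - 1) (weakDeriv d1 f) 0 b (c + 1)) := by
  rw [← wNorm_comp_rot]
  have e : (fun p => f p - sumX lam b c n f p) ∘ rot =ᵐ[volume.restrict tri]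
      fun p => (f ∘ rot) p - sumY lam c b n (f ∘ rot) p := by
    filter_upwards [ae_restrict_mem measurableSet_tri] with p hp
    simp only [Function.comp, sumX_rot lam b c n f hp]
  rw [wNorm_congr e]
  refine (sumY_estimate hc hb hl hf.comp_rot hn).trans ?_
  gcongr
  · exact bestApprox_comp_rot_le (by norm_num) (weakDeriv_comp_rot (by norm_num) d2_eq f)
  · exact bestApprox_comp_rot_le (by norm_num) (weakDeriv_comp_rot (by norm_num) d3_eq f)

end
end Tri

/-! ### The theorem -/

theorem theorem12p1 :
    (∀ α β : ℝ, -1 < α → -1 < β → ∃ c : ℝ, 0 < c ∧ ∀ lam : ℝ, 0 < lam →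
      ∀ f : ℝ × ℝ → ℝ, Tri.MemSobolev α β 0 f → ∀ n : ℕ, 1 ≤ n →
        Tri.wNorm α β 0 (fun p => f p - Tri.sumZ lam α β n f p) ≤
          ENNReal.ofReal (c / n) *
            (Tri.bestApprox (n - 1) (Tri.weakDeriv Tri.d1 f) (α + 1) β 0 +
              Tri.bestApprox (n - 1) (Tri.weakDeriv Tri.d2 f) α (β + 1) 0)) ∧
    (∀ α γ : ℝ, -1 < α → -1 < γ → ∃ c : ℝ, 0 < c ∧ ∀ lam : ℝ, 0 < lam →
      ∀ f : ℝ × ℝ → ℝ, Tri.MemSobolev α 0 γ f → ∀ n : ℕ, 1 ≤ n →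
        Tri.wNorm α 0 γ (fun p => f p - Tri.sumY lam α γ n f p) ≤
          ENNReal.ofReal (c / n) *
            (Tri.bestApprox (n - 1) (Tri.weakDeriv Tri.d2 f) α 0 (γ + 1) +
              Tri.bestApprox (n - 1) (Tri.weakDeriv Tri.d3 f) (α + 1) 0 γ)) ∧
    (∀ β γ : ℝ, -1 < β → -1 < γ → ∃ c : ℝ, 0 < c ∧ ∀ lam : ℝ, 0 < lam →
      ∀ f : ℝ × ℝ → ℝ, Tri.MemSobolev 0 β γ f → ∀ n : ℕ, 1 ≤ n →
        Tri.wNorm 0 β γ (fun p => f p - Tri.sumX lam β γ n f p) ≤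
          ENNReal.ofReal (c / n) *
            (Tri.bestApprox (n - 1) (Tri.weakDeriv Tri.d3 f) 0 (β + 1) γ +
              Tri.bestApprox (n - 1) (Tri.weakDeriv Tri.d1 f) 0 β (γ + 1))) := by
  -- The constant `3` is the root of the `9` in `functional_bound`, independent of all parameters.
  refine ⟨fun α β hα hβ => ⟨3, by norm_num, fun lam hl f hf n hn => ?_⟩,
    fun α γ hα hγ => ⟨3, by norm_num, fun lam hl f hf n hn => ?_⟩,
    fun β γ hβ hγ => ⟨3, by norm_num, fun lam hl f hf n hn => ?_⟩⟩
  · exact Tri.sumZ_estimate hα hβ hl hf hn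
  · exact Tri.sumY_estimate hα hγ hl hf hn
  · exact Tri.sumX_estimate hβ hγ hl hf hn
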